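/- Let $p>3$ be a prime, $K=\mathbb{Q}(\sqrt{-p})$, $O_K$ its ring of integers and $O=\mathbb{Z}[2\sqrt{-p}]$. Call a prime $q$ *admissible* if $q\equiv 3\pmod 8$ and $\left(\frac{p}{q}\right)=-1$. For admissible $q$ and an integer $r$ with $q\mid r^2+p$, write the quaternion algebra $B_{p,\infty}$ over $\mathbb{Q}$ ramified exactly at $p$ and $\infty$ as $\mathbb{Q}+\mathbb{Q}\alpha+\mathbb{Q}\beta+\mathbb{Q}\alpha\beta$ with $\alpha^2=-p$, $\beta^2=-q$, $\alpha\beta=-\beta\alpha$, embed $K$ in it by $\sqrt{-p}\mapsto\alpha$, and put $$\mathcal{O}(q,r)=\mathbb{Z}+\mathbb{Z}\,\tfrac{1+\beta}{2}+\mathbb{Z}\,\tfrac{\alpha(1+\beta)}{2}+\mathbb{Z}\,\tfrac{(r+\alpha)\beta}{q}.$$ For an integer $f\ge 2$ let $P_{\mathbb{Z}}(f)$ be the group of fractional $O_K$-ideals generated by the principal ideals $\alpha O_K$ with $\alpha\in O_K$ congruent modulo $fO_K$ to an integer prime to $f$. Write $[a,b]=\mathbb{Z}a+\mathbb{Z}b$.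 For an ideal $\mathfrak{l}$ of $O$ put $\mathfrak{l}^{-1}=\{x\in K: x\mathfrak{l}\subseteq O\}$, and let $\mathfrak{l}^{-1}\mathcal{O}(q,r)\mathfrak{l}$ be the additive group generated by the products $xyz$ with $x\in\mathfrak{l}^{-1}$, $y\in\mathcal{O}(q,r)$, $z\in\mathfrak{l}$. Let $q_1$ be admissible, let $r_1$ be an integer with $q_1\mid r_1^2+p$, and let $\bar{\mathfrak{q}}_1=[q_1,2r_1-2\sqrt{-p}]$ be the conjugate of the ideal $\mathfrak{q}_1=[q_1,2r_1+2\sqrt{-p}]$ of $O$. (1) Let $\mathfrak{l}$ be an ideal of $O$ whose norm $\#(O/\mathfrak{l})=\ell$ is an odd prime. Then there are an admissible prime $q_2$ and a prime ideal $\mathfrak{q}_2$ of $O_K$ of norm $q_2$ such that $\mathfrak{q}_2\in(\bar{\mathfrak{q}}_1\mathfrak{l}^2O_K)P_{\mathbb{Z}}(2)$ if $p\equiv1\pmod 4$, and $\mathfrak{q}_2\in(\bar{\mathfrak{q}}_1\mathfrak{l}^2O_K)P_{\mathbb{Z}}(4)$ if $p\equiv3\pmod 4$; integers $r_2$ with $q_2\mid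 r_2^2+p$ exist, and for every such $r_2$ the lattices $\mathfrak{l}^{-1}\mathcal{O}(q_1,r_1)\mathfrak{l}$ and $\mathcal{O}(q_2,r_2)$ are isomorphic rings. (2) Let $p\equiv1\pmod4$ and $\mathfrak{l}=[8,2+2\sqrt{-p}]$. Then $\mathfrak{l}$ is a proper ideal of $O$, that is, $\{x\in K:x\mathfrak{l}\subseteq\mathfrak{l}\}=O$. Moreover there are an admissible prime $q_2$ and a prime ideal $\mathfrak{q}_2$ of $O_K$ of norm $q_2$ lying in the coset of $P_{\mathbb{Z}}(2)$ that corresponds to the class of $\bar{\mathfrak{q}}_1\mathfrak{l}^2$ under the canonical isomorphism of the class group $C(O)$ with the ring class group modulo $P_{\mathbb{Z}}(2)$ (that is, $\mathfrak{q}_2\in(\mathfrak{a}O_K)P_{\mathbb{Z}}(2)$ for some ideal $\mathfrak{a}$ of $O$ prime to $2$ and equivalent to $\bar{\mathfrak{q}}_1\mathfrak{l}^2$); integers $r_2$ with $q_2\mid r_2^2+p$ exist, and for every such $r_2$ the lattices $\mathfrak{l}^{-1}\mathcal{O}(q_1,r_1)\mathfrak{l}$ and $\mathcal{O}(q_2,r_2)$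 are isomorphic rings. -/

import Mathlib

open scoped Quaternion nonZeroDivisors NumberField

noncomputable section

namespace SupersingularOrders

/-- The imaginary quadratic field `K = ℚ(√-p)`, with elements `x + y√-p` for `x y : ℚ`. -/
abbrev QuadField (p : ℕ) : Type := QuadraticAlgebra ℚ (-(p : ℚ)) 0

instance factNotSquare (p : ℕ) [hp : Fact p.Prime] :
    Fact (∀ r : ℚ, r ^ 2 ≠ -(p : ℚ) + 0 * r) := ⟨fun r h => by
  have h1 : (0 : ℚ) < p := by exact_mod_cast hp.out.pos
  nlinarith [sq_nonneg r]⟩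

instance numberField (p : ℕ) [Fact p.Prime] : NumberField (QuadField p) where
  to_charZero := inferInstance
  to_finiteDimensional := by
    have h : FiniteDimensional ℚ (QuadField p) := inferInstance
    convert h

/-- `√-p` as an element of the ring of integers `O_K`. -/
def sqrtNeg (p : ℕ) [Fact p.Prime] : 𝓞 (QuadField p) :=
  ⟨⟨0, 1⟩, by
    refine ⟨Polynomial.X ^ 2 + Polynomial.C (p : ℤ), Polynomial.monic_X_pow_add_C _ two_ne_zero, ?_⟩
    ext <;> simp [sq]⟩

/-- The order `O = ℤ[2√-p]` of `K`, as a subring of `O_K`. -/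
abbrev order (p : ℕ) [Fact p.Prime] : Subalgebra ℤ (𝓞 (QuadField p)) :=
  Algebra.adjoin ℤ {2 * sqrtNeg p}

/-- `2√-p` as an element of `O`. -/
def twoSqrt (p : ℕ) [Fact p.Prime] : order p :=
  ⟨2 * sqrtNeg p, Algebra.subset_adjoin rfl⟩

/-- The ideal `[q, 2r - 2√-p]` of `O`, the conjugate of `[q, 2r + 2√-p]`. When `q ∣ r² + p` the
ideal generated by these two elements is also their `ℤ`-span. -/
def idealQConj (p : ℕ) [Fact p.Prime] (q : ℕ) (r : ℤ) : Ideal (order p) :=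
  Ideal.span {(q : order p), 2 * (r : order p) - twoSqrt p}

/-- The ideal `[8, 2 + 2√-p]` of `O`. When `p` is odd the ideal generated by these two
elements is also their `ℤ`-span. -/
def idealTwo (p : ℕ) [Fact p.Prime] : Ideal (order p) :=
  Ideal.span {(8 : order p), 2 + twoSqrt p}

/-- An ideal of `O`, viewed as a `ℤ`-lattice in `K`. -/
def lattice (p : ℕ) [Fact p.Prime] (I : Ideal (order p)) : Submodule ℤ (QuadField p) :=
  Submodule.span ℤ ((fun x : order p => ((x : 𝓞 (QuadField p)) : QuadField p)) '' (I : Set (order p)))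

/-- `I⁻¹ = {x ∈ K : x I ⊆ O}`. -/
def latticeInv (p : ℕ) [Fact p.Prime] (I : Ideal (order p)) : Submodule ℤ (QuadField p) :=
  lattice p ⊤ / lattice p I

/-- An ideal `I` of `O` is proper if `{x ∈ K : x I ⊆ I} = O`. -/
def IsProperIdeal (p : ℕ) [Fact p.Prime] (I : Ideal (order p)) : Prop :=
  lattice p I / lattice p I = lattice p ⊤

/-- The ideal `I O_K` of `O_K`. -/
def extend (p : ℕ) [Fact p.Prime] (I : Ideal (order p)) : Ideal (𝓞 (QuadField p)) :=
  I.map (order p).val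

/-- `P_ℤ(f)`: the group of fractional ideals of `O_K` generated by the principal ideals `α O_K`,
where `α ∈ O_K` is congruent modulo `f O_K` to an integer prime to `f`. -/
def PZ (p : ℕ) [Fact p.Prime] (f : ℕ) :
    Subgroup (FractionalIdeal (𝓞 (QuadField p))⁰ (QuadField p))ˣ :=
  Subgroup.closure {J | ∃ (α : 𝓞 (QuadField p)) (a : ℤ), IsCoprime a (f : ℤ) ∧
    (f : 𝓞 (QuadField p)) ∣ α - (a : 𝓞 (QuadField p)) ∧
    (J : FractionalIdeal (𝓞 (QuadField p))⁰ (QuadField p)) =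
      FractionalIdeal.spanSingleton (𝓞 (QuadField p))⁰ (α : QuadField p)}

/-- `Q ∈ A P_ℤ(f)`, for ideals `Q` and `A` of `O_K`. -/
def MemCoset (p : ℕ) [Fact p.Prime] (f : ℕ) (Q A : Ideal (𝓞 (QuadField p))) : Prop :=
  ∃ J ∈ PZ p f, (Q : FractionalIdeal (𝓞 (QuadField p))⁰ (QuadField p)) =
    (A : FractionalIdeal (𝓞 (QuadField p))⁰ (QuadField p)) * J

/-- `Q` lies in the coset of `P_ℤ(f)` attached to the class of the ideal `I` in the class group
`C(O)` by `C(O) ≅ I(f) / P_ℤ(f)`: for some ideal `A` of `O` which is prime to `f` and lies in the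
ideal class of `I`, one has `Q ∈ (A O_K) P_ℤ(f)`. -/
def MemClassCoset (p : ℕ) [Fact p.Prime] (f : ℕ) (Q : Ideal (𝓞 (QuadField p)))
    (I : Ideal (order p)) : Prop :=
  ∃ A : Ideal (order p), A ⊔ Ideal.span {(f : order p)} = ⊤ ∧
    (∃ x y : order p, x ≠ 0 ∧ y ≠ 0 ∧ Ideal.span {x} * I = Ideal.span {y} * A) ∧
    MemCoset p f Q (extend p A)

/-- `q` is a prime with `q ≡ 3 (mod 8)` and `(p / q) = -1`. -/
def Admissible (p q : ℕ) : Prop :=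
  q.Prime ∧ q % 8 = 3 ∧ jacobiSym (p : ℤ) q = -1

/-- The quaternion algebra `ℚ + ℚα + ℚβ + ℚαβ` with `α² = -p`, `β² = -q`, `αβ = -βα`. For
admissible `q` it is the quaternion algebra over `ℚ` ramified exactly at `p` and `∞`. -/
abbrev QuatAlg (p q : ℕ) : Type := ℍ[ℚ, -(p : ℚ), -(q : ℚ)]

/-- The embedding `K → B`, `√-p ↦ α`. -/
def embed (p q : ℕ) [Fact p.Prime] : QuadField p →+* QuatAlg p q where
  toFun x := ⟨x.re, x.im, 0, 0⟩
  map_one' := by ext <;> simp [QuadraticAlgebra.re_one, QuadraticAlgebra.im_one]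
  map_zero' := by ext <;> simp
  map_add' x y := by ext <;> simp
  map_mul' x y := by ext <;> simp

/-- `𝒪(q, r) = ℤ + ℤ (1 + β)/2 + ℤ α(1 + β)/2 + ℤ (r + α)β/q`, in coordinates with respect to
`1, α, β, αβ`. -/
def maxOrder (p q : ℕ) (r : ℤ) : Submodule ℤ (QuatAlg p q) :=
  Submodule.span ℤ {⟨1, 0, 0, 0⟩, ⟨1 / 2, 0, 1 / 2, 0⟩, ⟨0, 1 / 2, 0, 1 / 2⟩,
    ⟨0, 0, (r : ℚ) / q, 1 / q⟩}

/-- The lattice `I⁻¹ 𝒪(q, r) I` in `B`, where `K` is embedded in `B` by `√-p ↦ α`. -/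
def conjOrder (p q : ℕ) [Fact p.Prime] (r : ℤ) (I : Ideal (order p)) :
    Submodule ℤ (QuatAlg p q) :=
  (latticeInv p I).map (embed p q).toAddMonoidHom.toIntLinearMap * maxOrder p q r *
    (lattice p I).map (embed p q).toAddMonoidHom.toIntLinearMap

/-- Two lattices are subrings of their ambient algebras, and are isomorphic as rings. -/
def IsomorphicRings {A B : Type*} [Ring A] [Ring B] (M : Submodule ℤ A) (N : Submodule ℤ B) :
    Prop :=
  ∃ (R : Subring A) (S : Subring B), (R : Set A) = M ∧ (S : Set B) = N ∧ Nonempty (R ≃+* S)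

end SupersingularOrders

end

/-!
The proof has an analytic half, which produces the prime `q₂`, and an algebraic half, which
compares the two quaternion orders. Throughout `K = ℚ(√-p)`, `O = ℤ[2√-p]`.

**Primes in ring classes.** Ideals of `O_K` of odd norm are taken modulo quotients of elements
`x + 8y√-p` with `x` odd (`rayElements`); the quotient `RingClassGroup` is a finite group. The
claim is that every class contains a prime ideal of degree one (`exists_prime_rayClass_eq`). The
ideals in a class are, up to sign, the lattice points `(x, y)` in a union of cosets of a lattice,
so that the theta series of the class is `κ / t + O(1)` for `t → 0` (`exists_theta_fiber`), with
`κ` independent of the class because the reduction map `rayReduction` is a surjective homomorphism.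
A Mellin transform turns this into the continuation of the partial zeta function to `Re s > 0`,
with the polar part `κ / (s - 1)` (`exists_continuation_of_theta`). From here on only this
information is used, abstractly, in the structure `ClassZeta`. The series `L χ` is holomorphic on
`Re s > 0` for nontrivial `χ`. It does not vanish at `1` (`ClassZeta.H_ne_zero`): the residues at
`1` of all the `-L'/L` together have a nonnegative sum, which allows at most one vanishing `L χ`,
so that `χ` is quadratic; then `L 0 * L χ` has nonnegative coefficients, at least `1` at squares,
and would be holomorphic at `1`, which contradicts Landau's theorem (`sum_LSeries_le`). Hence the
sum over the prime powers in each class diverges (`ClassZeta.tendsto_primePowerSum`), whereas the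
higher powers and the inert and ramified primes contribute a bounded amount.

**Quaternion orders.** Elements of the quaternion algebra are written `x + yβ` with `x y : K`. The
lattices in question are all of the form `localLattice`: `2x` lies in `ℤ[√-p]`, `y` is integral
away from `2` against a given set `D`, and `y ≡ e x` in the localization of `ℤ[√-p]` at `2`. For
`𝒪(q, r)`, `D` is a prime ideal over `q` and `e = 1` (`maxOrder_eq_localLattice`). For
`𝔩⁻¹ 𝒪(q, r) 𝔩` with `𝔩` of odd prime norm `l`, `D` is `l⁻¹ [q, 2r - 2√-p] 𝔩² O_K` and `e = 1`
(`conjOrder_eq_localLattice`). For `𝔩 = [8, 2 + 2√-p]` only the prime `2` matters, and `e` becomes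
`√-p` (`conjOrder_idealTwo_eq_localLattice`). If `β₁² = -q₁`, `β₂² = -q₂` and `δ` has norm
`q₂ / q₁`, then `x + yβ₂ ↦ x + yδβ₁` is a ring homomorphism (`twistHom`), and it carries the local
conditions of `𝒪(q₂, r₂)` to those given by `D` and `e` if `δ D` is a prime ideal over `q₂` and
`δ / e ≡ 1` modulo `2` (`isomorphicRings_localLattice`). The ideal that generates the class of the
required prime is thus `[q₁, 2r₁ - 2√-p] 𝔩² O_K`, respectively `[q₁, 2r₁ - 2√-p] √-p O_K`; the
latter is the class of `[q₁, 2r₁ - 2√-p] 𝔩²` because `𝔩²` is equivalent to `[p, 2√-p]`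
(`span_twoSqrt_mul_idealTwo_sq`). Elements of `rayElements` have norm `1` modulo `8`, so the norm
of the prime is `3` modulo `8`, where in the second case the factor `1 + 2√-p` is inserted if
`p ≡ 5` modulo `8`.
-/

/-! ### Class group characters and their `L`-series -/

noncomputable section

set_option linter.unusedSectionVars false

open Complex Filter Topology Set

/-- A multiplicative norm `N` on a monoid with zero `M`, such as the monoid of ideals of a ring of
integers, and a multiplicative class map `cl` to an abelian group `G`, where `cl A = 0` means that
`A` has no class. The fields from `κ` on express that each partial zeta function
`∑_{cl A = g} N(A)^{-s}` has the polar part `κ / (s - 1)`, with the same `κ` for all classes, and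
continues to `Re s > 0`. -/
structure ClassZeta (M G : Type*) [CommMonoidWithZero M] [CommGroup G] where
  N : M →*₀ ℕ
  N_ne_zero : ∀ A, A ≠ 0 → N A ≠ 0
  eq_one_of_N : ∀ A, N A = 1 → A = 1
  cl : M →*₀ WithZero G
  κ : ℝ
  κ_pos : 0 < κ
  h : G → ℂ → ℂ
  diff_h : ∀ g, DifferentiableOn ℂ (h g) {s | 0 < s.re}
  hasSum_class : ∀ (g : G) (s : ℂ), 1 < s.re →
    HasSum (fun A : M ↦ open Classical in if cl A = g then (N A : ℂ) ^ (-s) else 0)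
      (κ / (s - 1) + h g s)

namespace ClassZeta

variable {M G : Type*} [CommMonoidWithZero M] [CommGroup G] (Z : ClassZeta M G)

/-- The character `χ` of the class group as a multiplicative function on `M`, zero on the elements
without a class. -/
def X (χ : AddChar (Additive G) ℂ) (A : M) : ℂ :=
  WithZero.recZeroCoe (motive := fun _ ↦ ℂ) 0 (fun g ↦ χ (Additive.ofMul g)) (Z.cl A)

variable {Z} in
lemma X_of_cl_eq (χ : AddChar (Additive G) ℂ) {A : M} {g : G} (h : Z.cl A = g) :
    Z.X χ A = χ (Additive.ofMul g) := by
  simp [X, h]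

variable {Z} in
lemma X_of_cl_zero (χ : AddChar (Additive G) ℂ) {A : M} (h : Z.cl A = 0) : Z.X χ A = 0 := by
  simp [X, h]

variable {Z} in
lemma cl_cases (A : M) : Z.cl A = 0 ∨ ∃ g : G, Z.cl A = g := by
  rcases h : Z.cl A with _ | g
  · exact Or.inl rfl
  · exact Or.inr ⟨g, rfl⟩

lemma X_one (χ : AddChar (Additive G) ℂ) : Z.X χ 1 = 1 := by
  rw [X_of_cl_eq (g := 1) χ (by simp)]; simp

lemma X_mul (χ : AddChar (Additive G) ℂ) (A B : M) : Z.X χ (A * B) = Z.X χ A * Z.X χ B := by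
  rcases Z.cl_cases A with hA | ⟨a, hA⟩
  · rw [X_of_cl_zero χ (by rw [map_mul, hA, zero_mul]), X_of_cl_zero χ hA, zero_mul]
  rcases Z.cl_cases B with hB | ⟨b, hB⟩
  · rw [X_of_cl_zero χ (by rw [map_mul, hB, mul_zero]), X_of_cl_zero χ hB, mul_zero]
  rw [X_of_cl_eq (g := a * b) χ (by rw [map_mul, hA, hB, WithZero.coe_mul]), X_of_cl_eq χ hA,
    X_of_cl_eq χ hB, ofMul_mul, AddChar.map_add_eq_mul]

/-- `N(A)^{-σ}` if `A` has a class, and zero otherwise. -/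
def w (σ : ℝ) (A : M) : ℝ := open Classical in if Z.cl A = 0 then 0 else (Z.N A : ℝ) ^ (-σ)

lemma w_nonneg (σ : ℝ) (A : M) : 0 ≤ Z.w σ A := by
  unfold w; split_ifs <;> positivity

variable {Z} in
lemma ne_zero_of_cl {A : M} (h : Z.cl A ≠ 0) : A ≠ 0 := by
  rintro rfl; simp at h

variable {Z} in
lemma N_pos_of_cl {A : M} (h : Z.cl A ≠ 0) : 0 < Z.N A :=
  Nat.pos_of_ne_zero (Z.N_ne_zero A (ne_zero_of_cl h))

variable [Finite G]

lemma norm_X (χ : AddChar (Additive G) ℂ) {A : M} (h : Z.cl A ≠ 0) : ‖Z.X χ A‖ = 1 := by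
  rcases Z.cl_cases A with hA | ⟨a, hA⟩
  · exact absurd hA h
  · rw [X_of_cl_eq χ hA, AddChar.norm_apply]

lemma norm_term (χ : AddChar (Additive G) ℂ) (s : ℂ) (A : M) :
    ‖Z.X χ A * (Z.N A : ℂ) ^ (-s)‖ = Z.w s.re A := by
  by_cases h : Z.cl A = 0
  · simp [X_of_cl_zero χ h, w, h]
  · rw [norm_mul, Z.norm_X χ h, norm_natCast_cpow_of_pos (N_pos_of_cl h), w, if_neg h, one_mul,
      neg_re]

lemma summable_w {σ : ℝ} (hσ : 1 < σ) : Summable (Z.w σ) := by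
  classical
  have := Fintype.ofFinite G
  have key : Z.w σ = fun A ↦ ∑ g : G, ‖if Z.cl A = g then (Z.N A : ℂ) ^ (-(σ : ℂ)) else 0‖ := by
    funext A
    rcases Z.cl_cases A with hA | ⟨a, hA⟩
    · simp [w, hA]
    · have h0 : Z.cl A ≠ 0 := by simp [hA]
      rw [w, if_neg h0, Finset.sum_eq_single a]
      · rw [if_pos hA, norm_natCast_cpow_of_pos (N_pos_of_cl h0)]; simp
      · intro b _ hb
        rw [if_neg, norm_zero]
        rw [hA, WithZero.coe_inj]; exact fun h ↦ hb h.symm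
      · simp
  rw [key]
  exact summable_sum fun g _ ↦ (Z.hasSum_class g σ (by simpa using hσ)).summable.norm

/-- The `L`-series of a class group character. -/
def L (χ : AddChar (Additive G) ℂ) (s : ℂ) : ℂ := ∑' A, Z.X χ A * (Z.N A : ℂ) ^ (-s)

lemma summable_L (χ : AddChar (Additive G) ℂ) {s : ℂ} (hs : 1 < s.re) :
    Summable fun A ↦ Z.X χ A * (Z.N A : ℂ) ^ (-s) :=
  Summable.of_norm (by simpa only [Z.norm_term χ s] using Z.summable_w hs)

/-- The part of `L χ` that is holomorphic on `Re s > 0`. -/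
def H (χ : AddChar (Additive G) ℂ) (s : ℂ) : ℂ :=
  ∑ᶠ g : G, χ (Additive.ofMul g) * Z.h g s

lemma diff_H (χ : AddChar (Additive G) ℂ) : DifferentiableOn ℂ (Z.H χ) {s | 0 < s.re} := by
  have := Fintype.ofFinite G
  have : Z.H χ = fun s ↦ ∑ g : G, χ (Additive.ofMul g) * Z.h g s := by
    funext s; exact finsum_eq_sum_of_fintype _
  rw [this]
  exact DifferentiableOn.fun_sum fun g _ ↦ (Z.diff_h g).const_mul _

lemma L_eq_sum [Fintype G] (χ : AddChar (Additive G) ℂ) {s : ℂ} (hs : 1 < s.re) :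
    Z.L χ s = (∑ g : G, χ (Additive.ofMul g)) * (Z.κ / (s - 1)) + Z.H χ s := by
  classical
  have h1 := hasSum_sum (s := Finset.univ) fun (g : G) _ ↦
    (Z.hasSum_class g s hs).mul_left (χ (Additive.ofMul g))
  rw [H, finsum_eq_sum_of_fintype, Finset.sum_mul, ← Finset.sum_add_distrib]
  simp_rw [← mul_add]
  rw [← h1.tsum_eq, L]
  congr 1
  funext A
  rcases Z.cl_cases A with hA | ⟨a, hA⟩
  · simp [X_of_cl_zero χ hA, hA]
  · rw [X_of_cl_eq χ hA, Finset.sum_eq_single a]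
    · rw [if_pos hA]
    · intro b _ hb
      rw [if_neg, mul_zero]
      rw [hA, WithZero.coe_inj]; exact fun h ↦ hb h.symm
    · simp

lemma L_eq_of_ne {χ : AddChar (Additive G) ℂ} (hχ : χ ≠ 0) {s : ℂ} (hs : 1 < s.re) :
    Z.L χ s = Z.H χ s := by
  classical
  have := Fintype.ofFinite G
  rw [Z.L_eq_sum χ hs]
  have : ∑ g : G, χ (Additive.ofMul g) = ∑ g : Additive G, χ g :=
    Fintype.sum_equiv Additive.ofMul _ _ fun _ ↦ rfl
  rw [this, AddChar.sum_eq_zero_iff_ne_zero.2 hχ]; simp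

lemma L_zero_eq {s : ℂ} (hs : 1 < s.re) :
    Z.L 0 s = (Nat.card G : ℂ) * (Z.κ / (s - 1)) + Z.H 0 s := by
  have := Fintype.ofFinite G
  rw [Z.L_eq_sum 0 hs]; simp

/-- The series `-L'/L`, as a sum over prime powers `Q ^ (k + 1)`. -/
def logDerivTerm (χ : AddChar (Additive G) ℂ) (s : ℂ) (v : {Q : M // Prime Q} × ℕ) : ℂ :=
  Z.X χ (v.1.1 ^ (v.2 + 1)) * (Z.N (v.1.1 ^ (v.2 + 1)) : ℂ) ^ (-s) * Real.log (Z.N v.1.1)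

end ClassZeta

end

/-! ### Logarithmic derivatives of the `L`-series -/

noncomputable section

set_option linter.unusedSectionVars false

open Complex Filter Topology Set

namespace ClassZeta

variable {M G : Type*} [CommMonoidWithZero M] [CommGroup G] (Z : ClassZeta M G)

/-- `log N(A)` is the sum of `log N(Q)` over the prime powers `Q ^ (k + 1)` dividing `A`. -/
lemma hasSum_log [UniqueFactorizationMonoid M] [Subsingleton Mˣ] {A : M} (hA : A ≠ 0) :
    HasSum (fun v : {Q : M // Prime Q} × ℕ ↦
      open Classical in if v.1.1 ^ (v.2 + 1) ∣ A then Real.log (Z.N v.1.1) else 0)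
      (Real.log (Z.N A)) := by
  classical
  induction A using UniqueFactorizationMonoid.induction_on_prime with
  | h₁ => exact absurd rfl hA
  | h₂ x hx =>
    have hx1 : x = 1 := by
      obtain ⟨u, rfl⟩ := hx
      rw [Subsingleton.elim u 1, Units.val_one]
    subst hx1
    have : (fun v : {Q : M // Prime Q} × ℕ ↦
        if v.1.1 ^ (v.2 + 1) ∣ (1 : M) then Real.log (Z.N v.1.1) else 0) = fun _ ↦ 0 := by
      funext v
      rw [if_neg]
      intro h
      exact v.1.2.not_isUnit (isUnit_of_dvd_one ((dvd_pow_self _ (by simp)).trans h))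
    rw [this]
    simp
  | h₃ a p ha hp ih =>
    have hfin : FiniteMultiplicity p a := FiniteMultiplicity.of_prime_left hp ha
    have hsingle : HasSum (fun v : {Q : M // Prime Q} × ℕ ↦
        if v = (⟨p, hp⟩, multiplicity p a) then Real.log (Z.N p) else 0) (Real.log (Z.N p)) :=
      hasSum_ite_eq _ _
    have hsum := hsingle.add (ih ha)
    have hN : Real.log (Z.N (p * a)) = Real.log (Z.N p) + Real.log (Z.N a) := by
      rw [map_mul, Nat.cast_mul, Real.log_mul]
      · exact_mod_cast Z.N_ne_zero p hp.ne_zero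
      · exact_mod_cast Z.N_ne_zero a ha
    rw [hN]
    convert! hsum using 1
    funext ⟨⟨Q, hQ⟩, k⟩
    simp only [Prod.mk.injEq, Subtype.mk.injEq]
    by_cases hQp : Q = p
    · subst hQp
      have h1 : Q ^ (k + 1) ∣ Q * a ↔ k ≤ multiplicity Q a := by
        rw [pow_succ', mul_dvd_mul_iff_left hp.ne_zero, hfin.pow_dvd_iff_le_multiplicity]
      have h2 : Q ^ (k + 1) ∣ a ↔ k < multiplicity Q a := by
        rw [hfin.pow_dvd_iff_le_multiplicity]; rfl
      simp only [h1, h2, true_and]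
      rcases lt_trichotomy k (multiplicity Q a) with h | h | h
      · simp [h, h.le, h.ne]
      · simp [h]
      · simp [h.not_ge, h.not_gt, h.ne']
    · have h1 : Q ^ (k + 1) ∣ p * a ↔ Q ^ (k + 1) ∣ a := by
        refine ⟨fun h ↦ hQ.pow_dvd_of_dvd_mul_left _ ?_ h, fun h ↦ h.mul_left _⟩
        intro h
        exact hQp (associated_iff_eq.1 (hQ.associated_of_dvd hp h))
      simp [h1, hQp]

variable [Finite G]

lemma log_mul_w_le {σ ε : ℝ} (hε : 0 < ε) (A : M) :
    Real.log (Z.N A) * Z.w σ A ≤ Z.w (σ - ε) A / ε := by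
  unfold w
  split_ifs with h
  · simp
  · have hN := N_pos_of_cl h
    have hN' : (0 : ℝ) < Z.N A := by exact_mod_cast hN
    have := Real.log_le_rpow_div hN'.le hε
    calc _ ≤ (Z.N A : ℝ) ^ ε / ε * (Z.N A : ℝ) ^ (-σ) := by gcongr
      _ = _ := by
        rw [div_mul_eq_mul_div, ← Real.rpow_add hN']; ring_nf

lemma summable_log_mul_w {σ : ℝ} (hσ : 1 < σ) :
    Summable fun A ↦ Real.log (Z.N A) * Z.w σ A := by
  refine Summable.of_nonneg_of_le (fun A ↦ mul_nonneg (Real.log_natCast_nonneg _)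
    (Z.w_nonneg _ _)) (fun A ↦ Z.log_mul_w_le (ε := (σ - 1) / 2) (by linarith) A) ?_
  exact (Z.summable_w (by linarith)).div_const _

lemma diff_term (χ : AddChar (Additive G) ℂ) (A : M) :
    Differentiable ℂ fun s : ℂ ↦ Z.X χ A * (Z.N A : ℂ) ^ (-s) := by
  by_cases h : Z.cl A = 0
  · simp [X_of_cl_zero χ h]
  · have : (Z.N A : ℂ) ≠ 0 := by exact_mod_cast (N_pos_of_cl h).ne'
    refine Differentiable.const_mul (Differentiable.const_cpow differentiable_neg (Or.inl this)) _

lemma deriv_term (χ : AddChar (Additive G) ℂ) (A : M) (s : ℂ) :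
    deriv (fun s : ℂ ↦ Z.X χ A * (Z.N A : ℂ) ^ (-s)) s =
      -(Z.X χ A * (Z.N A : ℂ) ^ (-s) * Real.log (Z.N A)) := by
  by_cases h : Z.cl A = 0
  · simp [X_of_cl_zero χ h]
  · have h0 : (Z.N A : ℂ) ≠ 0 := by exact_mod_cast (N_pos_of_cl h).ne'
    have := ((hasDerivAt_neg s).const_cpow (c := (Z.N A : ℂ)) (Or.inl h0)).const_mul (Z.X χ A)
    rw [this.deriv]
    push_cast [natCast_log]
    ring

lemma w_anti {σ τ : ℝ} (h : σ ≤ τ) (A : M) : Z.w τ A ≤ Z.w σ A := by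
  unfold w
  split_ifs with h0
  · rfl
  · refine Real.rpow_le_rpow_of_exponent_le ?_ (by linarith)
    exact_mod_cast N_pos_of_cl h0

lemma hasSum_deriv_L (χ : AddChar (Additive G) ℂ) {s : ℂ} (hs : 1 < s.re) :
    HasSum (fun A ↦ -(Z.X χ A * (Z.N A : ℂ) ^ (-s) * Real.log (Z.N A))) (deriv (Z.L χ) s) := by
  have h1 : 1 < (s.re + 1) / 2 := by linarith
  have := hasSum_deriv_of_summable_norm (U := {z : ℂ | (s.re + 1) / 2 < z.re})
    (Z.summable_w h1) (fun A ↦ (Z.diff_term χ A).differentiableOn)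
    (isOpen_lt continuous_const continuous_re)
    (fun A z hz ↦ by rw [Z.norm_term]; exact Z.w_anti (le_of_lt hz) A)
    (z := s) (by simp only [mem_ofPred_eq]; linarith)
  simpa only [Z.deriv_term χ] using! this

variable [UniqueFactorizationMonoid M] [Subsingleton Mˣ]

lemma summable_double (χ : AddChar (Additive G) ℂ) {s : ℂ} (hs : 1 < s.re) :
    Summable (Function.uncurry fun (A : M) (v : {Q : M // Prime Q} × ℕ) ↦
      Z.X χ A * (Z.N A : ℂ) ^ (-s) * ((open Classical in
        if v.1.1 ^ (v.2 + 1) ∣ A then Real.log (Z.N v.1.1) else 0 : ℝ) : ℂ)) := by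
  classical
  refine Summable.of_norm ?_
  refine (summable_prod_of_nonneg (fun _ ↦ norm_nonneg _)).2 ⟨fun A ↦ ?_, ?_⟩
  · by_cases hA : Z.cl A = 0
    · simp [X_of_cl_zero χ hA, summable_zero]
    · simp only [Function.uncurry, norm_mul _ (ofReal _), norm_real]
      exact (Z.hasSum_log (ne_zero_of_cl hA)).summable.norm.mul_left _
  · refine (Z.summable_log_mul_w hs).congr fun A ↦ ?_
    by_cases hA : Z.cl A = 0
    · simp [X_of_cl_zero χ hA, w, hA]
    · simp only [Function.uncurry, norm_mul _ (ofReal _), norm_real, Z.norm_term, tsum_mul_left]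
      rw [mul_comm]
      congr 1
      rw [← (Z.hasSum_log (ne_zero_of_cl hA)).tsum_eq]
      refine tsum_congr fun v ↦ ?_
      split_ifs
      · rw [Real.norm_of_nonneg (Real.log_natCast_nonneg _)]
      · simp

lemma summable_logDerivTerm (χ : AddChar (Additive G) ℂ) {s : ℂ} (hs : 1 < s.re) :
    Summable (Z.logDerivTerm χ s) := by
  have hinj : Function.Injective fun v : {Q : M // Prime Q} × ℕ ↦ (v.1.1 ^ (v.2 + 1), v) :=
    fun v w h ↦ (Prod.ext_iff.1 h).2
  convert! (Z.summable_double χ hs).comp_injective hinj using 1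
  funext v
  simp [logDerivTerm, Function.uncurry]

lemma cpow_N_mul (A B : M) (s : ℂ) :
    (Z.N (A * B) : ℂ) ^ s = (Z.N A : ℂ) ^ s * (Z.N B : ℂ) ^ s := by
  rw [map_mul, Nat.cast_mul, natCast_mul_natCast_cpow]

/-- The logarithmic derivative of `L χ` as a sum over prime powers. -/
lemma L_mul_logDeriv (χ : AddChar (Additive G) ℂ) {s : ℂ} (hs : 1 < s.re) :
    Z.L χ s * ∑' v, Z.logDerivTerm χ s v = -deriv (Z.L χ) s := by
  classical
  have h1 := (Z.summable_double χ hs).tsum_comm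
  have h2 : ∀ A : M, ∑' v : {Q : M // Prime Q} × ℕ, Z.X χ A * (Z.N A : ℂ) ^ (-s) *
      ((if v.1.1 ^ (v.2 + 1) ∣ A then Real.log (Z.N v.1.1) else 0 : ℝ) : ℂ) =
      Z.X χ A * (Z.N A : ℂ) ^ (-s) * Real.log (Z.N A) := by
    intro A
    by_cases hA : Z.cl A = 0
    · simp [X_of_cl_zero χ hA]
    · rw [tsum_mul_left]
      congr 1
      rw [← ofReal_tsum, (Z.hasSum_log (ne_zero_of_cl hA)).tsum_eq]
  have h3 : ∀ v : {Q : M // Prime Q} × ℕ, ∑' A : M, Z.X χ A * (Z.N A : ℂ) ^ (-s) *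
      ((if v.1.1 ^ (v.2 + 1) ∣ A then Real.log (Z.N v.1.1) else 0 : ℝ) : ℂ) =
      Z.L χ s * Z.logDerivTerm χ s v := by
    intro v
    have hQ : v.1.1 ^ (v.2 + 1) ≠ 0 := pow_ne_zero _ v.1.2.ne_zero
    have hinj : Function.Injective fun B : M ↦ v.1.1 ^ (v.2 + 1) * B :=
      fun a b h ↦ mul_left_cancel₀ hQ h
    rw [← hinj.tsum_eq]
    · rw [L, ← tsum_mul_right]
      refine tsum_congr fun B ↦ ?_
      simp only [X_mul, cpow_N_mul, logDerivTerm, dvd_mul_right, if_true]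
      ring
    · intro A hA
      rw [Function.mem_support] at hA
      by_cases hd : v.1.1 ^ (v.2 + 1) ∣ A
      · obtain ⟨B, rfl⟩ := hd
        exact ⟨B, rfl⟩
      · simp [hd] at hA
  rw [← tsum_mul_left, ← (Z.hasSum_deriv_L χ hs).tsum_eq, tsum_neg, neg_neg]
  calc _ = ∑' v, ∑' A : M, _ := (tsum_congr h3).symm
    _ = _ := h1
    _ = _ := tsum_congr h2

end ClassZeta

end

/-! ### Orders of zeros and Landau's theorem -/

noncomputable section

set_option linter.unusedSectionVars false

open Complex Filter Topology Set

/-- Near a zero of finite order the logarithmic derivative has a simple pole whose residue is the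
order. -/
lemma tendsto_sub_mul_logDeriv {f : ℂ → ℂ} {c : ℂ} (hf : AnalyticAt ℂ f c)
    (h0 : ¬∀ᶠ z in 𝓝 c, f z = 0) :
    ∃ m : ℕ, (f c = 0 → 1 ≤ m) ∧ (∀ᶠ z in 𝓝[≠] c, f z ≠ 0) ∧
      Tendsto (fun z ↦ (z - c) * (deriv f z / f z)) (𝓝[≠] c) (𝓝 m) := by
  obtain ⟨m, g, hg, hgc, hfg⟩ := hf.exists_eventuallyEq_pow_smul_nonzero_iff.2 h0
  have hg0 : ∀ᶠ z in 𝓝 c, g z ≠ 0 := hg.continuousAt.eventually_ne hgc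
  refine ⟨m, fun h ↦ ?_, ?_, ?_⟩
  · rcases Nat.eq_zero_or_pos m with rfl | hm
    · have := hfg.self_of_nhds
      simp [h] at this
      exact absurd this.symm hgc
    · exact hm
  · filter_upwards [hg0.filter_mono nhdsWithin_le_nhds, hfg.filter_mono nhdsWithin_le_nhds,
      self_mem_nhdsWithin] with z h1 h2 h3
    rw [h2, smul_eq_mul]
    exact mul_ne_zero (pow_ne_zero _ (sub_ne_zero.2 h3)) h1
  · have hlim : Tendsto (fun z ↦ (m : ℂ) + (z - c) * (deriv g z / g z)) (𝓝[≠] c) (𝓝 m) := by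
      have : ContinuousAt (fun z ↦ (m : ℂ) + (z - c) * (deriv g z / g z)) c := by
        have h1 := hg.deriv.continuousAt
        have h2 := hg.continuousAt
        fun_prop (disch := assumption)
      have := this.tendsto
      simp only [sub_self, zero_mul, add_zero] at this
      exact this.mono_left nhdsWithin_le_nhds
    refine hlim.congr' ?_
    filter_upwards [hg0.filter_mono nhdsWithin_le_nhds,
      hfg.eventually_nhds.filter_mono nhdsWithin_le_nhds,
      hg.eventually_analyticAt.filter_mono nhdsWithin_le_nhds,
      self_mem_nhdsWithin] with z h1 h2 h3 h4
    have hz : z - c ≠ 0 := sub_ne_zero.2 h4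
    have hder : deriv f z = m * (z - c) ^ (m - 1) * g z + (z - c) ^ m * deriv g z := by
      rw [EventuallyEq.deriv_eq h2]
      have e1 : HasDerivAt (fun z ↦ (z - c) ^ m) (m * (z - c) ^ (m - 1)) z := by
        simpa using ((hasDerivAt_id z).sub_const c).fun_pow m
      simpa [smul_eq_mul] using! (e1.mul h3.differentiableAt.hasDerivAt).deriv
    rw [hder, h2.self_of_nhds, smul_eq_mul]
    rcases Nat.eq_zero_or_pos m with rfl | hm
    · simp
    · obtain ⟨k, rfl⟩ : ∃ k, m = k + 1 := ⟨m - 1, by omega⟩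
      simp only [Nat.add_sub_cancel, pow_succ]
      field_simp

open scoped ComplexOrder in
/-- **Landau's theorem**, in quantitative form: if a Dirichlet series with nonnegative coefficients
continues to a holomorphic function on `Re s > 0`, then this function bounds the partial sums. The
Taylor coefficients at `2` of the function minus a partial sum have alternating signs, so that the
difference is nonnegative to the left of `2`. -/
lemma sum_LSeries_le {c : ℕ → ℝ} (hc : ∀ n, 0 ≤ c n) {F : ℂ → ℂ}
    (hF : DifferentiableOn ℂ F {s | 0 < s.re})
    (hcF : ∀ s : ℂ, 1 < s.re → HasSum (fun n : ℕ ↦ (c n : ℂ) * (n : ℂ) ^ (-s)) (F s))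
    (T : Finset ℕ) {σ : ℝ} (hσ0 : 0 < σ) (hσ : σ ≤ 2) :
    ∑ n ∈ T, c n * (n : ℝ) ^ (-σ) ≤ (F σ).re := by
  classical
  have hopen : IsOpen {s : ℂ | 1 < s.re} := isOpen_lt continuous_const continuous_re
  set a : ℕ → ℂ := fun n ↦ if n ∈ T ∨ n = 0 then 0 else (c n : ℂ) with ha
  have hterm : ∀ (s : ℂ), 1 < s.re → ∀ n, LSeries.term a s n =
      (c n : ℂ) * (n : ℂ) ^ (-s) - if n ∈ T then (c n : ℂ) * (n : ℂ) ^ (-s) else 0 := by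
    intro s hs n
    have hs0 : s ≠ 0 := by rintro rfl; simp at hs; linarith
    rw [LSeries.term_def]
    rcases eq_or_ne n 0 with rfl | hn
    · simp [hs0]
    · rw [if_neg hn]
      by_cases hT : n ∈ T
      · simp [ha, hT]
      · simp [ha, hT, hn, cpow_neg, div_eq_mul_inv]
  have hLS : ∀ s : ℂ, 1 < s.re → HasSum (LSeries.term a s)
      (F s - ∑ n ∈ T, (c n : ℂ) * (n : ℂ) ^ (-s)) := by
    intro s hs
    rw [funext (hterm s hs)]
    refine (hcF s hs).sub ?_
    have := hasSum_sum_of_ne_finset_zero (L := .unconditional ℕ)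
      (f := fun n ↦ if n ∈ T then (c n : ℂ) * (n : ℂ) ^ (-s) else 0)
      (s := T) (fun n hn ↦ if_neg hn)
    convert! this using 1
    exact Finset.sum_congr rfl fun n hn ↦ (if_pos hn).symm
  have habs : LSeries.abscissaOfAbsConv a < (2 : ℝ) := by
    refine lt_of_le_of_lt (LSeries.abscissaOfAbsConv_le_of_forall_lt_LSeriesSummable (x := 1)
      fun y hy ↦ (hLS y (by simpa using hy)).summable) ?_
    exact_mod_cast one_lt_two
  set g : ℂ → ℂ := fun s ↦ F s - ∑ n ∈ T.erase 0, (c n : ℂ) * (n : ℂ) ^ (-s) with hg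
  have hgL : EqOn g (LSeries a) {s | 1 < s.re} := by
    intro s hs
    have hs0 : s ≠ 0 := by rintro rfl; simp at hs; linarith
    rw [LSeries, (hLS s hs).tsum_eq, hg]
    simp only
    rw [Finset.sum_erase]
    simp [hs0]
  have hgd : DifferentiableOn ℂ g {s | 0 < s.re} := by
    refine hF.sub (DifferentiableOn.fun_sum fun n hn ↦ ?_)
    have : (n : ℂ) ≠ 0 := by exact_mod_cast (Finset.mem_erase.1 hn).1
    exact ((differentiable_neg.const_cpow (Or.inl this)).const_mul _).differentiableOn
  have hpos : 0 ≤ (fun z ↦ g (-z)) (-(σ : ℂ)) := by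
    refine DifferentiableOn.nonneg_of_iteratedDeriv_nonneg (f := fun z ↦ g (-z)) (z := -(σ : ℂ)) (c := -2) (r := 2) ?_ ?_ ?_ ?_
    · refine hgd.comp differentiable_neg.differentiableOn fun z hz ↦ ?_
      rw [Metric.mem_ball, dist_eq] at hz
      have := (abs_re_le_norm _).trans_lt hz
      simp only [sub_re, neg_re, re_ofNat, abs_lt] at this
      simp only [mem_ofPred_eq, neg_re]
      linarith
    · intro n
      rw [iteratedDeriv_comp_neg, neg_neg, smul_eq_mul,
        hgL.iteratedDeriv_of_isOpen hopen n (by simp)]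
      have := LSeries.iteratedDeriv_alternating (a := a) (fun n ↦ ?_) habs n
      · simpa using this
      · simp only [ha, Pi.zero_apply]
        split_ifs
        · exact le_rfl
        · exact_mod_cast hc n
    · rw [neg_le_neg_iff]
      exact_mod_cast hσ
    · rw [Metric.mem_ball, dist_eq]
      have : -(σ : ℂ) - -2 = ((2 - σ : ℝ) : ℂ) := by push_cast; ring
      rw [this, norm_real, Real.norm_of_nonneg (by linarith)]
      linarith
  simp only [neg_neg] at hpos
  have hre := (Complex.le_def.1 hpos).1
  have e : ∑ n ∈ T, c n * (n : ℝ) ^ (-σ) = (∑ n ∈ T.erase 0, (c n : ℂ) * (n : ℂ) ^ (-(σ : ℂ))).re := by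
    rw [← Finset.sum_erase (s := T) (a := 0)]
    · rw [re_sum]
      refine Finset.sum_congr rfl fun n _ ↦ ?_
      rw [re_ofReal_mul, ← ofReal_natCast, ← ofReal_neg, ← ofReal_cpow (Nat.cast_nonneg n),
        ofReal_re]
    · rw [Nat.cast_zero, Real.zero_rpow (by linarith : -σ ≠ 0), mul_zero]
  rw [e]
  simp only [hg, sub_re, zero_re] at hre
  linarith

end

/-! ### Divisor sums, and `L`-series near infinity -/

noncomputable section

section DivisorSums

variable {M : Type*} [CommMonoidWithZero M] [UniqueFactorizationMonoid M] [Subsingleton Mˣ]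

/-- The sum of the values of `f` over the divisors of `B`. -/
def divisorSum (f : M → ℝ) (B : M) : ℝ := ∑' D : {D // D ∣ B}, f D

lemma divisorSum_mul {f : M → ℝ} (hf : ∀ A B, f (A * B) = f A * f B) {x y : M}
    (hx : x ≠ 0) (hy : y ≠ 0) (hxy : IsRelPrime x y) :
    divisorSum f (x * y) = divisorSum f x * divisorSum f y := by
  have := Fintype.ofFinite Mˣ
  have := UniqueFactorizationMonoid.fintypeSubtypeDvd x hx
  have := UniqueFactorizationMonoid.fintypeSubtypeDvd y hy
  have := UniqueFactorizationMonoid.fintypeSubtypeDvd (x * y) (mul_ne_zero hx hy)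
  unfold divisorSum
  rw [tsum_fintype, tsum_fintype, tsum_fintype, Finset.sum_mul_sum, ← Fintype.sum_prod_type']
  symm
  have hdvd : ∀ {a b c d : M}, a ∣ x → d ∣ y → a * b = c * d → a ∣ c := fun {a b c d} ha hd h ↦
    (IsRelPrime.dvd_of_dvd_mul_right ((hxy.of_dvd_left ha).of_dvd_right hd)
      (Dvd.intro _ h))
  refine Fintype.sum_bijective
    (fun v : {D // D ∣ x} × {D // D ∣ y} ↦ (⟨v.1.1 * v.2.1, mul_dvd_mul v.1.2 v.2.2⟩ : {D // D ∣ x * y}))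
    ⟨?_, ?_⟩ _ _ fun v ↦ (hf _ _).symm
  · rintro ⟨⟨a, ha⟩, ⟨b, hb⟩⟩ ⟨⟨c, hc⟩, ⟨d, hd⟩⟩ h
    simp only [Subtype.mk.injEq] at h
    have hac : a = c := associated_iff_eq.1
      (associated_of_dvd_dvd (hdvd ha hd h) (hdvd hc hb h.symm))
    subst hac
    have hbd : b = d := mul_left_cancel₀ (ne_zero_of_dvd_ne_zero hx ha) h
    subst hbd
    rfl
  · rintro ⟨D, hD⟩
    obtain ⟨a, b, ha, hb, rfl⟩ := exists_dvd_and_dvd_of_dvd_mul hD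
    exact ⟨(⟨a, ha⟩, ⟨b, hb⟩), rfl⟩

lemma divisorSum_prime_pow {f : M → ℝ} (h1 : f 1 = 1) (hf : ∀ A B, f (A * B) = f A * f B) {p : M}
    (hp : Prime p) (i : ℕ) : divisorSum f (p ^ i) = ∑ j ∈ Finset.range (i + 1), f p ^ j := by
  have := Fintype.ofFinite Mˣ
  have := UniqueFactorizationMonoid.fintypeSubtypeDvd (p ^ i) (pow_ne_zero _ hp.ne_zero)
  have hpow : ∀ j : ℕ, f (p ^ j) = f p ^ j := fun j ↦ by
    induction j with
    | zero => simp [h1]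
    | succ j ih => rw [pow_succ, hf, ih, pow_succ]
  unfold divisorSum
  rw [tsum_fintype, ← Fin.sum_univ_eq_sum_range (fun j ↦ f p ^ j)]
  symm
  refine Fintype.sum_bijective
    (fun j : Fin (i + 1) ↦ (⟨p ^ (j : ℕ), pow_dvd_pow p (Nat.lt_succ_iff.1 j.2)⟩ : {D // D ∣ p ^ i}))
    ⟨?_, ?_⟩ _ _ fun j ↦ (hpow _).symm
  · intro j k h
    simp only [Subtype.mk.injEq] at h
    exact Fin.ext (pow_injective_of_not_isUnit hp.not_isUnit hp.ne_zero h)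
  · rintro ⟨D, hD⟩
    obtain ⟨j, hj, hD⟩ := (dvd_prime_pow hp i).1 hD
    exact ⟨⟨j, Nat.lt_succ_of_le hj⟩, Subtype.ext (associated_iff_eq.1 hD).symm⟩

omit [UniqueFactorizationMonoid M] in
lemma eq_one_of_isUnit {x : M} (hx : IsUnit x) : x = 1 := by
  obtain ⟨u, rfl⟩ := hx
  rw [Subsingleton.elim u 1, Units.val_one]

omit [UniqueFactorizationMonoid M] in
lemma divisorSum_one {f : M → ℝ} (h1 : f 1 = 1) : divisorSum f 1 = 1 := by
  unfold divisorSum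
  rw [tsum_eq_single ⟨1, dvd_rfl⟩]
  · exact h1
  · intro D hD
    exact absurd (Subtype.ext (eq_one_of_isUnit (isUnit_of_dvd_one D.2))) hD

lemma divisorSum_nonneg {f : M → ℝ} (h1 : f 1 = 1) (hf : ∀ A B, f (A * B) = f A * f B)
    (hv : ∀ A, f A = 0 ∨ f A = 1 ∨ f A = -1) {B : M} (hB : B ≠ 0) : 0 ≤ divisorSum f B := by
  revert hB
  induction B using UniqueFactorizationMonoid.induction_on_coprime with
  | h0 => exact fun h ↦ absurd rfl h
  | h1 hx =>
    rw [eq_one_of_isUnit hx, divisorSum_one h1]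
    exact fun _ ↦ zero_le_one
  | hpr i hp =>
    intro _
    rw [divisorSum_prime_pow h1 hf hp]
    rcases hv _ with h | h | h <;> rw [h]
    · positivity
    · positivity
    · rw [neg_one_geom_sum]; split_ifs <;> norm_num
  | hcp hxy ihx ihy =>
    intro h
    have hx := left_ne_zero_of_mul h
    have hy := right_ne_zero_of_mul h
    rw [divisorSum_mul hf hx hy hxy]
    exact mul_nonneg (ihx hx) (ihy hy)

lemma one_le_divisorSum_sq {f : M → ℝ} (h1 : f 1 = 1) (hf : ∀ A B, f (A * B) = f A * f B)
    (hv : ∀ A, f A = 0 ∨ f A = 1 ∨ f A = -1) {B : M} (hB : B ≠ 0) :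
    1 ≤ divisorSum f (B ^ 2) := by
  revert hB
  induction B using UniqueFactorizationMonoid.induction_on_coprime with
  | h0 => exact fun h ↦ absurd rfl h
  | h1 hx =>
    rw [eq_one_of_isUnit hx, one_pow, divisorSum_one h1]
    exact fun _ ↦ le_rfl
  | hpr i hp =>
    intro _
    rw [← pow_mul, divisorSum_prime_pow h1 hf hp]
    rcases hv _ with h | h | h <;> rw [h]
    · rw [Finset.sum_range_succ']
      simp
    · simp
    · rw [neg_one_geom_sum, if_neg]
      rw [Nat.not_even_iff_odd]
      exact ⟨i, by ring⟩
  | hcp hxy ihx ihy =>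
    intro h
    have hx := left_ne_zero_of_mul h
    have hy := right_ne_zero_of_mul h
    rw [mul_pow, divisorSum_mul hf (pow_ne_zero _ hx) (pow_ne_zero _ hy) hxy.pow]
    exact one_le_mul_of_one_le_of_one_le (ihx hx) (ihy hy)

end DivisorSums

set_option linter.unusedSectionVars false

open Complex Filter Topology Set

namespace ClassZeta

variable {M G : Type*} [CommMonoidWithZero M] [CommGroup G] (Z : ClassZeta M G) [Finite G]

lemma norm_L_sub_one_le (χ : AddChar (Additive G) ℂ) {σ : ℝ} (hσ : 2 ≤ σ) :
    ‖Z.L χ σ - 1‖ ≤ (2 : ℝ) ^ (-(σ - 2)) * ∑' A, Z.w 2 A := by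
  classical
  have hs : 1 < (σ : ℂ).re := by simp; linarith
  have h1 : HasSum (fun A : M ↦ if A = 1 then (1 : ℂ) else 0) 1 := hasSum_ite_eq _ _
  have h2 := (Z.summable_L χ hs).hasSum.sub h1
  rw [L, ← h2.tsum_eq, ← tsum_mul_left]
  refine tsum_of_norm_bounded ((Z.summable_w one_lt_two).mul_left _).hasSum fun A ↦ ?_
  by_cases hA : A = 1
  · subst hA
    simp only [X_one, map_one, Nat.cast_one, one_cpow, mul_one, if_true, sub_self, norm_zero]
    exact mul_nonneg (by positivity) (Z.w_nonneg _ _)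
  · rw [if_neg hA, sub_zero, Z.norm_term, ofReal_re]
    unfold w
    split_ifs with h
    · simp
    · have hN : 2 ≤ Z.N A := by
        have := N_pos_of_cl h
        have h2 : Z.N A ≠ 1 := fun h ↦ hA (Z.eq_one_of_N A h)
        omega
      have hN' : (2 : ℝ) ≤ Z.N A := by exact_mod_cast hN
      calc (Z.N A : ℝ) ^ (-σ) = (Z.N A : ℝ) ^ (-(σ - 2)) * (Z.N A : ℝ) ^ (-2 : ℝ) := by
            rw [← Real.rpow_add (by linarith)]; ring_nf
        _ ≤ _ := by
          gcongr ?_ * _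
          exact Real.rpow_le_rpow_of_nonpos (by norm_num) hN' (by linarith)

/-- The series `L χ` tends to `1` for `σ → ∞`, hence it is not identically zero. -/
lemma exists_L_ne_zero (χ : AddChar (Additive G) ℂ) : ∃ σ : ℝ, 1 < σ ∧ Z.L χ σ ≠ 0 := by
  have hlim : Tendsto (fun σ : ℝ ↦ (2 : ℝ) ^ (-(σ - 2)) * ∑' A, Z.w 2 A) atTop (𝓝 0) := by
    rw [← zero_mul (∑' A, Z.w 2 A)]
    refine Tendsto.mul_const _ ?_
    have h1 : Tendsto (fun σ : ℝ ↦ -(σ - 2)) atTop atBot :=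
      tendsto_neg_atTop_atBot.comp (tendsto_atTop_add_const_right _ _ tendsto_id)
    exact (tendsto_rpow_atBot_of_base_gt_one 2 one_lt_two).comp h1
  obtain ⟨σ, h1, h2⟩ := ((hlim.eventually_lt_const one_pos).and (eventually_ge_atTop 2)).exists
  refine ⟨σ, by linarith, fun h ↦ ?_⟩
  have := Z.norm_L_sub_one_le χ h2
  rw [h, zero_sub, norm_neg, norm_one] at this
  linarith

lemma isOpen_re_pos : IsOpen {s : ℂ | 0 < s.re} := isOpen_lt continuous_const continuous_re

lemma analyticAt_H (χ : AddChar (Additive G) ℂ) {s : ℂ} (hs : 0 < s.re) :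
    AnalyticAt ℂ (Z.H χ) s :=
  (Z.diff_H χ).analyticAt (isOpen_re_pos.mem_nhds hs)

lemma H_not_eventually_zero {χ : AddChar (Additive G) ℂ} (hχ : χ ≠ 0) :
    ¬∀ᶠ z in 𝓝 (1 : ℂ), Z.H χ z = 0 := by
  intro h
  have hpre : IsPreconnected {s : ℂ | 0 < s.re} :=
    (convex_halfSpace_re_gt 0).isPreconnected
  have h1 : (1 : ℂ) ∈ {s : ℂ | 0 < s.re} := by simp
  have := AnalyticOnNhd.eqOn_zero_of_preconnected_of_eventuallyEq_zero
    (fun s hs ↦ Z.analyticAt_H χ hs) hpre h1 h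
  obtain ⟨σ, hσ, hL⟩ := Z.exists_L_ne_zero χ
  refine hL ?_
  rw [Z.L_eq_of_ne hχ (by simpa using hσ)]
  exact this (show 0 < (σ : ℂ).re by simp; linarith)

end ClassZeta

end

/-! ### Non-vanishing at `1` for quadratic characters -/

noncomputable section

set_option linter.unusedSectionVars false

open Complex Filter Topology Set

namespace ClassZeta

variable {M G : Type*} [CommMonoidWithZero M] [CommGroup G] (Z : ClassZeta M G) [Finite G]
  [UniqueFactorizationMonoid M] [Subsingleton Mˣ]

lemma X_zero_char {A : M} (h : Z.cl A ≠ 0) : Z.X 0 A = 1 := by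
  rcases Z.cl_cases A with hA | ⟨a, hA⟩
  · exact absurd hA h
  · rw [X_of_cl_eq 0 hA]; simp

/-- A quadratic character of the class group takes the real values `0`, `1` and `-1`. -/
lemma X_real {χ : AddChar (Additive G) ℂ} (hχ : -χ = χ) (A : M) :
    Z.X χ A = ((Z.X χ A).re : ℂ) ∧
      ((Z.X χ A).re = 0 ∨ (Z.X χ A).re = 1 ∨ (Z.X χ A).re = -1) := by
  rcases Z.cl_cases A with hA | ⟨a, hA⟩
  · simp [X_of_cl_zero χ hA]
  · have h1 : χ (Additive.ofMul a) * χ (Additive.ofMul a) = 1 := by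
      nth_rw 1 [← hχ]
      rw [AddChar.neg_apply', inv_mul_cancel₀]
      intro h
      have := AddChar.norm_apply χ (Additive.ofMul a)
      rw [h, norm_zero] at this
      exact zero_ne_one this
    rcases mul_self_eq_one_iff.1 h1 with h | h <;> simp [X_of_cl_eq χ hA, h]

/-- The coefficient at `B` of the product `L(0) L(χ)`, for quadratic `χ`. -/
def quadCoeff (χ : AddChar (Additive G) ℂ) (B : M) : ℝ :=
  open Classical in if Z.cl B = 0 then 0 else divisorSum (fun D ↦ (Z.X χ D).re) B

lemma quadCoeff_nonneg {χ : AddChar (Additive G) ℂ} (hχ : -χ = χ) (B : M) :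
    0 ≤ Z.quadCoeff χ B := by
  unfold quadCoeff
  split_ifs with h
  · rfl
  · refine divisorSum_nonneg (by simp [X_one]) (fun A B ↦ ?_) (fun A ↦ (Z.X_real hχ A).2)
      (ne_zero_of_cl h)
    rw [X_mul, (Z.X_real hχ A).1, (Z.X_real hχ B).1, ← ofReal_mul, ofReal_re]
    simp

lemma one_le_quadCoeff_sq {χ : AddChar (Additive G) ℂ} (hχ : -χ = χ) {B : M} (hB : Z.cl B ≠ 0) :
    1 ≤ Z.quadCoeff χ (B ^ 2) := by
  unfold quadCoeff
  rw [if_neg (by rw [map_pow]; exact pow_ne_zero 2 hB)]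
  refine one_le_divisorSum_sq (by simp [X_one]) (fun A B ↦ ?_) (fun A ↦ (Z.X_real hχ A).2)
      (ne_zero_of_cl hB)
  rw [X_mul, (Z.X_real hχ A).1, (Z.X_real hχ B).1, ← ofReal_mul, ofReal_re]
  simp

lemma tsum_fiber_eq_quadCoeff {χ : AddChar (Additive G) ℂ} (hχ : -χ = χ) (B : M) :
    ∑' x : (fun x : M × M ↦ x.1 * x.2) ⁻¹' {B}, Z.X 0 x.1.1 * Z.X χ x.1.2 = Z.quadCoeff χ B := by
  unfold quadCoeff
  split_ifs with h
  · rw [ofReal_zero]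
    convert tsum_zero with x
    have hx : x.1.1 * x.1.2 = B := x.2
    rw [← hx, map_mul] at h
    rcases mul_eq_zero.1 h with h | h
    · rw [X_of_cl_zero 0 h, zero_mul]
    · rw [X_of_cl_zero χ h, mul_zero]
  · have hB : B ≠ 0 := ne_zero_of_cl h
    let e : ((fun x : M × M ↦ x.1 * x.2) ⁻¹' {B}) ≃ {D // D ∣ B} :=
      Equiv.ofBijective (fun x ↦ ⟨x.1.2, x.1.1, by rw [mul_comm]; exact x.2.symm⟩) (by
        constructor
        · rintro ⟨⟨a, b⟩, hab⟩ ⟨⟨c, d⟩, hcd⟩ h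
          simp only [Subtype.mk.injEq] at h
          subst h
          have h1 : a * b = B := hab
          have h2 : c * b = B := hcd
          have hb : b ≠ 0 := by rintro rfl; rw [mul_zero] at h1; exact hB h1.symm
          have : a = c := mul_right_cancel₀ hb (h1.trans h2.symm)
          subst this
          rfl
        · rintro ⟨D, C, rfl⟩
          exact ⟨⟨(C, D), by simp [mul_comm]⟩, rfl⟩)
    rw [divisorSum, ofReal_tsum, ← e.tsum_eq]
    refine tsum_congr fun x ↦ ?_
    have hx : x.1.1 * x.1.2 = B := x.2
    have h1 : Z.cl x.1.1 ≠ 0 := by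
      intro h0
      rw [← hx, map_mul, h0, zero_mul] at h
      exact h rfl
    rw [Z.X_zero_char h1, one_mul]
    exact (Z.X_real hχ _).1

lemma hasSum_quadCoeff {χ : AddChar (Additive G) ℂ} (hχ : -χ = χ) {s : ℂ} (hs : 1 < s.re) :
    HasSum (fun B ↦ (Z.quadCoeff χ B : ℂ) * (Z.N B : ℂ) ^ (-s)) (Z.L 0 s * Z.L χ s) := by
  have h1 := summable_mul_of_summable_norm (Z.summable_L 0 hs).norm (Z.summable_L χ hs).norm
  have h2 := tsum_mul_tsum_of_summable_norm (Z.summable_L 0 hs).norm (Z.summable_L χ hs).norm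
  have h3 := h1.hasSum.tsum_fiberwise (fun x : M × M ↦ x.1 * x.2)
  rw [← h2] at h3
  convert! h3 using 1
  funext B
  rw [← Z.tsum_fiber_eq_quadCoeff hχ, ← tsum_mul_right]
  refine tsum_congr fun x ↦ ?_
  have hx : x.1.1 * x.1.2 = B := x.2
  have hN : (Z.N B : ℂ) ^ (-s) = (Z.N x.1.1 : ℂ) ^ (-s) * (Z.N x.1.2 : ℂ) ^ (-s) := by
    rw [← cpow_N_mul, hx]
  rw [hN]
  ring

/-- If `L χ` vanishes at `1` for a quadratic `χ`, then Landau's theorem bounds the sum of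
`quadCoeff χ` with weights `N(B)^{-1/2}`, because the zero cancels the pole of `L 0`. -/
lemma summable_quadCoeff {χ : AddChar (Additive G) ℂ} (hχ : -χ = χ) (hχ0 : χ ≠ 0)
    (hH : Z.H χ 1 = 0) : Summable fun B ↦ Z.quadCoeff χ B * (Z.N B : ℝ) ^ (-(1 / 2) : ℝ) := by
  classical
  set F : ℂ → ℂ := fun s ↦ ((Nat.card G : ℂ) * Z.κ + (s - 1) * Z.H 0 s) * dslope (Z.H χ) 1 s
  have hF : DifferentiableOn ℂ F {s | 0 < s.re} := by
    refine DifferentiableOn.mul ?_ ?_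
    · have := Z.diff_H 0
      fun_prop
    · exact (differentiableOn_dslope (isOpen_re_pos.mem_nhds (by simp))).2 (Z.diff_H χ)
  have hFL : ∀ s : ℂ, 1 < s.re → F s = Z.L 0 s * Z.L χ s := by
    intro s hs
    have hs1 : s - 1 ≠ 0 := by
      intro h
      rw [sub_eq_zero.1 h] at hs
      simp at hs
    rw [Z.L_zero_eq hs, Z.L_eq_of_ne hχ0 hs]
    simp only [F]
    rw [dslope_of_ne _ (sub_ne_zero.1 hs1), slope_def_field, hH]
    field_simp
    ring
  have hsum : ∀ s : ℂ, 1 < s.re → HasSum (fun n : ℕ ↦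
      ((∑' B : Z.N ⁻¹' {n}, Z.quadCoeff χ B : ℝ) : ℂ) * (n : ℂ) ^ (-s)) (F s) := by
    intro s hs
    rw [hFL s hs]
    convert! (Z.hasSum_quadCoeff hχ hs).tsum_fiberwise Z.N using 1
    funext n
    rw [ofReal_tsum, ← tsum_mul_right]
    refine tsum_congr fun B ↦ ?_
    rw [show Z.N B.1 = n from B.2]
  have hLandau := fun T ↦ sum_LSeries_le
    (fun n ↦ tsum_nonneg fun B : Z.N ⁻¹' {n} ↦ Z.quadCoeff_nonneg hχ B) hF hsum T
    (σ := 1 / 2) (by norm_num) (by norm_num)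
  have hfib : ∀ n ≠ 0, Summable fun B : Z.N ⁻¹' {n} ↦ Z.quadCoeff χ B := by
    intro n hn
    have h1 := (Z.hasSum_quadCoeff hχ (s := 2) (by simp)).summable.norm
    have h2 := (h1.comp_injective (Subtype.val_injective (p := (· ∈ Z.N ⁻¹' {n})))).mul_right
      ‖(n : ℂ) ^ (2 : ℂ)‖
    refine h2.congr fun B ↦ ?_
    have hB : Z.N B.1 = n := B.2
    have hn' : (n : ℂ) ≠ 0 := by exact_mod_cast hn
    rw [Function.comp_apply, hB, norm_mul, mul_assoc, ← norm_mul, ← cpow_add _ _ hn']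
    simp [abs_of_nonneg (Z.quadCoeff_nonneg hχ B.1)]
  refine summable_of_sum_le (c := (F ((1 / 2 : ℝ) : ℂ)).re)
    (fun B ↦ mul_nonneg (Z.quadCoeff_nonneg hχ B) (by positivity)) fun U ↦ ?_
  refine le_trans ?_ (hLandau (U.image Z.N))
  rw [← Finset.sum_fiberwise_of_maps_to (g := Z.N) (t := U.image Z.N)
    fun B hB ↦ Finset.mem_image_of_mem _ hB]
  refine Finset.sum_le_sum fun n _ ↦ ?_
  rcases eq_or_ne n 0 with rfl | hn
  · rw [Nat.cast_zero, Real.zero_rpow (by norm_num), mul_zero]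
    refine (Finset.sum_eq_zero fun B hB ↦ ?_).le
    rw [(Finset.mem_filter.1 hB).2, Nat.cast_zero, Real.zero_rpow (by norm_num), mul_zero]
  · have e1 : ∑ B ∈ U with Z.N B = n, Z.quadCoeff χ B * (Z.N B : ℝ) ^ (-(1 / 2) : ℝ) =
        (∑ B ∈ U with Z.N B = n, Z.quadCoeff χ B) * (n : ℝ) ^ (-(1 / 2) : ℝ) := by
      rw [Finset.sum_mul]
      exact Finset.sum_congr rfl fun B hB ↦ by rw [(Finset.mem_filter.1 hB).2]
    rw [e1]
    gcongr
    have hmem : ∀ B ∈ U.filter (fun B ↦ Z.N B = n), B ∈ Z.N ⁻¹' {n} :=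
      fun B hB ↦ (Finset.mem_filter.1 hB).2
    rw [← Finset.sum_subtype_of_mem (p := (· ∈ Z.N ⁻¹' {n})) _ hmem]
    exact (hfib n hn).sum_le_tsum _ fun B _ ↦ Z.quadCoeff_nonneg hχ B

lemma sq_injective_of_unique_units : Function.Injective fun A : M ↦ A ^ 2 := by
  intro A B h
  have h' : A ^ 2 = B ^ 2 := h
  refine associated_iff_eq.1 (associated_of_dvd_dvd ?_ ?_)
  · exact (UniqueFactorizationMonoid.pow_dvd_pow_iff_dvd two_ne_zero).1 h'.dvd
  · exact (UniqueFactorizationMonoid.pow_dvd_pow_iff_dvd two_ne_zero).1 h'.symm.dvd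

/-- `∑ N(A)^{-1}` diverges, because of the pole of the zeta function at `1`. -/
lemma not_summable_w_one : ¬Summable (Z.w 1) := by
  intro h
  have hlim : Tendsto (fun σ : ℝ ↦ ‖(Nat.card G : ℂ) * Z.κ + (σ - 1) * Z.H 0 σ‖)
      (𝓝[>] 1) (𝓝 ‖(Nat.card G : ℂ) * Z.κ‖) := by
    have h1 : ContinuousAt (Z.H 0) ((1 : ℝ) : ℂ) := (Z.analyticAt_H 0 (by simp)).continuousAt
    have h2 : ContinuousAt (fun σ : ℝ ↦ Z.H 0 (σ : ℂ)) 1 := h1.comp continuous_ofReal.continuousAt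
    have h3 : ContinuousAt (fun σ : ℝ ↦ ‖(Nat.card G : ℂ) * Z.κ + (σ - 1) * Z.H 0 σ‖) 1 := by
      fun_prop
    have := h3.tendsto
    simp only [ofReal_one, sub_self, zero_mul, add_zero] at this
    exact this.mono_left nhdsWithin_le_nhds
  have hlim2 : Tendsto (fun σ : ℝ ↦ (σ - 1) * ∑' A, Z.w 1 A) (𝓝[>] 1) (𝓝 0) := by
    have : ContinuousAt (fun σ : ℝ ↦ (σ - 1) * ∑' A, Z.w 1 A) 1 := by fun_prop
    have := this.tendsto
    rw [sub_self, zero_mul] at this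
    exact this.mono_left nhdsWithin_le_nhds
  have hle := le_of_tendsto_of_tendsto hlim hlim2 ?_
  · have h0 : (Nat.card G : ℂ) * Z.κ ≠ 0 :=
      mul_ne_zero (by exact_mod_cast Nat.card_pos.ne') (by exact_mod_cast Z.κ_pos.ne')
    exact h0 (norm_le_zero_iff.1 hle)
  · filter_upwards [self_mem_nhdsWithin] with σ hσ
    have hσ' : 1 < σ := hσ
    have hs : 1 < (σ : ℂ).re := by simpa using hσ
    have hs1 : (σ : ℂ) - 1 ≠ 0 := by
      rw [← ofReal_one, ← ofReal_sub]; exact_mod_cast (sub_pos.2 hσ').ne'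
    have : (Nat.card G : ℂ) * Z.κ + (σ - 1) * Z.H 0 σ = (σ - 1) * Z.L 0 σ := by
      rw [Z.L_zero_eq hs]; field_simp
    rw [this, norm_mul, ← ofReal_one, ← ofReal_sub, norm_real,
      Real.norm_of_nonneg (sub_pos.2 hσ').le]
    refine mul_le_mul_of_nonneg_left ?_ (sub_pos.2 hσ').le
    · refine tsum_of_norm_bounded h.hasSum fun A ↦ ?_
      rw [Z.norm_term]
      exact Z.w_anti (by simpa using hσ'.le) A

/-- `L(1, χ) ≠ 0` for quadratic `χ`. -/
lemma H_ne_zero_of_quadratic {χ : AddChar (Additive G) ℂ} (hχ : -χ = χ) (hχ0 : χ ≠ 0) :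
    Z.H χ 1 ≠ 0 := by
  intro hH
  refine Z.not_summable_w_one ?_
  refine Summable.of_nonneg_of_le (Z.w_nonneg 1) (fun B ↦ ?_)
    ((Z.summable_quadCoeff hχ hχ0 hH).comp_injective sq_injective_of_unique_units)
  simp only [Function.comp_apply]
  unfold w
  split_ifs with h
  · exact mul_nonneg (Z.quadCoeff_nonneg hχ _) (by positivity)
  · have e : (Z.N B : ℝ) ^ (-1 : ℝ) = ((Z.N (B ^ 2) : ℕ) : ℝ) ^ (-(1 / 2) : ℝ) := by
      rw [map_pow, Nat.cast_pow, ← Real.rpow_natCast, ← Real.rpow_mul (by positivity)]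
      norm_num
    rw [e]
    exact le_mul_of_one_le_left (by positivity) (Z.one_le_quadCoeff_sq hχ h)

end ClassZeta

end

/-! ### Non-vanishing at `1`, and prime powers in classes -/

noncomputable section

set_option linter.unusedSectionVars false

open Complex Filter Topology Set

namespace ClassZeta

variable {M G : Type*} [CommMonoidWithZero M] [CommGroup G] (Z : ClassZeta M G) [Finite G]
  [UniqueFactorizationMonoid M] [Subsingleton Mˣ]

lemma tendsto_ofReal_one : Tendsto (fun σ : ℝ ↦ (σ : ℂ)) (𝓝[>] 1) (𝓝[≠] 1) := by
  refine tendsto_nhdsWithin_iff.2 ⟨?_, ?_⟩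
  · have : ContinuousAt (fun σ : ℝ ↦ (σ : ℂ)) 1 := continuous_ofReal.continuousAt
    have := this.tendsto
    rw [ofReal_one] at this
    exact this.mono_left nhdsWithin_le_nhds
  · filter_upwards [self_mem_nhdsWithin] with σ hσ
    have hσ' : 1 < σ := hσ
    simpa using hσ'.ne'

/-- The logarithmic derivative `-L'/L` of `L χ`. -/
def P (χ : AddChar (Additive G) ℂ) (s : ℂ) : ℂ := ∑' v, Z.logDerivTerm χ s v

lemma isOpen_one_lt_re : IsOpen {s : ℂ | 1 < s.re} := isOpen_lt continuous_const continuous_re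

lemma H_mul_P {χ : AddChar (Additive G) ℂ} (hχ : χ ≠ 0) {s : ℂ} (hs : 1 < s.re) :
    Z.H χ s * Z.P χ s = -deriv (Z.H χ) s := by
  have h := Z.L_mul_logDeriv χ hs
  rw [Z.L_eq_of_ne hχ hs] at h
  rw [P, h]
  congr 1
  refine EventuallyEq.deriv_eq ?_
  filter_upwards [isOpen_one_lt_re.mem_nhds hs] with z hz
  exact Z.L_eq_of_ne hχ hz

/-- For nontrivial `χ` the residue of `-L'/L` at `1` is minus the order of vanishing. -/
lemma tendsto_P {χ : AddChar (Additive G) ℂ} (hχ : χ ≠ 0) :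
    ∃ m : ℕ, (Z.H χ 1 = 0 → 1 ≤ m) ∧
      Tendsto (fun σ : ℝ ↦ ((σ : ℂ) - 1) * Z.P χ σ) (𝓝[>] 1) (𝓝 (-m)) := by
  obtain ⟨m, h1, h2, h3⟩ := tendsto_sub_mul_logDeriv (Z.analyticAt_H χ (s := 1) (by simp))
    (Z.H_not_eventually_zero hχ)
  refine ⟨m, h1, ((h3.comp tendsto_ofReal_one).neg).congr' ?_⟩
  filter_upwards [self_mem_nhdsWithin, tendsto_ofReal_one.eventually h2] with σ hσ hH
  have := Z.H_mul_P hχ (s := σ) (by simpa using hσ)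
  have e : Z.P χ σ = -(deriv (Z.H χ) σ / Z.H χ σ) := by
    rw [eq_comm, ← neg_div, ← this, mul_div_cancel_left₀ _ hH]
  rw [Function.comp_apply, e, mul_neg]

/-- The simple pole of `L 0` at `1` gives `-L'/L` the residue `1`. -/
lemma tendsto_P_zero :
    Tendsto (fun σ : ℝ ↦ ((σ : ℂ) - 1) * Z.P 0 σ) (𝓝[>] 1) (𝓝 1) := by
  set g : ℂ → ℂ := fun s ↦ (Nat.card G : ℂ) * Z.κ + (s - 1) * Z.H 0 s with hg
  have hga : AnalyticAt ℂ g 1 := by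
    have := Z.analyticAt_H 0 (s := 1) (by simp)
    fun_prop
  have h0 : (Nat.card G : ℂ) * Z.κ ≠ 0 :=
      mul_ne_zero (by exact_mod_cast Nat.card_pos.ne') (by exact_mod_cast Z.κ_pos.ne')
  have hg1 : g 1 ≠ 0 := by simpa [hg] using h0
  have hlim : Tendsto (fun s ↦ 1 - (s - 1) * (deriv g s / g s)) (𝓝 1) (𝓝 1) := by
    have : ContinuousAt (fun s ↦ 1 - (s - 1) * (deriv g s / g s)) 1 := by
      have h1 := hga.deriv.continuousAt
      have h2 := hga.continuousAt
      fun_prop (disch := assumption)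
    simpa using! this.tendsto
  refine ((hlim.mono_left nhdsWithin_le_nhds).comp tendsto_ofReal_one).congr' ?_
  filter_upwards [self_mem_nhdsWithin, tendsto_ofReal_one.eventually
    ((hga.continuousAt.eventually_ne hg1).filter_mono nhdsWithin_le_nhds),
    tendsto_ofReal_one.eventually (hga.eventually_analyticAt.filter_mono nhdsWithin_le_nhds)]
    with σ hσ hgσ hgσa
  have hs : 1 < (σ : ℂ).re := by simpa using hσ
  have hs1 : (σ : ℂ) - 1 ≠ 0 := by
    intro h
    rw [sub_eq_zero.1 h] at hs
    simp at hs
  have hL : ∀ s : ℂ, 1 < s.re → Z.L 0 s = g s / (s - 1) := by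
    intro s hs
    have hs1 : s - 1 ≠ 0 := by
      intro h
      rw [sub_eq_zero.1 h] at hs
      simp at hs
    rw [Z.L_zero_eq hs, hg]
    field_simp
  have hd : deriv (Z.L 0) σ = (deriv g σ * (σ - 1) - g σ) / (σ - 1) ^ 2 := by
    have : Z.L 0 =ᶠ[𝓝 (σ : ℂ)] fun s ↦ g s / (s - 1) := by
      filter_upwards [isOpen_one_lt_re.mem_nhds hs] with z hz using hL z hz
    rw [this.deriv_eq]
    have := hgσa.differentiableAt.hasDerivAt.fun_div ((hasDerivAt_id (σ : ℂ)).sub_const 1) hs1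
    simpa using this.deriv
  have hP := Z.L_mul_logDeriv 0 hs
  rw [hd, hL _ hs] at hP
  have e : Z.P 0 σ = (g σ - deriv g σ * (σ - 1)) / (g σ * (σ - 1)) := by
    change g σ / (σ - 1) * Z.P 0 σ = _ at hP
    field_simp at hP ⊢
    linear_combination hP
  rw [Function.comp_apply, e]
  field_simp

/-- The sum of `log N(Q) N(Q ^ (k + 1))^{-σ}` over the prime powers in the class `g`. -/
def primePowerSum (g : G) (σ : ℝ) : ℝ := ∑' v : {Q : M // Prime Q} × ℕ, open Classical in
  if Z.cl (v.1.1 ^ (v.2 + 1)) = g then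
    (Z.N (v.1.1 ^ (v.2 + 1)) : ℝ) ^ (-σ) * Real.log (Z.N v.1.1) else 0

lemma primePowerSum_nonneg (g : G) (σ : ℝ) : 0 ≤ Z.primePowerSum g σ := by
  refine tsum_nonneg fun v ↦ ?_
  split_ifs
  · exact mul_nonneg (by positivity) (Real.log_natCast_nonneg _)
  · rfl

lemma sum_char_mul_X [Fintype (AddChar (Additive G) ℂ)] (g : G) (A : M) :
    ∑ χ : AddChar (Additive G) ℂ, χ (-Additive.ofMul g) * Z.X χ A =
      open Classical in if Z.cl A = g then (Nat.card G : ℂ) else 0 := by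
  classical
  have := Fintype.ofFinite G
  rcases Z.cl_cases A with hA | ⟨a, hA⟩
  · simp [X_of_cl_zero _ hA, hA]
  · have h1 : ∀ χ : AddChar (Additive G) ℂ, χ (-Additive.ofMul g) * Z.X χ A =
        χ (-Additive.ofMul g + Additive.ofMul a) := fun χ ↦ by
      rw [X_of_cl_eq χ hA, AddChar.map_add_eq_mul]
    simp_rw [h1]
    have h2 := AddChar.sum_apply_eq_ite (α := Additive G) (-Additive.ofMul g + Additive.ofMul a)
    have h3 : (-Additive.ofMul g + Additive.ofMul a = 0) ↔ Z.cl A = g := by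
      rw [neg_add_eq_zero, hA, WithZero.coe_inj, eq_comm]
      exact Additive.ofMul.injective.eq_iff
    simp only [h3] at h2
    rw [Nat.card_eq_fintype_card, ← Fintype.card_additive]
    convert! h2

lemma sum_char_mul_P [Fintype (AddChar (Additive G) ℂ)] (g : G) {σ : ℝ} (hσ : 1 < σ) :
    ∑ χ : AddChar (Additive G) ℂ, χ (-Additive.ofMul g) * Z.P χ σ =
      ((Nat.card G * Z.primePowerSum g σ : ℝ) : ℂ) := by
  classical
  have hs : 1 < (σ : ℂ).re := by simpa using hσ
  have h1 : ∀ χ : AddChar (Additive G) ℂ, χ (-Additive.ofMul g) * Z.P χ σ =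
      ∑' v, χ (-Additive.ofMul g) * Z.logDerivTerm χ σ v := fun χ ↦ by rw [tsum_mul_left, P]
  simp_rw [h1]
  unfold primePowerSum
  rw [ofReal_mul, ofReal_tsum, ← tsum_mul_left]
  rw [← Summable.tsum_finsetSum fun χ _ ↦ (Z.summable_logDerivTerm χ hs).mul_left _]
  refine tsum_congr fun v ↦ ?_
  unfold logDerivTerm
  simp_rw [← mul_assoc]
  rw [← Finset.sum_mul, ← Finset.sum_mul, Z.sum_char_mul_X]
  split_ifs
  · push_cast
    rw [ofReal_cpow (Nat.cast_nonneg _)]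
    push_cast
    ring
  · simp

/-- Complex conjugation carries `L χ` to `L (-χ)`. -/
lemma H_neg {χ : AddChar (Additive G) ℂ} (hχ : χ ≠ 0) (h : Z.H χ 1 = 0) : Z.H (-χ) 1 = 0 := by
  have hχ' : -χ ≠ 0 := neg_ne_zero.2 hχ
  have hlim : ∀ ψ : AddChar (Additive G) ℂ, Tendsto (fun σ : ℝ ↦ Z.H ψ σ) (𝓝[>] 1) (𝓝 (Z.H ψ 1)) :=
    fun ψ ↦ ((Z.analyticAt_H ψ (s := 1) (by simp)).continuousAt.tendsto.mono_left
      nhdsWithin_le_nhds).comp tendsto_ofReal_one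
  have h1 := (continuous_conj.tendsto _).comp (hlim χ)
  rw [h, map_zero] at h1
  refine tendsto_nhds_unique ((hlim (-χ)).congr' ?_) h1
  filter_upwards [self_mem_nhdsWithin] with σ hσ
  have hs : 1 < (σ : ℂ).re := by simpa using hσ
  rw [Function.comp_apply, ← Z.L_eq_of_ne hχ hs, ← Z.L_eq_of_ne hχ' hs, L, L, conj_tsum]
  refine tsum_congr fun A ↦ ?_
  rw [map_mul]
  congr 1
  · rcases Z.cl_cases A with hA | ⟨a, hA⟩
    · simp [X_of_cl_zero _ hA]
    · rw [X_of_cl_eq _ hA, X_of_cl_eq _ hA, AddChar.neg_apply', AddChar.inv_apply_eq_conj]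
  · rw [← ofReal_natCast, ← ofReal_neg, ← ofReal_cpow (Nat.cast_nonneg _), conj_ofReal]

/-- `L(1, χ) ≠ 0` for all nontrivial `χ`. The residues of all the `-L'/L` at `1` add up to a
nonnegative number, so at most one `L χ` vanishes at `1`; such a `χ` is quadratic, since `L (-χ)`
vanishes as well. -/
lemma H_ne_zero {χ : AddChar (Additive G) ℂ} (hχ : χ ≠ 0) : Z.H χ 1 ≠ 0 := by
  classical
  have := Fintype.ofFinite G
  have : Fintype (AddChar (Additive G) ℂ) := Fintype.ofFinite _
  intro h0
  by_cases hq : -χ = χ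
  · exact Z.H_ne_zero_of_quadratic hq hχ h0
  have hm : ∀ ψ : AddChar (Additive G) ℂ, ∃ r : ℤ, (ψ ≠ 0 → r ≤ 0) ∧ (ψ = 0 → r = 1) ∧
      (ψ ≠ 0 → Z.H ψ 1 = 0 → r ≤ -1) ∧
      Tendsto (fun σ : ℝ ↦ ((σ : ℂ) - 1) * Z.P ψ σ) (𝓝[>] 1) (𝓝 r) := by
    intro ψ
    by_cases hψ : ψ = 0
    · subst hψ
      exact ⟨1, by simp, by simp, by simp, by simpa using Z.tendsto_P_zero⟩
    · obtain ⟨m, h1, h2⟩ := Z.tendsto_P hψ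
      exact ⟨-m, by simp, fun h ↦ absurd h hψ, fun _ h ↦ by have := h1 h; omega, by simpa using h2⟩
  choose r hr0 hr1 hr2 hr3 using hm
  have hsum : Tendsto (fun σ : ℝ ↦ (((σ - 1) * (Nat.card G * Z.primePowerSum 1 σ) : ℝ) : ℂ))
      (𝓝[>] 1) (𝓝 (∑ ψ, (r ψ : ℂ))) := by
    refine (tendsto_finsetSum Finset.univ fun ψ _ ↦ hr3 ψ).congr' ?_
    filter_upwards [self_mem_nhdsWithin] with σ hσ
    have := Z.sum_char_mul_P 1 hσ
    simp only [ofMul_one, neg_zero, AddChar.map_zero_eq_one, one_mul] at this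
    rw [← Finset.mul_sum, this]
    push_cast
    ring
  have hre := (continuous_re.tendsto _).comp hsum
  have hnn : 0 ≤ (∑ ψ, (r ψ : ℂ)).re := by
    refine ge_of_tendsto hre ?_
    filter_upwards [self_mem_nhdsWithin] with σ hσ
    have hσ' : 1 < σ := hσ
    rw [Function.comp_apply, ofReal_re]
    exact mul_nonneg (by linarith) (mul_nonneg (by positivity) (Z.primePowerSum_nonneg _ _))
  have hle : ∑ ψ, r ψ ≤ -1 := by
    have hb : ∀ ψ, r ψ ≤ (if ψ = 0 then 1 else 0) - (if ψ = χ then 1 else 0) -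
        (if ψ = -χ then 1 else 0) := by
      intro ψ
      by_cases e0 : ψ = 0
      · subst e0
        simp [hr1 0 rfl, hχ.symm, (neg_ne_zero.2 hχ).symm]
      by_cases e1 : ψ = χ
      · subst e1
        have := hr2 ψ hχ h0
        simp [hχ, Ne.symm hq]
        exact this
      by_cases e2 : ψ = -χ
      · subst e2
        have := hr2 (-χ) e0 (Z.H_neg hχ h0)
        simp [hχ, hq]
        exact this
      simpa [e0, e1, e2] using hr0 ψ e0
    refine (Finset.sum_le_sum fun ψ _ ↦ hb ψ).trans ?_
    simp [Finset.sum_sub_distrib]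
  have : (∑ ψ, (r ψ : ℂ)).re = ((∑ ψ, r ψ : ℤ) : ℝ) := by
    rw [← Int.cast_sum, intCast_re]
  rw [this] at hnn
  have : (0 : ℤ) ≤ ∑ ψ, r ψ := by exact_mod_cast hnn
  omega

/-- The weighted sum over the prime powers in a class diverges for `σ → 1`, since only the trivial
character contributes to the pole of its expansion in characters. -/
theorem tendsto_primePowerSum (g : G) : Tendsto (Z.primePowerSum g) (𝓝[>] 1) atTop := by
  classical
  have := Fintype.ofFinite G
  have : Fintype (AddChar (Additive G) ℂ) := Fintype.ofFinite _
  have hlim : Tendsto (fun σ : ℝ ↦ ∑ χ : AddChar (Additive G) ℂ,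
      χ (-Additive.ofMul g) * (((σ : ℂ) - 1) * Z.P χ σ)) (𝓝[>] 1) (𝓝 1) := by
    have h1 : ∀ χ ∈ Finset.univ (α := AddChar (Additive G) ℂ),
        Tendsto (fun σ : ℝ ↦ χ (-Additive.ofMul g) * (((σ : ℂ) - 1) * Z.P χ σ)) (𝓝[>] 1)
          (𝓝 (if χ = 0 then 1 else 0)) := by
      intro χ _
      split_ifs with h
      · subst h
        simpa using Z.tendsto_P_zero
      · have hH := Z.analyticAt_H χ (s := 1) (by simp)
        have h0 := Z.H_ne_zero h
        have hc : Tendsto (fun s ↦ χ (-Additive.ofMul g) * ((s - 1) *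
            (-(deriv (Z.H χ) s / Z.H χ s)))) (𝓝 1) (𝓝 0) := by
          have : ContinuousAt (fun s ↦ χ (-Additive.ofMul g) * ((s - 1) *
            (-(deriv (Z.H χ) s / Z.H χ s)))) 1 := by
            have h1 := hH.deriv.continuousAt
            have h2 := hH.continuousAt
            fun_prop (disch := assumption)
          simpa using! this.tendsto
        refine ((hc.mono_left nhdsWithin_le_nhds).comp tendsto_ofReal_one).congr' ?_
        filter_upwards [self_mem_nhdsWithin, tendsto_ofReal_one.eventually
          ((hH.continuousAt.eventually_ne h0).filter_mono nhdsWithin_le_nhds)] with σ hσ hne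
        have := Z.H_mul_P h (s := σ) (by simpa using hσ)
        rw [Function.comp_apply, ← neg_div, ← this, mul_div_cancel_left₀ _ hne]
    have := tendsto_finsetSum _ h1
    simpa using this
  have hlim2 : Tendsto (fun σ : ℝ ↦ (σ - 1) * (Nat.card G * Z.primePowerSum g σ)) (𝓝[>] 1)
      (𝓝 1) := by
    have := (continuous_re.tendsto _).comp hlim
    rw [one_re] at this
    refine this.congr' ?_
    filter_upwards [self_mem_nhdsWithin] with σ hσ
    have h2 := Z.sum_char_mul_P g hσ
    have h3 : ∑ χ : AddChar (Additive G) ℂ,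
        χ (-Additive.ofMul g) * (((σ : ℂ) - 1) * Z.P χ σ) =
        (((σ - 1) * (Nat.card G * Z.primePowerSum g σ) : ℝ) : ℂ) := by
      rw [ofReal_mul, ← h2, Finset.mul_sum]
      refine Finset.sum_congr rfl fun χ _ ↦ ?_
      push_cast
      ring
    rw [Function.comp_apply, h3, ofReal_re]
  have hinv : Tendsto (fun σ : ℝ ↦ (σ - 1)⁻¹ * (Nat.card G : ℝ)⁻¹) (𝓝[>] 1) atTop := by
    refine Tendsto.atTop_mul_const (by
      have : (0 : ℝ) < Nat.card G := by exact_mod_cast Nat.card_pos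
      positivity) ?_
    refine tendsto_inv_nhdsGT_zero.comp ?_
    refine tendsto_nhdsWithin_iff.2 ⟨?_, ?_⟩
    · have : ContinuousAt (fun σ : ℝ ↦ σ - 1) 1 := by fun_prop
      have := this.tendsto
      rw [sub_self] at this
      exact this.mono_left nhdsWithin_le_nhds
    · filter_upwards [self_mem_nhdsWithin] with σ hσ
      have hσ' : 1 < σ := hσ
      exact sub_pos.2 hσ'
  refine (hinv.atTop_mul_pos one_pos hlim2).congr' ?_
  filter_upwards [self_mem_nhdsWithin] with σ hσ
  have hσ' : 1 < σ := hσ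
  have h1 : σ - 1 ≠ 0 := (sub_pos.2 hσ').ne'
  have h2 : (Nat.card G : ℝ) ≠ 0 := by exact_mod_cast Nat.card_pos.ne'
  field_simp

end ClassZeta

end

/-! ### Theta series of `x² + D y²` -/

noncomputable section

open Complex Filter Topology Set Asymptotics

/-- By the functional equation the theta kernel differs from `x ^ (-1 / 2)` by an exponentially
small amount for `x → 0`. -/
lemma isBigO_evenKernel_sub (a : UnitAddCircle) :
    (fun x ↦ HurwitzZeta.evenKernel a x - x ^ (-(1 / 2) : ℝ)) =O[𝓝[>] 0]
      fun x : ℝ ↦ x ^ (1 / 2 : ℝ) := by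
  obtain ⟨p, hp, h⟩ := HurwitzZeta.isBigO_atTop_cosKernel_sub a
  have h1 := (h.trans (isLittleO_exp_neg_mul_rpow_atTop hp (-1)).isBigO).comp_tendsto
    tendsto_inv_nhdsGT_zero
  have h2 := (isBigO_refl (fun x : ℝ ↦ x ^ (-(1 / 2) : ℝ)) (𝓝[>] 0)).mul h1
  refine (h2.congr' ?_ ?_)
  · filter_upwards [self_mem_nhdsWithin] with x hx
    have hx' : 0 < x := hx
    rw [HurwitzZeta.evenKernel_functional_equation, Function.comp_apply, one_div x,
      Real.rpow_neg hx'.le]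
    ring
  · filter_upwards [self_mem_nhdsWithin] with x hx
    have hx' : 0 < x := hx
    rw [Function.comp_apply, Real.rpow_neg_one, inv_inv]
    nth_rw 2 [← Real.rpow_one x]
    rw [← Real.rpow_add hx']
    norm_num

/-- The theta series of an arithmetic progression, up to `O(t ^ (1 / 2))` for `t → 0`. -/
lemma exists_theta_progression (i : ℤ) {k : ℕ} (hk : 0 < k) {c : ℝ} (hc : 0 < c) :
    ∃ f : ℝ → ℝ, (∀ t, 0 < t → HasSum (fun n : ℤ ↦ Real.exp (-(t * (c * (i + k * n : ℤ) ^ 2)))) (f t)) ∧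
      (fun t ↦ f t - √(Real.pi / c) / k * t ^ (-(1 / 2) : ℝ)) =O[𝓝[>] 0]
        fun t : ℝ ↦ t ^ (1 / 2 : ℝ) := by
  have hk' : (0 : ℝ) < k := by exact_mod_cast hk
  set m : ℝ := c * k ^ 2 / Real.pi with hm
  have hm0 : 0 < m := by have := Real.pi_pos; positivity
  refine ⟨fun t ↦ HurwitzZeta.evenKernel ((i / k : ℝ) : UnitAddCircle) (m * t), fun t ht ↦ ?_, ?_⟩
  · convert! HurwitzZeta.hasSum_int_evenKernel (i / k : ℝ) (mul_pos hm0 ht) using 1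
    funext n
    congr 1
    rw [hm]
    push_cast
    have := Real.pi_pos.ne'
    field_simp
    ring
  · have hlim : Tendsto (fun t : ℝ ↦ m * t) (𝓝[>] 0) (𝓝[>] 0) := by
      refine tendsto_nhdsWithin_iff.2 ⟨?_, ?_⟩
      · have : ContinuousAt (fun t : ℝ ↦ m * t) 0 := by fun_prop
        have := this.tendsto
        rw [mul_zero] at this
        exact this.mono_left nhdsWithin_le_nhds
      · filter_upwards [self_mem_nhdsWithin] with t ht
        exact mul_pos hm0 ht
    have h1 := (isBigO_evenKernel_sub ((i / k : ℝ) : UnitAddCircle)).comp_tendsto hlim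
    have h2 : ((fun x : ℝ ↦ x ^ (1 / 2 : ℝ)) ∘ fun t ↦ m * t) =O[𝓝[>] 0]
        fun t : ℝ ↦ t ^ (1 / 2 : ℝ) := by
      refine (isBigO_const_mul_self (m ^ (1 / 2 : ℝ)) (fun t : ℝ ↦ t ^ (1 / 2 : ℝ)) _).congr' ?_
        EventuallyEq.rfl
      filter_upwards [self_mem_nhdsWithin] with t ht
      rw [Function.comp_apply, Real.mul_rpow hm0.le (le_of_lt ht)]
    refine (h1.trans h2).congr' ?_ EventuallyEq.rfl
    filter_upwards [self_mem_nhdsWithin] with t ht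
    have ht' : 0 < t := ht
    rw [Function.comp_apply, Real.mul_rpow hm0.le ht'.le]
    congr 2
    rw [Real.rpow_neg hm0.le, ← Real.sqrt_eq_rpow, hm, ← Real.sqrt_inv, inv_div]
    rw [mul_comm c, ← div_div, div_right_comm, Real.sqrt_div (by have := Real.pi_pos; positivity),
      Real.sqrt_sq hk'.le]

lemma isBigO_mul_theta {f g : ℝ → ℝ} {A B : ℝ}
    (hf : (fun t ↦ f t - A * t ^ (-(1 / 2) : ℝ)) =O[𝓝[>] 0] fun t : ℝ ↦ t ^ (1 / 2 : ℝ))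
    (hg : (fun t ↦ g t - B * t ^ (-(1 / 2) : ℝ)) =O[𝓝[>] 0] fun t : ℝ ↦ t ^ (1 / 2 : ℝ)) :
    (fun t ↦ f t * g t - A * B / t) =O[𝓝[>] 0] fun _ : ℝ ↦ (1 : ℝ) := by
  have hone : (fun t : ℝ ↦ t ^ (-(1 / 2) : ℝ) * t ^ (1 / 2 : ℝ)) =ᶠ[𝓝[>] 0] fun _ ↦ 1 := by
    filter_upwards [self_mem_nhdsWithin] with t ht
    rw [← Real.rpow_add ht]
    norm_num
  have hinv : ∀ C : ℝ, (fun t : ℝ ↦ C * t ^ (-(1 / 2) : ℝ)) =O[𝓝[>] 0]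
      fun t : ℝ ↦ t ^ (-(1 / 2) : ℝ) := fun C ↦ isBigO_const_mul_self _ _ _
  have h1 := ((hinv A).mul hg).congr' EventuallyEq.rfl hone
  have h2 := ((hinv B).mul hf).congr' EventuallyEq.rfl hone
  have h3 : (fun t ↦ (f t - A * t ^ (-(1 / 2) : ℝ)) * (g t - B * t ^ (-(1 / 2) : ℝ)))
      =O[𝓝[>] 0] fun _ : ℝ ↦ (1 : ℝ) := by
    refine (hf.mul hg).trans ?_
    have : (fun t : ℝ ↦ t ^ (1 / 2 : ℝ) * t ^ (1 / 2 : ℝ)) =ᶠ[𝓝[>] 0] fun t ↦ t := by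
      filter_upwards [self_mem_nhdsWithin] with t ht
      rw [← Real.rpow_add ht]
      norm_num
    refine (EventuallyEq.isBigO this).trans ?_
    exact ((continuous_id.tendsto (0 : ℝ)).mono_left nhdsWithin_le_nhds).isBigO_one ℝ
  refine ((h1.add h2).add h3).congr' ?_ EventuallyEq.rfl
  filter_upwards [self_mem_nhdsWithin] with t ht
  have ht' : 0 < t := ht
  have e : t ^ (-(1 / 2) : ℝ) * t ^ (-(1 / 2) : ℝ) = 1 / t := by
    rw [← Real.rpow_add ht', one_div t, ← Real.rpow_neg_one t]
    norm_num
  rw [div_eq_mul_one_div (A * B), ← e]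
  ring

/-- The theta series of the fibre over `a` of a surjection `ψ` from `ℤ²` to a finite group, for the
quadratic form `x² + D y²`. Its main term for `t → 0` does not depend on `a`. -/
theorem exists_theta_fiber {A : Type*} [AddCommGroup A] [Finite A] (ψ : ℤ × ℤ →+ A)
    (hψ : Function.Surjective ψ) (a : A) {D : ℝ} (hD : 0 < D) :
    ∃ f : ℝ → ℝ, (∀ t, 0 < t → HasSum (fun w : ℤ × ℤ ↦ open Classical in
        if ψ w = a then Real.exp (-(t * (w.1 ^ 2 + D * w.2 ^ 2))) else 0) (f t)) ∧
      (fun t ↦ f t - Real.pi / √D / Nat.card A / t) =O[𝓝[>] 0] fun _ : ℝ ↦ (1 : ℝ) := by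
  classical
  have := Fintype.ofFinite A
  set k := Nat.card A with hkA
  have hk : 0 < k := Nat.card_pos
  have : NeZero k := ⟨hk.ne'⟩
  have hkill : ∀ x : A, k • x = 0 := fun x ↦ card_nsmul_eq_zero'
  have hlift : ∀ g : ℤ →+ A, ∃ g' : ZMod k →+ A, ∀ n : ℤ, g' n = g n := fun g ↦
    ⟨ZMod.lift k ⟨g, by
      have := g.map_nsmul k 1
      rw [hkill] at this
      simpa using this⟩, fun n ↦ by simp⟩
  obtain ⟨g1, hg1⟩ := hlift (ψ.comp (AddMonoidHom.inl ℤ ℤ))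
  obtain ⟨g2, hg2⟩ := hlift (ψ.comp (AddMonoidHom.inr ℤ ℤ))
  set φ : ZMod k × ZMod k →+ A := g1.coprod g2 with hφ
  have hφψ : ∀ w : ℤ × ℤ, φ ((w.1 : ZMod k), (w.2 : ZMod k)) = ψ w := by
    intro w
    rw [hφ, AddMonoidHom.coprod_apply, hg1, hg2, AddMonoidHom.comp_apply, AddMonoidHom.comp_apply,
      ← map_add]
    simp
  have hφs : Function.Surjective φ := fun b ↦ by
    obtain ⟨w, rfl⟩ := hψ b
    exact ⟨_, hφψ w⟩
  have hcount : (Finset.univ.filter fun r : ZMod k × ZMod k ↦ φ r = a).card = k := by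
    have h1 : ∀ b : A, (Finset.univ.filter fun r : ZMod k × ZMod k ↦ φ r = b).card =
        (Finset.univ.filter fun r : ZMod k × ZMod k ↦ φ r = a).card := fun b ↦
      AddMonoidHom.card_fiber_eq_of_mem_range φ (hφs b) (hφs a)
    have h2 := Finset.card_eq_sum_card_fiberwise (f := φ) (s := Finset.univ) (t := Finset.univ)
      fun _ _ ↦ Finset.mem_coe.2 (Finset.mem_univ _)
    rw [Finset.sum_congr rfl fun b _ ↦ h1 b, Finset.sum_const, Finset.card_univ, Finset.card_univ,
      Fintype.card_prod, ZMod.card, smul_eq_mul, ← Nat.card_eq_fintype_card, ← hkA] at h2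
    exact (Nat.eq_of_mul_eq_mul_left hk h2).symm
  choose f1 hf1 hf1' using fun r : ZMod k ↦ exists_theta_progression (r.val : ℤ) hk one_pos
  choose f2 hf2 hf2' using fun r : ZMod k ↦ exists_theta_progression (r.val : ℤ) hk hD
  refine ⟨fun t ↦ ∑ r ∈ Finset.univ.filter fun r : ZMod k × ZMod k ↦ φ r = a, f1 r.1 t * f2 r.2 t,
    fun t ht ↦ ?_, ?_⟩
  · have hprog : ∀ r : ZMod k × ZMod k, HasSum (fun w : ℤ × ℤ ↦
        if ((w.1 : ZMod k), (w.2 : ZMod k)) = r then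
          Real.exp (-(t * (w.1 ^ 2 + D * w.2 ^ 2))) else 0) (f1 r.1 t * f2 r.2 t) := by
      intro r
      set e : ℤ × ℤ → ℤ × ℤ := fun v ↦ (r.1.val + k * v.1, r.2.val + k * v.2) with he
      have hk0 : (k : ℤ) ≠ 0 := by exact_mod_cast hk.ne'
      have hinj : Function.Injective e := by
        rintro ⟨a, b⟩ ⟨c, d⟩ h
        simp only [he, Prod.mk.injEq, add_right_inj, mul_eq_mul_left_iff, hk0, or_false] at h
        rw [h.1, h.2]
      refine (hinj.hasSum_iff ?_).1 ?_
      · intro w hw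
        refine if_neg fun h ↦ hw ?_
        have hdiv : ∀ (n : ℤ) (z : ZMod k), (n : ZMod k) = z → ∃ m : ℤ, z.val + k * m = n := by
          intro n z h
          have : (k : ℤ) ∣ n - z.val := by
            rw [← ZMod.intCast_eq_intCast_iff_dvd_sub]
            simp [h]
          obtain ⟨m, hm⟩ := this
          exact ⟨m, by linarith⟩
        obtain ⟨m1, h1⟩ := hdiv w.1 r.1 (Prod.ext_iff.1 h).1
        obtain ⟨m2, h2⟩ := hdiv w.2 r.2 (Prod.ext_iff.1 h).2
        exact ⟨(m1, m2), Prod.ext h1 h2⟩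
      · have hmul := (hf1 r.1 t ht).mul (hf2 r.2 t ht)
          (summable_mul_of_summable_norm (hf1 r.1 t ht).summable.norm (hf2 r.2 t ht).summable.norm)
        convert! hmul using 1
        funext v
        rw [Function.comp_apply, if_pos (by simp [he]), ← Real.exp_add]
        congr 1
        simp only [he]
        push_cast
        ring
    have hs := hasSum_sum (s := Finset.univ.filter fun r : ZMod k × ZMod k ↦ φ r = a)
      fun r _ ↦ hprog r
    convert! hs using 1
    funext w
    rw [Finset.sum_ite_eq]
    simp only [Finset.mem_filter, Finset.mem_univ, true_and, hφψ]
  · have hs := IsBigO.sum (s := Finset.univ.filter fun r : ZMod k × ZMod k ↦ φ r = a)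
      fun r _ ↦ isBigO_mul_theta (hf1' r.1) (hf2' r.2)
    refine hs.congr_left fun t ↦ ?_
    rw [Finset.sum_apply]
    simp only
    rw [Finset.sum_sub_distrib, Finset.sum_const, hcount, nsmul_eq_mul]
    congr 1
    have hk' : (k : ℝ) ≠ 0 := by exact_mod_cast hk.ne'
    rw [div_one, Real.sqrt_div Real.pi_pos.le]
    field_simp
    rw [Real.sq_sqrt Real.pi_pos.le]

end

/-! ### Mellin transforms of theta series -/

noncomputable section

open Complex Filter Topology Set Asymptotics

section Mellin

variable {ι : Type*} {q : ι → ℝ} {F : ℝ → ℝ}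

lemma continuousOn_of_hasSum_exp (hq : ∀ i, 0 ≤ q i)
    (hF : ∀ t, 0 < t → HasSum (fun i ↦ Real.exp (-(t * q i))) (F t)) : ContinuousOn F (Ioi 0) := by
  intro t ht
  have ht' : 0 < t := ht
  refine ContinuousAt.continuousWithinAt ?_
  have h1 : ContinuousOn (fun x ↦ ∑' i, Real.exp (-(x * q i))) (Ioi (t / 2)) := by
    refine continuousOn_tsum (fun i ↦ by fun_prop) (hF (t / 2) (by linarith)).summable
      fun i x hx ↦ ?_
    rw [Real.norm_of_nonneg (Real.exp_pos _).le]
    have := mul_le_mul_of_nonneg_right (le_of_lt (show t / 2 < x from hx)) (hq i)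
    gcongr
  have h2 : ContinuousAt (fun x ↦ ∑' i, Real.exp (-(x * q i))) t :=
    h1.continuousAt (Ioi_mem_nhds (by linarith))
  refine h2.congr ?_
  filter_upwards [Ioi_mem_nhds ht'] with x hx
  exact (hF x hx).tsum_eq

lemma isBigO_exp_of_hasSum_exp (hq : ∀ i, 1 ≤ q i)
    (hF : ∀ t, 0 < t → HasSum (fun i ↦ Real.exp (-(t * q i))) (F t)) :
    F =O[atTop] fun t ↦ Real.exp (-1 * t) := by
  refine IsBigO.of_bound (Real.exp 1 * F 1) ?_
  filter_upwards [eventually_ge_atTop 1] with t ht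
  have h0 : 0 ≤ F t := (hF t (by linarith)).nonneg fun i ↦ (Real.exp_pos _).le
  rw [Real.norm_of_nonneg h0, Real.norm_of_nonneg (Real.exp_pos _).le]
  refine hasSum_le (fun i ↦ ?_) (hF t (by linarith))
    (((hF 1 one_pos).mul_left (Real.exp 1)).mul_right (Real.exp (-1 * t)))
  rw [← Real.exp_add, ← Real.exp_add]
  refine Real.exp_le_exp.2 ?_
  nlinarith [hq i]

variable {κ : ℝ}

lemma isBigO_inv_of_isBigO_sub (h0 : (fun t ↦ F t - κ / t) =O[𝓝[>] 0] fun _ : ℝ ↦ (1 : ℝ)) :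
    F =O[𝓝[>] 0] fun t : ℝ ↦ t ^ (-1 : ℝ) := by
  have h1 : (fun _ : ℝ ↦ (1 : ℝ)) =O[𝓝[>] 0] fun t : ℝ ↦ t ^ (-1 : ℝ) := by
    refine IsBigO.of_bound 1 ?_
    filter_upwards [Ioo_mem_nhdsGT one_pos] with t ht
    rw [one_mul, norm_one, Real.rpow_neg_one, norm_inv, Real.norm_of_nonneg ht.1.le]
    exact (one_le_inv₀ ht.1).2 ht.2.le
  have h2 : (fun t : ℝ ↦ κ / t) =O[𝓝[>] 0] fun t : ℝ ↦ t ^ (-1 : ℝ) := by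
    simp_rw [Real.rpow_neg_one, div_eq_mul_inv]
    exact isBigO_const_mul_self _ _ _
  refine ((h0.trans h1).add h2).congr_left fun t ↦ by ring

lemma summable_rpow_of_hasSum_exp (hq : ∀ i, 1 ≤ q i)
    (hF : ∀ t, 0 < t → HasSum (fun i ↦ Real.exp (-(t * q i))) (F t))
    (h0 : (fun t ↦ F t - κ / t) =O[𝓝[>] 0] fun _ : ℝ ↦ (1 : ℝ)) {σ : ℝ} (hσ : 1 < σ) :
    Summable fun i ↦ q i ^ (-σ) := by
  have hq0 : ∀ i, 0 < q i := fun i ↦ one_pos.trans_le (hq i)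
  have hcont := continuousOn_of_hasSum_exp (fun i ↦ (hq0 i).le) hF
  have hconv : MellinConvergent (fun t ↦ (F t : ℂ)) (σ : ℂ) := by
    refine mellinConvergent_of_isBigO_rpow_exp (a := 1) (b := 1) one_pos ?_ ?_ ?_ (by simpa)
    · exact (continuous_ofReal.comp_continuousOn hcont).locallyIntegrableOn measurableSet_Ioi
    · exact isBigO_ofReal_left.2 (isBigO_exp_of_hasSum_exp hq hF)
    · exact isBigO_ofReal_left.2 (isBigO_inv_of_isBigO_sub h0)
  have hint : MeasureTheory.IntegrableOn (fun t ↦ t ^ (σ - 1) * F t) (Ioi 0) := by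
    have h1 := MeasureTheory.Integrable.re hconv
    refine h1.congr ?_
    filter_upwards [MeasureTheory.ae_restrict_mem measurableSet_Ioi] with t ht
    have : (t : ℂ) ^ ((σ : ℂ) - 1) = ((t ^ (σ - 1) : ℝ) : ℂ) := by
      rw [ofReal_cpow (le_of_lt ht)]; push_cast; rfl
    simp only [smul_eq_mul, this, ← ofReal_mul]
    exact ofReal_re _
  refine summable_of_sum_le (c := (∫ t in Ioi (0 : ℝ), t ^ (σ - 1) * F t) / Real.Gamma σ)
    (fun i ↦ Real.rpow_nonneg (hq0 i).le _) fun T ↦ ?_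
  rw [le_div_iff₀ (Real.Gamma_pos_of_pos (by linarith))]
  have hi : ∀ i, MeasureTheory.IntegrableOn (fun t ↦ t ^ (σ - 1) * Real.exp (-(q i * t))) (Ioi 0) :=
    fun i ↦ by
      have := integrableOn_rpow_mul_exp_neg_mul_rpow (p := 1) (s := σ - 1) (b := q i)
        (by linarith) one_pos (hq0 i)
      simpa only [Real.rpow_one, neg_mul] using this
  have hval : ∀ i, ∫ t in Ioi (0 : ℝ), t ^ (σ - 1) * Real.exp (-(q i * t)) =
      q i ^ (-σ) * Real.Gamma σ := fun i ↦ by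
    rw [Real.integral_rpow_mul_exp_neg_mul_Ioi (by linarith) (hq0 i), one_div,
      Real.inv_rpow (hq0 i).le, Real.rpow_neg (hq0 i).le]
  rw [Finset.sum_mul, ← Finset.sum_congr rfl fun i _ ↦ hval i,
    ← MeasureTheory.integral_finsetSum _ fun i _ ↦ hi i]
  refine MeasureTheory.setIntegral_mono_on (MeasureTheory.integrable_finsetSum _ fun i _ ↦ hi i)
    hint measurableSet_Ioi fun t ht ↦ ?_
  have ht' : 0 < t := ht
  rw [← Finset.mul_sum]
  gcongr
  have := sum_le_hasSum T (fun i _ ↦ (Real.exp_pos _).le) (hF t ht')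
  simpa only [mul_comm t] using this

/-- If the theta series `∑ exp(-t q_i)` is `κ / t + O(1)` for `t → 0`, then the Dirichlet series
`∑ q_i^{-s}` is `κ / (s - 1)` up to a function holomorphic on `Re s > 0`, by Mellin transform. -/
theorem exists_continuation_of_theta [Countable ι] (hq : ∀ i, 1 ≤ q i)
    (hF : ∀ t, 0 < t → HasSum (fun i ↦ Real.exp (-(t * q i))) (F t))
    (h0 : (fun t ↦ F t - κ / t) =O[𝓝[>] 0] fun _ : ℝ ↦ (1 : ℝ)) :
    ∃ h : ℂ → ℂ, DifferentiableOn ℂ h {s | 0 < s.re} ∧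
      ∀ s : ℂ, 1 < s.re → HasSum (fun i ↦ (q i : ℂ) ^ (-s)) (κ / (s - 1) + h s) := by
  have hq0 : ∀ i, 0 < q i := fun i ↦ one_pos.trans_le (hq i)
  have hcont := continuousOn_of_hasSum_exp (fun i ↦ (hq0 i).le) hF
  have hFc : MeasureTheory.LocallyIntegrableOn (fun t ↦ (F t : ℂ)) (Ioi 0) :=
    (continuous_ofReal.comp_continuousOn hcont).locallyIntegrableOn measurableSet_Ioi
  -- the polar part `κ exp(-t) / t` has the same behaviour at `0` and decays
  set E : ℝ → ℝ := fun t ↦ F t - κ * (t⁻¹ * Real.exp (-t)) with hE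
  have hEc : ContinuousOn E (Ioi 0) := by
    refine hcont.sub (ContinuousOn.mul continuousOn_const (ContinuousOn.mul ?_ (by fun_prop)))
    exact continuousOn_inv₀.mono fun t ht ↦ (ne_of_gt ht)
  have hEtop : E =O[atTop] fun t ↦ Real.exp (-1 * t) := by
    refine (isBigO_exp_of_hasSum_exp hq hF).sub (IsBigO.const_mul_left ?_ _)
    refine IsBigO.of_bound 1 ?_
    filter_upwards [eventually_ge_atTop 1] with t ht
    rw [norm_mul, neg_one_mul]
    gcongr
    rw [norm_inv, Real.norm_of_nonneg (by linarith)]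
    exact inv_le_one_of_one_le₀ ht
  have hE0 : E =O[𝓝[>] 0] fun t : ℝ ↦ t ^ (-0 : ℝ) := by
    have h1 : (fun t : ℝ ↦ κ * (t⁻¹ * (1 - Real.exp (-t)))) =O[𝓝[>] 0] fun _ : ℝ ↦ (1 : ℝ) := by
      refine IsBigO.const_mul_left (IsBigO.of_bound 1 ?_) _
      filter_upwards [self_mem_nhdsWithin] with t ht
      have ht' : 0 < t := ht
      have h2 : 1 - Real.exp (-t) ≤ t := by linarith [Real.add_one_le_exp (-t)]
      have h3 : 0 ≤ 1 - Real.exp (-t) := by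
        have := Real.exp_le_one_iff.2 (show -t ≤ 0 by linarith)
        linarith
      rw [norm_one, norm_mul, norm_inv, Real.norm_of_nonneg ht'.le, Real.norm_of_nonneg h3,
        mul_one, inv_mul_le_iff₀ ht', mul_one]
      exact h2
    simp only [neg_zero, Real.rpow_zero]
    refine (h0.add h1).congr_left fun t ↦ ?_
    rw [hE]
    ring
  refine ⟨fun s ↦ mellin (fun t ↦ (E t : ℂ)) s * (Gamma s)⁻¹, ?_, ?_⟩
  · intro s hs
    refine DifferentiableAt.differentiableWithinAt (DifferentiableAt.mul ?_ ?_)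
    · exact mellin_differentiableAt_of_isBigO_rpow_exp (a := 1) (b := 0) one_pos
        ((continuous_ofReal.comp_continuousOn hEc).locallyIntegrableOn measurableSet_Ioi)
        (isBigO_ofReal_left.2 hEtop) (isBigO_ofReal_left.2 hE0) hs
    · exact (differentiable_one_div_Gamma s)
  · intro s hs
    have hs0 : 0 < s.re := by linarith
    have hG : Gamma s ≠ 0 := Gamma_ne_zero_of_re_pos hs0
    have hs1 : s - 1 ≠ 0 := by
      intro h
      rw [sub_eq_zero.1 h] at hs
      simp at hs
    have hFconv : MellinConvergent (fun t ↦ (F t : ℂ)) s :=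
      mellinConvergent_of_isBigO_rpow_exp (a := 1) (b := 1) one_pos hFc
        (isBigO_ofReal_left.2 (isBigO_exp_of_hasSum_exp hq hF))
        (isBigO_ofReal_left.2 (isBigO_inv_of_isBigO_sub h0)) hs
    have hsum := hasSum_mellin (a := fun _ : ι ↦ (1 : ℂ)) (p := q) (F := fun t ↦ (F t : ℂ)) (s := s)
      (fun i ↦ Or.inr (hq0 i)) hs0 (fun t ht ↦ by
        have := hasSum_ofReal.2 (hF t ht)
        simpa only [one_mul, neg_mul, mul_comm t] using! this) (by
        refine (summable_rpow_of_hasSum_exp hq hF h0 hs).congr fun i ↦ ?_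
        rw [norm_one, one_div, Real.rpow_neg (hq0 i).le])
    have hpol : HasMellin (fun t : ℝ ↦ (t : ℂ) ^ (-1 : ℂ) • ((Real.exp (-t) : ℝ) : ℂ)) s
        (Gamma (s - 1)) := by
      have hre : 0 < (s + -1).re := by simp; linarith
      refine ⟨MellinConvergent.cpow_smul.2 ?_, ?_⟩
      · have := GammaIntegral_convergent hre
        refine this.congr_fun (fun t _ ↦ ?_) measurableSet_Ioi
        rw [smul_eq_mul, mul_comm]
      · rw [mellin_cpow_smul, ← GammaIntegral_eq_mellin, ← Gamma_eq_integral hre, sub_eq_add_neg]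
    have hpolκ : MellinConvergent (fun t : ℝ ↦ (κ : ℂ) • ((t : ℂ) ^ (-1 : ℂ) •
        ((Real.exp (-t) : ℝ) : ℂ))) s := hpol.1.const_smul _
    have hdiff := hasMellin_sub hFconv hpolκ
    have hEeq : mellin (fun t ↦ (E t : ℂ)) s = mellin (fun t ↦ (F t : ℂ)) s - κ * Gamma (s - 1) := by
      have h1 : mellin (fun t : ℝ ↦ (κ : ℂ) • ((t : ℂ) ^ (-1 : ℂ) •
        ((Real.exp (-t) : ℝ) : ℂ))) s = κ * Gamma (s - 1) := by
        rw [mellin_const_smul, hpol.2, smul_eq_mul]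
      rw [← h1, ← hdiff.2]
      refine MeasureTheory.setIntegral_congr_fun measurableSet_Ioi fun t ht ↦ ?_
      simp only [hE, smul_eq_mul, cpow_neg_one]
      push_cast
      ring
    have hGs : Gamma s = (s - 1) * Gamma (s - 1) := by
      have := Gamma_add_one (s - 1) hs1
      rwa [sub_add_cancel] at this
    have hG1 : Gamma (s - 1) ≠ 0 := fun h ↦ hG (by rw [hGs, h, mul_zero])
    have hfin := hsum.mul_left (Gamma s)⁻¹
    convert! hfin using 1
    · funext i
      rw [cpow_neg]
      field_simp
    · simp only
      rw [hEeq, hGs]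
      field_simp
      ring

end Mellin

end

/-! ### Arithmetic of `ℚ(√-p)` -/

noncomputable section

namespace SupersingularOrders

variable (p : ℕ) [Fact p.Prime]

/-- The element `x + y√-p` of `O_K`. -/
def elt (x y : ℤ) : 𝓞 (QuadField p) := x + y * sqrtNeg p

lemma algebraMap_sqrtNeg : algebraMap (𝓞 (QuadField p)) (QuadField p) (sqrtNeg p) = ⟨0, 1⟩ := rfl

lemma algebraMap_elt (x y : ℤ) :
    algebraMap (𝓞 (QuadField p)) (QuadField p) (elt p x y) = ⟨x, y⟩ := by
  rw [elt, map_add, map_mul, map_intCast, map_intCast, algebraMap_sqrtNeg]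
  ext <;> simp

variable {p} in
lemma algebraMap_inj {a b : 𝓞 (QuadField p)} :
    algebraMap (𝓞 (QuadField p)) (QuadField p) a = algebraMap (𝓞 (QuadField p)) (QuadField p) b ↔
      a = b :=
  (FaithfulSMul.algebraMap_injective _ _).eq_iff

lemma sqrtNeg_mul_self : sqrtNeg p * sqrtNeg p = -(p : 𝓞 (QuadField p)) := by
  rw [← algebraMap_inj, map_mul, map_neg, map_natCast, algebraMap_sqrtNeg]
  ext <;> simp

lemma elt_mul (x y z w : ℤ) : elt p x y * elt p z w = elt p (x * z - p * y * w) (x * w + y * z) := by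
  simp only [elt]
  push_cast
  linear_combination (y * w : 𝓞 (QuadField p)) * sqrtNeg_mul_self p

lemma elt_add (x y z w : ℤ) : elt p x y + elt p z w = elt p (x + z) (y + w) := by
  simp only [elt]; push_cast; ring

lemma elt_neg (x y : ℤ) : -elt p x y = elt p (-x) (-y) := by
  simp only [elt]; push_cast; ring

lemma elt_intCast (n : ℤ) : (n : 𝓞 (QuadField p)) = elt p n 0 := by simp [elt]

lemma elt_natCast (n : ℕ) : (n : 𝓞 (QuadField p)) = elt p n 0 := by simp [elt]

variable {p} in
lemma elt_inj {x y z w : ℤ} : elt p x y = elt p z w ↔ x = z ∧ y = w := by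
  constructor
  · intro h
    have := congrArg (algebraMap (𝓞 (QuadField p)) (QuadField p)) h
    simp only [algebraMap_elt] at this
    have h1 := congrArg QuadraticAlgebra.re this
    have h2 := congrArg QuadraticAlgebra.im this
    simp only [Int.cast_inj] at h1 h2
    exact ⟨h1, h2⟩
  · rintro ⟨rfl, rfl⟩; rfl

lemma norm_eq (z : QuadField p) : Algebra.norm ℚ z = z.re ^ 2 + p * z.im ^ 2 := by
  have h := QuadraticAlgebra.det_toLinearMap_eq_norm z
  rw [QuadraticAlgebra.norm_def] at h
  rw [Algebra.norm_apply]
  convert! h using 1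
  simp
  ring

/-- One has `2 O_K ⊆ ℤ[√-p]`: trace and norm of `γ` are integral, so `p (2 im γ)²` is an integer,
and `p` is squarefree. -/
lemma two_mul_eq_elt (γ : 𝓞 (QuadField p)) : ∃ u v : ℤ, 2 * γ = elt p u v := by
  have hp : p.Prime := Fact.out
  set z : QuadField p := algebraMap (𝓞 (QuadField p)) (QuadField p) γ with hz
  have hint : IsIntegral ℤ z := NumberField.RingOfIntegers.isIntegral_coe γ
  have hstar : IsIntegral ℤ (star z) :=
    map_isIntegral_int (starRingEnd (QuadField p)) hint
  have hrat : ∀ r : ℚ, IsIntegral ℤ (⟨r, 0⟩ : QuadField p) → ∃ n : ℤ, (n : ℚ) = r := by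
    intro r hr
    have : IsIntegral ℤ r := by
      have h2 : (⟨r, 0⟩ : QuadField p) = algebraMap ℚ (QuadField p) r := by
        rw [eq_ratCast]
        rfl
      rw [h2] at hr
      exact (isIntegral_algebraMap_iff (algebraMap ℚ (QuadField p)).injective).1 hr
    obtain ⟨n, hn⟩ := IsIntegrallyClosed.isIntegral_iff.1 this
    exact ⟨n, by simpa using hn⟩
  obtain ⟨u, hu⟩ := hrat (2 * z.re) (by
    have h : (⟨2 * z.re, 0⟩ : QuadField p) = z + star z :=
      QuadraticAlgebra.ext (by simp; ring) (by simp)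
    rw [h]
    exact hint.add hstar)
  obtain ⟨n, hn⟩ := hrat (z.re ^ 2 + p * z.im ^ 2) (by
    have h : (⟨z.re ^ 2 + p * z.im ^ 2, 0⟩ : QuadField p) = z * star z :=
      QuadraticAlgebra.ext (by simp; ring) (by simp; ring)
    rw [h]
    exact hint.mul hstar)
  -- `p (2 z.im)²` is an integer, and `p` is prime, so `2 z.im` is one
  have hm : ((4 * n - u ^ 2 : ℤ) : ℚ) = p * (2 * z.im) ^ 2 := by
    push_cast
    rw [hu, hn]
    ring
  obtain ⟨v, hv⟩ : ∃ v : ℤ, (v : ℚ) = 2 * z.im := by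
    set w : ℚ := 2 * z.im with hw
    have hsq : ((p * (4 * n - u ^ 2) : ℤ) : ℚ) = (p * w) ^ 2 := by
      rw [Int.cast_mul, hm]; push_cast; ring
    have hpw : IsIntegral ℤ ((p : ℚ) * w) := by
      refine IsIntegral.of_pow (n := 2) two_pos ?_
      rw [← hsq]
      exact isIntegral_intCast _
    obtain ⟨m, hm2⟩ := IsIntegrallyClosed.isIntegral_iff.1 hpw
    rw [eq_intCast] at hm2
    have hdvd : (p : ℤ) ∣ m ^ 2 := by
      refine ⟨4 * n - u ^ 2, ?_⟩
      have : ((m ^ 2 : ℤ) : ℚ) = ((p * (4 * n - u ^ 2) : ℤ) : ℚ) := by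
        rw [hsq]; push_cast; rw [hm2]
      exact_mod_cast this
    obtain ⟨v, rfl⟩ := (Nat.prime_iff_prime_int.1 hp).dvd_of_dvd_pow hdvd
    refine ⟨v, ?_⟩
    have hp0 : (p : ℚ) ≠ 0 := by exact_mod_cast hp.ne_zero
    push_cast at hm2
    exact mul_left_cancel₀ hp0 hm2
  refine ⟨u, v, ?_⟩
  rw [← algebraMap_inj, algebraMap_elt, two_mul, map_add, ← hz]
  exact QuadraticAlgebra.ext (by simp [hu, two_mul]) (by simp [hv, two_mul])

lemma absNorm_span_elt (x y : ℤ) :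
    (Ideal.absNorm (Ideal.span {elt p x y}) : ℤ) = x ^ 2 + p * y ^ 2 := by
  rw [Ideal.absNorm_span_singleton]
  have h : Algebra.norm ℤ (elt p x y) = x ^ 2 + p * y ^ 2 := by
    have : ((Algebra.norm ℤ (elt p x y) : ℤ) : ℚ) =
        Algebra.norm ℚ (algebraMap (𝓞 (QuadField p)) (QuadField p) (elt p x y)) :=
      Algebra.coe_norm_int (elt p x y)
    rw [algebraMap_elt, norm_eq] at this
    simp only at this
    exact_mod_cast this
  rw [h, Int.natCast_natAbs, abs_of_nonneg (by positivity)]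

end SupersingularOrders

end

/-! ### The ring class group -/

noncomputable section

namespace SupersingularOrders

variable (p : ℕ) [Fact p.Prime]

/-- The multiplicative set of the elements `x + 8y√-p` of `O_K` with `x` odd. -/
def rayElements : Submonoid (𝓞 (QuadField p)) where
  carrier := {γ | ∃ x y : ℤ, Odd x ∧ γ = elt p x (8 * y)}
  one_mem' := ⟨1, 0, odd_one, by simp [elt]⟩
  mul_mem' := by
    rintro _ _ ⟨x, y, hx, rfl⟩ ⟨z, w, hz, rfl⟩
    refine ⟨x * z - p * (8 * y) * (8 * w), x * w + y * z, ?_, ?_⟩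
    · exact (hx.mul hz).sub_even ⟨p * y * w * 32, by ring⟩
    · rw [elt_mul]; congr 1; ring

variable {p}

lemma intCast_mem_rayElements {n : ℤ} (hn : Odd n) : (n : 𝓞 (QuadField p)) ∈ rayElements p :=
  ⟨n, 0, hn, by rw [elt_intCast]; simp⟩

lemma natCast_mem_rayElements {n : ℕ} (hn : Odd n) : (n : 𝓞 (QuadField p)) ∈ rayElements p := by
  have := intCast_mem_rayElements (p := p) (n := n) (by exact_mod_cast hn)
  exact_mod_cast this

lemma ne_zero_of_mem_rayElements {γ : 𝓞 (QuadField p)} (h : γ ∈ rayElements p) : γ ≠ 0 := by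
  obtain ⟨x, y, hx, rfl⟩ := h
  intro h0
  have h0 : elt p x (8 * y) = elt p 0 0 := by rw [h0]; simp [elt]
  have := (elt_inj.1 h0).1
  subst this
  exact absurd hx (by decide)

/-- Elements of the multiplicative set have a multiple which is an odd integer. -/
lemma exists_mul_eq_odd {γ : 𝓞 (QuadField p)} (h : γ ∈ rayElements p) :
    ∃ γ' ∈ rayElements p, ∃ n : ℤ, Odd n ∧ γ' * γ = n := by
  obtain ⟨x, y, hx, rfl⟩ := h
  refine ⟨elt p x (8 * -y), ⟨x, -y, hx, rfl⟩, x * x - p * (8 * -y) * (8 * y), ?_, ?_⟩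
  · exact (hx.mul hx).sub_even ⟨-(p * y * y * 32), by ring⟩
  · rw [elt_mul, elt_intCast]; congr 1; ring

lemma odd_absNorm_of_mem_rayElements {γ : 𝓞 (QuadField p)} (h : γ ∈ rayElements p) :
    Odd (Ideal.absNorm (Ideal.span {γ})) := by
  obtain ⟨x, y, hx, rfl⟩ := h
  have h1 := absNorm_span_elt p x (8 * y)
  have h2 : Odd (Ideal.absNorm (Ideal.span {elt p x (8 * y)}) : ℤ) := by
    rw [h1]
    exact hx.pow.add_even ⟨p * y ^ 2 * 32, by ring⟩
  exact_mod_cast h2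

lemma absNorm_mod_eight_of_mem_rayElements {γ : 𝓞 (QuadField p)} (h : γ ∈ rayElements p) :
    Ideal.absNorm (Ideal.span {γ}) % 8 = 1 := by
  obtain ⟨x, y, hx, rfl⟩ := h
  have h1 := absNorm_span_elt p x (8 * y)
  have h2 : x ^ 2 % 8 = 1 := by
    obtain ⟨k, rfl⟩ := hx
    obtain ⟨m, hm⟩ := Int.even_mul_succ_self k
    have : (2 * k + 1) ^ 2 = 8 * m + 1 := by linear_combination 4 * hm
    omega
  have h3 : (p : ℤ) * (8 * y) ^ 2 = 8 * (8 * p * y ^ 2) := by ring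
  omega

/-- A principal ideal with a generator in the fraction field of the multiplicative set has a
generator in the multiplicative set. -/
lemma exists_generator_mem_rayElements {u v : 𝓞 (QuadField p)} (hu : u ∈ rayElements p)
    (hv : v ∈ rayElements p) {C : Ideal (𝓞 (QuadField p))}
    (h : Ideal.span {u} * C = Ideal.span {v}) :
    ∃ γ ∈ rayElements p, C = Ideal.span {γ} := by
  obtain ⟨γ, hγ⟩ : u ∣ v := by
    rw [← Ideal.span_singleton_le_span_singleton, ← h]
    exact Ideal.mul_le_left
  have hC : C = Ideal.span {γ} := by
    rw [hγ, ← Ideal.span_singleton_mul_span_singleton] at h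
    refine mul_left_cancel₀ ?_ h
    simpa using ne_zero_of_mem_rayElements hu
  refine ⟨γ, ?_, hC⟩
  obtain ⟨u', hu', n, hn, hun⟩ := exists_mul_eq_odd hu
  obtain ⟨a, b, ha, hab⟩ := mul_mem hu' hv
  obtain ⟨c, d, hcd⟩ := two_mul_eq_elt p γ
  have h1 : elt p (n * c) (n * d) = elt p (2 * a) (2 * (8 * b)) := by
    have e1 : elt p (n * c) (n * d) = n * elt p c d := by simp only [elt]; push_cast; ring
    have e2 : elt p (2 * a) (2 * (8 * b)) = 2 * elt p a (8 * b) := by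
      simp only [elt]; push_cast; ring
    rw [e1, e2, ← hab, ← hcd, ← hun, hγ]
    ring
  obtain ⟨h2, h3⟩ := elt_inj.1 h1
  have hcop : IsCoprime (16 : ℤ) n := by
    have : IsCoprime (2 : ℤ) n := by
      obtain ⟨k, rfl⟩ := hn
      exact ⟨-k, 1, by ring⟩
    exact this.pow_left (m := 4)
  obtain ⟨c', rfl⟩ : (2 : ℤ) ∣ c :=
    (hcop.of_isCoprime_of_dvd_left ⟨8, by norm_num⟩).dvd_of_dvd_mul_left ⟨a, h2⟩
  obtain ⟨d', rfl⟩ : (16 : ℤ) ∣ d := hcop.dvd_of_dvd_mul_left ⟨b, by rw [h3]; ring⟩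
  refine ⟨c', d', ?_, ?_⟩
  · have : a = n * c' := by linarith
    rw [this] at ha
    exact (Int.odd_mul.1 ha).2
  · have : (2 : 𝓞 (QuadField p)) * γ = 2 * elt p c' (8 * d') := by
      rw [hcd]; simp only [elt]; push_cast; ring
    exact mul_left_cancel₀ two_ne_zero this

variable (p)

/-- The monoid of the ideals of `O_K` of odd norm. -/
def oddIdeals : Submonoid (Ideal (𝓞 (QuadField p))) where
  carrier := {A | Odd (Ideal.absNorm A)}
  one_mem' := by simp
  mul_mem' {A B} hA hB := by
    simp only [Set.mem_ofPred_eq, map_mul] at *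
    exact hA.mul hB

/-- Two ideals of odd norm are congruent if they differ by a quotient of two elements of
`rayElements p`. -/
def rayCon : Con (oddIdeals p) where
  r A B := ∃ u ∈ rayElements p, ∃ v ∈ rayElements p,
    Ideal.span {u} * (A : Ideal (𝓞 (QuadField p))) = Ideal.span {v} * B
  iseqv :=
    { refl := fun A ↦ ⟨1, one_mem _, 1, one_mem _, rfl⟩
      symm := fun ⟨u, hu, v, hv, h⟩ ↦ ⟨v, hv, u, hu, h.symm⟩
      trans := by
        rintro A B C ⟨u, hu, v, hv, h⟩ ⟨u', hu', v', hv', h'⟩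
        refine ⟨u' * u, mul_mem hu' hu, v * v', mul_mem hv hv', ?_⟩
        rw [← Ideal.span_singleton_mul_span_singleton, ← Ideal.span_singleton_mul_span_singleton,
          mul_assoc, h, mul_left_comm, h', mul_assoc] }
  mul' := by
    rintro A B C D ⟨u, hu, v, hv, h⟩ ⟨u', hu', v', hv', h'⟩
    refine ⟨u * u', mul_mem hu hu', v * v', mul_mem hv hv', ?_⟩
    simp only [← Ideal.span_singleton_mul_span_singleton, Submonoid.coe_mul]
    rw [mul_mul_mul_comm, h, h', mul_mul_mul_comm]

/-- The ring class group of the order `ℤ[8√-p]`: ideals of odd norm modulo `rayElements p`. -/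
abbrev RingClassGroup : Type := (rayCon p).Quotient

variable {p}

lemma exists_mul_eq_natCast (A : oddIdeals p) : ∃ B : oddIdeals p,
    (A : Ideal (𝓞 (QuadField p))) * B = Ideal.span {(Ideal.absNorm A.1 : 𝓞 (QuadField p))} := by
  obtain ⟨B, hB⟩ : A.1 ∣ Ideal.span {(Ideal.absNorm A.1 : 𝓞 (QuadField p))} := by
    rw [Ideal.dvd_span_singleton]
    exact Ideal.absNorm_mem A.1
  have hodd : Odd (Ideal.absNorm (A.1 * B)) := by
    rw [← hB]
    exact odd_absNorm_of_mem_rayElements (natCast_mem_rayElements A.2)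
  rw [map_mul] at hodd
  exact ⟨⟨B, (Nat.odd_mul.1 hodd).2⟩, hB.symm⟩

instance : CommGroup (RingClassGroup p) :=
  commGroupOfIsUnit (by
    intro x
    induction x using Con.induction_on with
    | H A =>
      obtain ⟨B, hB⟩ := exists_mul_eq_natCast A
      refine IsUnit.of_mul_eq_one (B : RingClassGroup p) ?_
      rw [← Con.coe_mul, ← Con.coe_one, Con.eq]
      refine ⟨1, one_mem _, _, natCast_mem_rayElements A.2, ?_⟩
      simpa using hB)

/-- The class of an ideal of odd norm is determined by its ideal class and by the residue modulo
`16` of a generator of its product with a fixed ideal of the inverse class. -/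
instance : Finite (RingClassGroup p) := by
  classical
  have hnz (A : oddIdeals p) : A.1 ∈ (Ideal (𝓞 (QuadField p)))⁰ := by
    rw [mem_nonZeroDivisors_iff_ne_zero]
    intro h
    have := A.2
    simp [oddIdeals, h] at this
  have hJ : ∀ k : ClassGroup (𝓞 (QuadField p)), ∃ J : oddIdeals p, ∀ A : oddIdeals p,
      ClassGroup.mk0 ⟨A.1, hnz A⟩ = k → ∃ α, A.1 * J.1 = Ideal.span {α} := by
    intro k
    by_cases hk : ∃ A₀ : oddIdeals p, ClassGroup.mk0 ⟨A₀.1, hnz A₀⟩ = k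
    · obtain ⟨A₀, rfl⟩ := hk
      obtain ⟨J, hJ⟩ := exists_mul_eq_natCast A₀
      refine ⟨J, fun A hA ↦ ?_⟩
      have h0 : ClassGroup.mk0 ⟨A₀.1, hnz A₀⟩ * ClassGroup.mk0 ⟨J.1, hnz J⟩ = 1 := by
        rw [← map_mul, ClassGroup.mk0_eq_one_iff]
        exact ⟨_, hJ⟩
      rw [← hA, ← map_mul, ClassGroup.mk0_eq_one_iff] at h0
      exact h0.principal
    · exact ⟨1, fun A hA ↦ (hk ⟨A, hA⟩).elim⟩
  choose J hJ using hJ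
  choose α hα using fun A : oddIdeals p ↦ hJ _ A rfl
  have : Finite (𝓞 (QuadField p) ⧸ Ideal.span {(16 : 𝓞 (QuadField p))}) :=
    Ideal.finiteQuotientOfFreeOfNeBot _ (by simp)
  let f : oddIdeals p → ClassGroup (𝓞 (QuadField p)) ×
      (𝓞 (QuadField p) ⧸ Ideal.span {(16 : 𝓞 (QuadField p))}) :=
    fun A ↦ (ClassGroup.mk0 ⟨A.1, hnz A⟩, Ideal.Quotient.mk _ (α A))
  have hf : ∀ A B, f A = f B → (A : RingClassGroup p) = B := by
    intro A B h
    obtain ⟨h1, h2⟩ := Prod.ext_iff.1 h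
    simp only [f] at h1 h2
    rw [Ideal.Quotient.eq, Ideal.mem_span_singleton] at h2
    obtain ⟨θ, hθ⟩ := h2
    have hA := hα A
    have hB := hα B
    rw [← h1] at hB
    set I := J (ClassGroup.mk0 ⟨A.1, hnz A⟩)
    have hodd : Odd (Ideal.absNorm (Ideal.span {α B})) := by
      rw [← hB, map_mul]
      exact B.2.mul I.2
    obtain ⟨β, hβ⟩ := Ideal.mem_span_singleton.1 (Ideal.absNorm_mem (Ideal.span {α B}))
    set n := Ideal.absNorm (Ideal.span {α B})
    have hAB : Ideal.span {α B} * A.1 = Ideal.span {α A} * B.1 := by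
      refine mul_right_cancel₀ (nonZeroDivisors.ne_zero (hnz I)) ?_
      rw [mul_assoc, hA, mul_assoc, hB, mul_comm]
    rw [Con.eq]
    refine ⟨n, natCast_mem_rayElements hodd, β * α A, ?_, ?_⟩
    · obtain ⟨c, d, hcd⟩ := two_mul_eq_elt p (θ * β)
      refine ⟨n + 8 * c, d, ?_, ?_⟩
      · exact (show Odd (n : ℤ) by exact_mod_cast hodd).add_even ⟨4 * c, by ring⟩
      · have h3 : β * α A = n + 8 * (2 * (θ * β)) := by rw [hβ]; linear_combination β * hθ
        rw [h3, hcd]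
        simp only [elt]; push_cast; ring
    · rw [hβ, mul_comm (α B), ← Ideal.span_singleton_mul_span_singleton,
        ← Ideal.span_singleton_mul_span_singleton, mul_assoc, hAB, mul_assoc]
  refine Finite.of_injective (fun g : RingClassGroup p ↦ f (Quotient.out g)) ?_
  intro g g' h
  have := hf _ _ h
  have hout (g : RingClassGroup p) : ((Quotient.out g : oddIdeals p) : RingClassGroup p) = g :=
    Quotient.out_eq g
  rwa [hout, hout] at this

/-- The class of an ideal of `O_K` in the ring class group, with value zero on ideals of even
norm. -/
def rayClass : Ideal (𝓞 (QuadField p)) →*₀ WithZero (RingClassGroup p) where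
  toFun A := open Classical in
    if h : A ∈ oddIdeals p then (((⟨A, h⟩ : oddIdeals p) : RingClassGroup p) : WithZero _) else 0
  map_zero' := by
    rw [dif_neg]
    simp [oddIdeals]
  map_one' := by
    rw [dif_pos (one_mem _)]
    rfl
  map_mul' A B := by
    by_cases hA : A ∈ oddIdeals p
    · by_cases hB : B ∈ oddIdeals p
      · rw [dif_pos hA, dif_pos hB, dif_pos (mul_mem hA hB), ← WithZero.coe_mul]
        rfl
      · rw [dif_neg hB, dif_neg, mul_zero]
        intro h
        simp only [oddIdeals, Submonoid.mem_mk, Subsemigroup.mem_mk, Set.mem_ofPred_eq,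
          map_mul] at h hB
        exact hB (Nat.odd_mul.1 h).2
    · rw [dif_neg hA, dif_neg, zero_mul]
      intro h
      simp only [oddIdeals, Submonoid.mem_mk, Subsemigroup.mem_mk, Set.mem_ofPred_eq,
        map_mul] at h hA
      exact hA (Nat.odd_mul.1 h).1

lemma rayClass_of_mem {A : Ideal (𝓞 (QuadField p))} (h : A ∈ oddIdeals p) :
    rayClass A = (((⟨A, h⟩ : oddIdeals p) : RingClassGroup p) : WithZero (RingClassGroup p)) :=
  dif_pos h

lemma rayClass_of_notMem {A : Ideal (𝓞 (QuadField p))} (h : A ∉ oddIdeals p) : rayClass A = 0 :=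
  dif_neg h

lemma mem_oddIdeals_of_rayClass_eq {A : Ideal (𝓞 (QuadField p))} {g : RingClassGroup p}
    (h : rayClass A = g) : A ∈ oddIdeals p := by
  by_contra hA
  rw [rayClass_of_notMem hA] at h
  exact WithZero.zero_ne_coe h

/-- Ideals in a class `g` are the complements in principal ideals, generated by elements of
`rayElements p`, of a fixed ideal in the class `g⁻¹`. -/
lemma rayClass_eq_iff {A : Ideal (𝓞 (QuadField p))} {B : oddIdeals p} :
    rayClass A = ((B : RingClassGroup p)⁻¹ : RingClassGroup p) ↔
      ∃ γ ∈ rayElements p, A * B.1 = Ideal.span {γ} := by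
  constructor
  · intro h
    have hA := mem_oddIdeals_of_rayClass_eq h
    rw [rayClass_of_mem hA, WithZero.coe_inj, eq_inv_iff_mul_eq_one, ← Con.coe_mul,
      ← Con.coe_one, Con.eq] at h
    obtain ⟨u, hu, v, hv, h⟩ := h
    exact exists_generator_mem_rayElements hu hv (by simpa using h)
  · rintro ⟨γ, hγ, h⟩
    have hA : A ∈ oddIdeals p := by
      have h1 := odd_absNorm_of_mem_rayElements hγ
      rw [← h, map_mul] at h1
      exact (Nat.odd_mul.1 h1).1
    rw [rayClass_of_mem hA, WithZero.coe_inj, eq_inv_iff_mul_eq_one, ← Con.coe_mul,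
      ← Con.coe_one, Con.eq]
    exact ⟨1, one_mem _, γ, hγ, by simpa using h⟩

end SupersingularOrders

end

/-! ### Partial zeta functions of ring classes -/

noncomputable section

namespace SupersingularOrders

section

open Filter Topology Asymptotics

variable {p : ℕ} [Fact p.Prime]

/-- Reduction of the elements `x + 8y√-p` modulo an ideal `B`, together with the parity of `x`. -/
def rayReduction (B : Ideal (𝓞 (QuadField p))) :
    ℤ × ℤ →+ (𝓞 (QuadField p) ⧸ B) × ZMod 2 where
  toFun w := (Ideal.Quotient.mk B (elt p w.1 (8 * w.2)), (w.1 : ZMod 2))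
  map_zero' := by simp [elt]
  map_add' w z := by
    rw [Prod.fst_add, Prod.snd_add, mul_add, Int.cast_add, ← elt_add, map_add, Prod.mk_add_mk]

lemma rayReduction_surjective (B : oddIdeals p) : Function.Surjective (rayReduction B.1) := by
  rintro ⟨γ, b⟩
  obtain ⟨γ, rfl⟩ := Ideal.Quotient.mk_surjective γ
  obtain ⟨u, v, huv⟩ := two_mul_eq_elt p γ
  obtain ⟨k, hk⟩ : Odd (Ideal.absNorm B.1) := B.2
  have hn : ((2 * k + 1 : ℕ) : 𝓞 (QuadField p)) ∈ B.1 := hk ▸ Ideal.absNorm_mem B.1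
  -- `2(k + 1)` is congruent to `1`, and `16(k + 1)⁴γ` has the required shape
  have key (e : ℤ) : Ideal.Quotient.mk B.1
      (elt p (8 * (k + 1) ^ 4 * u + (2 * k + 1) * e) (8 * ((k + 1) ^ 4 * v))) =
      Ideal.Quotient.mk B.1 γ := by
    rw [Ideal.Quotient.eq]
    have h1 : elt p (8 * (k + 1) ^ 4 * u + (2 * k + 1) * e) (8 * ((k + 1) ^ 4 * v)) - γ =
        ((2 * k + 1 : ℕ) : 𝓞 (QuadField p)) *
          (e + γ * ((2 * k + 2) ^ 3 + (2 * k + 2) ^ 2 + (2 * k + 2) + 1)) := by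
      have h2 : elt p (8 * (k + 1) ^ 4 * u + (2 * k + 1) * e) (8 * ((k + 1) ^ 4 * v)) =
          8 * (k + 1) ^ 4 * elt p u v + (2 * k + 1) * e := by
        simp only [elt]; push_cast; ring
      rw [h2, ← huv]; push_cast; ring
    rw [h1]
    exact B.1.mul_mem_right _ hn
  refine ⟨(8 * (k + 1) ^ 4 * u + (2 * k + 1) * b.val, (k + 1) ^ 4 * v), ?_⟩
  refine Prod.ext (key b.val) ?_
  change ((8 * (k + 1) ^ 4 * u + (2 * k + 1) * b.val : ℤ) : ZMod 2) = b
  have h2 : (2 : ZMod 2) = 0 := rfl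
  have h8 : (8 : ZMod 2) = 0 := rfl
  push_cast
  rw [h2, h8]
  simp

lemma rayReduction_eq_iff {B : Ideal (𝓞 (QuadField p))} {w : ℤ × ℤ} :
    rayReduction B w = (0, 1) ↔ elt p w.1 (8 * w.2) ∈ B ∧ Odd w.1 := by
  change (Ideal.Quotient.mk B (elt p w.1 (8 * w.2)), (w.1 : ZMod 2)) = (0, 1) ↔ _
  rw [Prod.mk.injEq, Ideal.Quotient.eq_zero_iff_mem, ZMod.intCast_eq_one_iff_odd]

/-- For `p > 3` the only units in `ℤ[√-p]` are `±1`. -/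
lemma eq_or_eq_neg_of_span_elt_eq (hp : 3 < p) {x y z w : ℤ}
    (h : Ideal.span {elt p x y} = Ideal.span {elt p z w}) (h0 : elt p x y ≠ 0) :
    (x = z ∧ y = w) ∨ (x = -z ∧ y = -w) := by
  obtain ⟨γ, hγ⟩ := Ideal.span_singleton_eq_span_singleton.1 h
  obtain ⟨c, d, hcd⟩ := two_mul_eq_elt p γ
  have hnorm : c ^ 2 + p * d ^ 2 = 4 := by
    have h1 := absNorm_span_elt p c d
    rw [← hcd, ← Ideal.span_singleton_mul_span_singleton,
      Ideal.span_singleton_eq_top.2 γ.isUnit, Ideal.mul_top] at h1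
    have h2 := absNorm_span_elt p 2 0
    have h3 : elt p 2 0 = 2 := by simp [elt]
    rw [h3] at h2
    rw [← h1, h2]
    ring
  have hd : d = 0 := by
    by_contra hd
    have : 0 < d ^ 2 := by positivity
    have hp' : (4 : ℤ) ≤ p := by exact_mod_cast hp
    have hp4 : p ≠ 4 := by
      rintro rfl
      exact absurd (Fact.out : Nat.Prime 4) (by decide)
    have hp5 : (5 : ℤ) ≤ p := by
      have : 5 ≤ p := by omega
      exact_mod_cast this
    nlinarith [sq_nonneg c]
  subst hd
  have hc : (c - 2) * (c + 2) = 0 := by linarith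
  have h2 : (2 : 𝓞 (QuadField p)) * elt p z w = elt p (c * x) (c * y) := by
    rw [← hγ, mul_left_comm, hcd]
    simp only [elt]; push_cast; ring
  have h3 : elt p (2 * z) (2 * w) = elt p (c * x) (c * y) := by
    rw [← h2]; simp only [elt]; push_cast; ring
  obtain ⟨h4, h5⟩ := elt_inj.1 h3
  rcases mul_eq_zero.1 hc with hc | hc
  · left
    have : c = 2 := by linarith
    subst this
    constructor <;> linarith
  · right
    have : c = -2 := by linarith
    subst this
    constructor <;> linarith

lemma absNorm_pos {A : Ideal (𝓞 (QuadField p))} (hA : A ≠ 0) : 0 < Ideal.absNorm A :=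
  Nat.pos_of_ne_zero (by rwa [Ne, Ideal.absNorm_eq_zero_iff])

instance : Countable (Ideal (𝓞 (QuadField p))) := by
  rw [← Set.countable_univ_iff]
  have : (Set.univ : Set (Ideal (𝓞 (QuadField p)))) =
      ⋃ n : ℕ, {I | Ideal.absNorm I = n} := by
    ext; simp
  rw [this]
  refine Set.countable_iUnion fun n ↦ ?_
  rcases Nat.eq_zero_or_pos n with rfl | hn
  · refine (Set.countable_singleton (⊥ : Ideal (𝓞 (QuadField p)))).mono fun I hI ↦ ?_
    exact Ideal.absNorm_eq_zero_iff.1 hI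
  · exact (Ideal.finite_setOfPred_absNorm_eq n).countable

/-- The theta series of a class: its ideals are the pairs `±w` of solutions of `rayReduction B w =
(0, 1)`, for any `B` in the inverse class. -/
lemma hasSum_theta_class (hp : 3 < p) (B : oddIdeals p) {f : ℝ → ℝ} {t : ℝ}
    (hf : HasSum (fun w : ℤ × ℤ ↦ open Classical in if rayReduction B.1 w = (0, 1) then
      Real.exp (-(t / Ideal.absNorm B.1 * (w.1 ^ 2 + (64 * p : ℝ) * w.2 ^ 2))) else 0)
      (f (t / Ideal.absNorm B.1))) :
    HasSum (fun A : {A : Ideal (𝓞 (QuadField p)) //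
        rayClass A = ((B : RingClassGroup p)⁻¹ : RingClassGroup p)} ↦
      Real.exp (-(t * (Ideal.absNorm A.1 : ℝ)))) (f (t / Ideal.absNorm B.1) / 2) := by
  set ι := {A : Ideal (𝓞 (QuadField p)) //
        rayClass A = ((B : RingClassGroup p)⁻¹ : RingClassGroup p)}
  have hB0 : B.1 ≠ 0 := by
    intro h
    have := B.2
    simp [oddIdeals, h] at this
  have hx : ∀ A : ι, ∃ w : ℤ × ℤ, Odd w.1 ∧ A.1 * B.1 = Ideal.span {elt p w.1 (8 * w.2)} := by
    intro A
    obtain ⟨γ, ⟨x, y, hx, rfl⟩, h⟩ := rayClass_eq_iff.1 A.2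
    exact ⟨(x, y), hx, h⟩
  choose w hodd hw using hx
  let g : ι × ℤˣ → ℤ × ℤ := fun a ↦ (a.2 : ℤ) • w a.1
  have hspan (a : ι × ℤˣ) : Ideal.span {elt p (g a).1 (8 * (g a).2)} = a.1.1 * B.1 := by
    rw [hw]
    obtain ⟨A, e⟩ := a
    rcases Int.units_eq_one_or e with rfl | rfl
    · simp [g]
    · have : elt p (g (A, -1)).1 (8 * (g (A, -1)).2) = -elt p (w A).1 (8 * (w A).2) := by
        rw [elt_neg]; simp [g]
      rw [this, Ideal.span_singleton_neg]
  have hgodd (a : ι × ℤˣ) : Odd (g a).1 := by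
    obtain ⟨A, e⟩ := a
    rcases Int.units_eq_one_or e with rfl | rfl
    · simpa [g] using hodd A
    · simpa [g] using hodd A
  have hginj : Function.Injective g := by
    rintro ⟨A, e⟩ ⟨A', e'⟩ h
    have h1 : A = A' := by
      refine Subtype.ext (mul_right_cancel₀ hB0 ?_)
      have h2 := hspan (A, e)
      rw [h, hspan] at h2
      exact h2.symm
    subst h1
    simp only [Prod.mk.injEq, true_and]
    have h2 : (e : ℤ) * (w A).1 = e' * (w A).1 := by
      have := congrArg Prod.fst h
      simpa [g] using this
    have h3 : (w A).1 ≠ 0 := by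
      intro h0
      have := hodd A
      rw [h0] at this
      exact absurd this (by decide)
    exact Units.ext (mul_right_cancel₀ h3 h2)
  have hcomp := (hginj.hasSum_iff (f := fun w : ℤ × ℤ ↦ open Classical in
      if rayReduction B.1 w = (0, 1) then
      Real.exp (-(t / Ideal.absNorm B.1 * (w.1 ^ 2 + (64 * p : ℝ) * w.2 ^ 2))) else 0) (by
    intro z hz
    rw [if_neg]
    intro h
    apply hz
    obtain ⟨h1, h2⟩ := rayReduction_eq_iff.1 h
    obtain ⟨A, hA⟩ : B.1 ∣ Ideal.span {elt p z.1 (8 * z.2)} := Ideal.dvd_span_singleton.2 h1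
    have hA' : rayClass A = ((B : RingClassGroup p)⁻¹ : RingClassGroup p) :=
      rayClass_eq_iff.2 ⟨_, ⟨_, _, h2, rfl⟩, by rw [hA, mul_comm]⟩
    have h3 := hw ⟨A, hA'⟩
    simp only at h3
    rw [mul_comm, ← hA] at h3
    rcases eq_or_eq_neg_of_span_elt_eq hp h3 (ne_zero_of_mem_rayElements ⟨_, _, h2, rfl⟩) with
      ⟨h4, h5⟩ | ⟨h4, h5⟩
    · refine ⟨(⟨A, hA'⟩, 1), Prod.ext ?_ ?_⟩
      · simp [g, h4]
      · simpa [g] using (mul_left_cancel₀ (by norm_num) h5).symm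
    · refine ⟨(⟨A, hA'⟩, -1), Prod.ext ?_ ?_⟩
      · simp [g, h4]
      · simpa [g] using (mul_left_cancel₀ (by norm_num) (h5.trans (mul_neg _ _).symm)).symm)).2 hf
  have hterm : ∀ a : ι × ℤˣ, ((fun w : ℤ × ℤ ↦ open Classical in
      if rayReduction B.1 w = (0, 1) then
      Real.exp (-(t / Ideal.absNorm B.1 * (w.1 ^ 2 + (64 * p : ℝ) * w.2 ^ 2))) else 0) ∘ g) a =
      Real.exp (-(t * (Ideal.absNorm a.1.1 : ℝ))) := by
    intro a
    have hmem : elt p (g a).1 (8 * (g a).2) ∈ B.1 := by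
      rw [← Ideal.span_singleton_le_iff_mem, hspan]
      exact Ideal.mul_le_right
    simp only [Function.comp_apply]
    rw [if_pos (rayReduction_eq_iff.2 ⟨hmem, hgodd a⟩)]
    have h1 := absNorm_span_elt p (g a).1 (8 * (g a).2)
    rw [hspan, map_mul] at h1
    have h2 : (Ideal.absNorm a.1.1 : ℝ) * Ideal.absNorm B.1 =
        (g a).1 ^ 2 + (64 * p : ℝ) * (g a).2 ^ 2 := by
      have h3 : (((Ideal.absNorm a.1.1 * Ideal.absNorm B.1 : ℕ) : ℤ) : ℝ) =
        (((g a).1 ^ 2 + p * (8 * (g a).2) ^ 2 : ℤ) : ℝ) := by rw [h1]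
      push_cast at h3
      rw [h3]; ring
    have hB : (Ideal.absNorm B.1 : ℝ) ≠ 0 := by exact_mod_cast (absNorm_pos hB0).ne'
    rw [← h2]
    congr 2
    field_simp
  rw [funext hterm] at hcomp
  have hfib := hcomp.prod_fiberwise (g := fun A ↦ 2 * Real.exp (-(t * (Ideal.absNorm A.1 : ℝ))))
    (fun A ↦ by
      have h := hasSum_fintype (fun _ : ℤˣ ↦ Real.exp (-(t * (Ideal.absNorm A.1 : ℝ))))
      simpa using h)
  refine (hfib.div_const 2).congr_fun fun A ↦ ?_
  ring

/-- The partial zeta function of a class has a polar part that does not depend on the class. -/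
lemma exists_continuation_class (hp : 3 < p) (g : RingClassGroup p) :
    ∃ h : ℂ → ℂ, DifferentiableOn ℂ h {s | 0 < s.re} ∧ ∀ s : ℂ, 1 < s.re →
      HasSum (fun A : Ideal (𝓞 (QuadField p)) ↦ open Classical in
        if rayClass A = g then (Ideal.absNorm A : ℂ) ^ (-s) else 0)
        ((Real.pi / √(64 * p) / 4 : ℝ) / (s - 1) + h s) := by
  obtain ⟨B, rfl⟩ : ∃ B : oddIdeals p, g = ((B : RingClassGroup p)⁻¹ : RingClassGroup p) := by
    obtain ⟨B, hB⟩ := Con.mk'_surjective g⁻¹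
    refine ⟨B, ?_⟩
    rw [eq_comm, inv_eq_iff_eq_inv]
    exact hB
  have hB0 : B.1 ≠ 0 := by
    intro h
    have := B.2
    simp [oddIdeals, h] at this
  have hNB := absNorm_pos hB0
  have hp0 : (0 : ℝ) < 64 * p := by
    have : (0 : ℝ) < p := by exact_mod_cast (by omega : 0 < p)
    positivity
  have : Finite (𝓞 (QuadField p) ⧸ B.1) := Ideal.finiteQuotientOfFreeOfNeBot _ hB0
  obtain ⟨f, hf, hO⟩ := exists_theta_fiber (rayReduction B.1) (rayReduction_surjective B) (0, 1) hp0
  have hcard : Nat.card ((𝓞 (QuadField p) ⧸ B.1) × ZMod 2) = Ideal.absNorm B.1 * 2 := by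
    rw [Nat.card_prod, Nat.card_zmod]
    rfl
  rw [hcard] at hO
  have hNB' : (0 : ℝ) < Ideal.absNorm B.1 := by exact_mod_cast hNB
  obtain ⟨h, hd, hs⟩ := exists_continuation_of_theta
    (ι := {A : Ideal (𝓞 (QuadField p)) //
        rayClass A = ((B : RingClassGroup p)⁻¹ : RingClassGroup p)})
    (q := fun A ↦ (Ideal.absNorm A.1 : ℝ)) (F := fun t ↦ f (t / Ideal.absNorm B.1) / 2)
    (κ := Real.pi / √(64 * p) / 4) (by
      intro A
      have hA := mem_oddIdeals_of_rayClass_eq A.2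
      have : 1 ≤ Ideal.absNorm A.1 := Nat.pos_of_ne_zero (by
        intro h0
        simp [oddIdeals, h0] at hA)
      exact_mod_cast this)
    (fun t ht ↦ hasSum_theta_class hp B (by convert hf _ (div_pos ht hNB')))
    (by
      have htend : Tendsto (fun t : ℝ ↦ t / Ideal.absNorm B.1) (𝓝[>] 0) (𝓝[>] 0) := by
        refine tendsto_nhdsWithin_iff.2 ⟨?_, ?_⟩
        · have : Tendsto (fun t : ℝ ↦ t / Ideal.absNorm B.1) (𝓝 0) (𝓝 (0 / Ideal.absNorm B.1)) :=
            tendsto_id.div_const _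
          rw [zero_div] at this
          exact this.mono_left nhdsWithin_le_nhds
        · filter_upwards [self_mem_nhdsWithin] with t ht
          exact div_pos ht hNB'
      have h1 := (hO.comp_tendsto htend).const_mul_left (1 / 2)
      refine h1.congr' ?_ (Eventually.of_forall fun t ↦ rfl)
      filter_upwards [self_mem_nhdsWithin] with t ht
      have ht : t ≠ 0 := ne_of_gt ht
      simp only [Function.comp_apply]
      push_cast
      field_simp
      ring)
  refine ⟨h, hd, fun s hs1 ↦ ?_⟩
  have h1 := hs s hs1
  classical
  have h2 := (hasSum_subtype_iff_indicator (f := fun A : Ideal (𝓞 (QuadField p)) ↦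
    (Ideal.absNorm A : ℂ) ^ (-s)) (s := {A | rayClass A =
      ((B : RingClassGroup p)⁻¹ : RingClassGroup p)})).1 (by
      refine h1.congr_fun fun A ↦ ?_
      rw [Complex.ofReal_natCast]
      rfl)
  convert h2 using 1
  ext A
  rw [Set.indicator_apply]
  rfl

variable (p) in
/-- The ideals of `O_K`, with the norm and the class in the ring class group, as a `ClassZeta`. -/
def rayClassZeta (hp : 3 < p) : ClassZeta (Ideal (𝓞 (QuadField p))) (RingClassGroup p) where
  N := Ideal.absNorm
  N_ne_zero A hA := (absNorm_pos hA).ne'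
  eq_one_of_N A hA := Ideal.one_eq_top (R := 𝓞 (QuadField p)) ▸ Ideal.absNorm_eq_one_iff.1 hA
  cl := rayClass
  κ := Real.pi / √(64 * p) / 4
  κ_pos := by
    have : (0 : ℝ) < p := by exact_mod_cast (by omega : 0 < p)
    positivity
  h g := (exists_continuation_class hp g).choose
  diff_h g := (exists_continuation_class hp g).choose_spec.1
  hasSum_class g s hs := by
    convert (exists_continuation_class hp g).choose_spec.2 s hs

end

end SupersingularOrders

end

/-! ### Prime ideals of degree one in ring classes -/

noncomputable section

namespace SupersingularOrders

section

open Filter Topology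

variable {p : ℕ} [Fact p.Prime]

lemma exists_prime_natCast_mem {Q : Ideal (𝓞 (QuadField p))} (hQ : Q.IsPrime) {n : ℕ} (hn : n ≠ 0)
    (h : (n : 𝓞 (QuadField p)) ∈ Q) : ∃ q : ℕ, q.Prime ∧ (q : 𝓞 (QuadField p)) ∈ Q := by
  induction n using induction_on_primes with
  | zero => exact (hn rfl).elim
  | one => exact (hQ.ne_top ((Ideal.eq_top_iff_one _).2 (by simpa using h))).elim
  | prime_mul q a hq ih =>
    rw [Nat.cast_mul] at h
    rcases hQ.mem_or_mem h with h | h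
    · exact ⟨q, hq, h⟩
    · exact ih (right_ne_zero_of_mul hn) h

lemma eq_span_of_mem_of_absNorm_eq {Q : Ideal (𝓞 (QuadField p))} {γ : 𝓞 (QuadField p)}
    (h : γ ∈ Q) (h0 : γ ≠ 0) (hN : Ideal.absNorm Q = Ideal.absNorm (Ideal.span {γ})) :
    Q = Ideal.span {γ} := by
  obtain ⟨C, hC⟩ := Ideal.dvd_span_singleton.2 h
  have h1 : Ideal.absNorm Q ≠ 0 := by
    rw [hN, Ne, Ideal.absNorm_eq_zero_iff]
    simpa using h0
  have h2 : Ideal.absNorm C = 1 := by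
    rw [hC, map_mul] at hN
    exact (Nat.eq_of_mul_eq_mul_left (Nat.pos_of_ne_zero h1) (by rw [← hN, mul_one])).symm
  rw [Ideal.absNorm_eq_one_iff] at h2
  rw [hC, h2, Ideal.mul_top]

lemma absNorm_span_natCast (n : ℕ) :
    Ideal.absNorm (Ideal.span {(n : 𝓞 (QuadField p))}) = n ^ 2 := by
  have := absNorm_span_elt p n 0
  rw [← elt_natCast] at this
  have h2 : ((Ideal.absNorm (Ideal.span {(n : 𝓞 (QuadField p))}) : ℕ) : ℤ) = (n ^ 2 : ℕ) := by
    rw [this]; push_cast; ring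
  exact_mod_cast h2

lemma absNorm_span_sqrtNeg : Ideal.absNorm (Ideal.span {sqrtNeg p}) = p := by
  have := absNorm_span_elt p 0 1
  have h : elt p 0 1 = sqrtNeg p := by simp [elt]
  rw [h] at this
  have h2 : ((Ideal.absNorm (Ideal.span {sqrtNeg p}) : ℕ) : ℤ) = (p : ℕ) := by
    rw [this]; ring
  exact_mod_cast h2

/-- Prime ideals of `O_K` whose norm is not a prime other than `p` are inert or ramified. -/
lemma inert_or_ramified {Q : Ideal (𝓞 (QuadField p))} (hQ : Prime Q)
    (h : ∀ q : ℕ, q.Prime → q ≠ p → Ideal.absNorm Q ≠ q) :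
    (∃ q : ℕ, q.Prime ∧ Q = Ideal.span {(q : 𝓞 (QuadField p))}) ∨ Q = Ideal.span {sqrtNeg p} := by
  have hp : p.Prime := Fact.out
  have hQp := Ideal.isPrime_of_prime hQ
  have hN0 : Ideal.absNorm Q ≠ 0 := (absNorm_pos hQ.ne_zero).ne'
  obtain ⟨q, hq, hqQ⟩ := exists_prime_natCast_mem hQp hN0 (Ideal.absNorm_mem Q)
  have hdvd : Ideal.absNorm Q ∣ q ^ 2 := by
    rw [← absNorm_span_natCast (p := p)]
    exact Ideal.absNorm_dvd_absNorm_of_le ((Ideal.span_singleton_le_iff_mem _).2 hqQ)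
  obtain ⟨i, hi, hiq⟩ := (Nat.dvd_prime_pow hq).1 hdvd
  interval_cases i
  · rw [pow_zero, Ideal.absNorm_eq_one_iff] at hiq
    exact (hQp.ne_top hiq).elim
  · right
    rw [pow_one] at hiq
    have hqp : q = p := by
      by_contra hne
      exact h q hq hne hiq
    subst hqp
    have hmem : sqrtNeg q ∈ Q := by
      have : sqrtNeg q * sqrtNeg q ∈ Q := by
        rw [sqrtNeg_mul_self]
        exact neg_mem hqQ
      exact (hQp.mem_or_mem this).elim id id
    refine eq_span_of_mem_of_absNorm_eq hmem ?_ (by rw [absNorm_span_sqrtNeg, hiq])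
    intro h0
    have := absNorm_span_sqrtNeg (p := q)
    rw [h0] at this
    simp at this
    exact hq.ne_zero this.symm
  · left
    refine ⟨q, hq, eq_span_of_mem_of_absNorm_eq hqQ ?_ (by rw [absNorm_span_natCast, hiq])⟩
    exact_mod_cast hq.ne_zero

lemma two_le_absNorm {Q : Ideal (𝓞 (QuadField p))} (hQ : Prime Q) : 2 ≤ Ideal.absNorm Q := by
  have h0 := absNorm_pos hQ.ne_zero
  have h1 : Ideal.absNorm Q ≠ 1 := by
    rw [Ne, Ideal.absNorm_eq_one_iff]
    exact (Ideal.isPrime_of_prime hQ).ne_top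
  omega

/-- The inert and ramified primes contribute a convergent series. -/
lemma summable_inert_or_ramified :
    Summable fun Q : Ideal (𝓞 (QuadField p)) ↦ open Classical in
      if (∃ q : ℕ, q.Prime ∧ Q = Ideal.span {(q : 𝓞 (QuadField p))}) ∨ Q = Ideal.span {sqrtNeg p}
      then (Ideal.absNorm Q : ℝ) ^ (-1 : ℝ) * Real.log (Ideal.absNorm Q) else 0 := by
  classical
  let e : ℕ → Ideal (𝓞 (QuadField p)) := fun n ↦ Ideal.span {(n : 𝓞 (QuadField p))}
  have he : Function.Injective e := by
    intro m n h
    have := congrArg Ideal.absNorm h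
    simp only [e, absNorm_span_natCast] at this
    exact Nat.pow_left_injective two_ne_zero this
  have h1 : Summable fun Q : Ideal (𝓞 (QuadField p)) ↦
      if Q ∈ Set.range e
      then (Ideal.absNorm Q : ℝ) ^ (-1 : ℝ) * Real.log (Ideal.absNorm Q) else 0 := by
    refine (he.summable_iff fun Q hQ ↦ if_neg hQ).1 ?_
    have h2 : Summable fun n : ℕ ↦ 4 * (n : ℝ) ^ (-(3 / 2) : ℝ) :=
      (Real.summable_nat_rpow.2 (by norm_num)).mul_left _
    refine Summable.of_nonneg_of_le (fun n ↦ ?_) (fun n ↦ ?_) h2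
    · simp only [Function.comp_apply, Set.mem_range_self, if_true, e, absNorm_span_natCast]
      exact mul_nonneg (by positivity) (Real.log_natCast_nonneg _)
    · simp only [Function.comp_apply, Set.mem_range_self, if_true, e, absNorm_span_natCast]
      rcases Nat.eq_zero_or_pos n with rfl | hn
      · simp
      · have hn' : (0 : ℝ) < n := by exact_mod_cast hn
        have hl := Real.log_natCast_le_rpow_div n (ε := 1 / 2) (by norm_num)
        push_cast
        rw [Real.log_pow, ← Real.rpow_natCast, ← Real.rpow_mul hn'.le]
        calc (n : ℝ) ^ (((2 : ℕ) : ℝ) * -1) * (((2 : ℕ) : ℝ) * Real.log n)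
            ≤ (n : ℝ) ^ (((2 : ℕ) : ℝ) * -1) * (((2 : ℕ) : ℝ) * ((n : ℝ) ^ (1 / 2 : ℝ) / (1 / 2))) := by
              gcongr
          _ = 4 * ((n : ℝ) ^ (((2 : ℕ) : ℝ) * -1) * (n : ℝ) ^ (1 / 2 : ℝ)) := by push_cast; ring
          _ = 4 * (n : ℝ) ^ (-(3 / 2) : ℝ) := by
              rw [← Real.rpow_add hn']
              norm_num
  refine Summable.of_nonneg_of_le (fun Q ↦ ?_) (fun Q ↦ ?_) (h1.add
    ((hasSum_ite_eq (Ideal.span {sqrtNeg p}) ((p : ℝ) ^ (-1 : ℝ) * Real.log p)).summable))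
  · split_ifs
    · exact mul_nonneg (by positivity) (Real.log_natCast_nonneg _)
    · exact le_rfl
  · have hpos : 0 ≤ (p : ℝ) ^ (-1 : ℝ) * Real.log p :=
      mul_nonneg (by positivity) (Real.log_natCast_nonneg _)
    have hpos' : 0 ≤ (Ideal.absNorm Q : ℝ) ^ (-1 : ℝ) * Real.log (Ideal.absNorm Q) :=
      mul_nonneg (by positivity) (Real.log_natCast_nonneg _)
    by_cases hQ : Q = Ideal.span {sqrtNeg p}
    · rw [if_pos (Or.inr hQ), if_pos hQ]
      have : Ideal.absNorm Q = p := by rw [hQ, absNorm_span_sqrtNeg]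
      rw [this] at hpos' ⊢
      split_ifs <;> linarith
    · rw [if_neg hQ, add_zero]
      split_ifs with h2 h3 h3
      · exact le_rfl
      · exfalso
        rcases h2 with ⟨q, -, rfl⟩ | h2
        · exact h3 ⟨q, rfl⟩
        · exact hQ h2
      · exact hpos'
      · exact le_rfl

/-- Every ray class contains a prime ideal of degree one: the powers of exponent at least two, the
inert and the ramified primes do not suffice for the divergence of `primePowerSum`. -/
theorem exists_prime_rayClass_eq (hp : 3 < p) (g : RingClassGroup p) :
    ∃ Q : Ideal (𝓞 (QuadField p)), Prime Q ∧ rayClass Q = g ∧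
      ∃ q : ℕ, q.Prime ∧ q ≠ p ∧ Ideal.absNorm Q = q := by
  classical
  by_contra! hcon
  set Z := rayClassZeta p hp with hZ
  have hN (A : Ideal (𝓞 (QuadField p))) : Z.N A = Ideal.absNorm A := rfl
  have hcl (A : Ideal (𝓞 (QuadField p))) : Z.cl A = rayClass A := rfl
  set a : {Q : Ideal (𝓞 (QuadField p)) // Prime Q} × ℕ → ℝ := fun v ↦
    (Real.log (Ideal.absNorm v.1.1) * Z.w 2 v.1.1) * (2⁻¹ : ℝ) ^ v.2
  set b : {Q : Ideal (𝓞 (QuadField p)) // Prime Q} × ℕ → ℝ := fun v ↦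
    (if (∃ q : ℕ, q.Prime ∧ v.1.1 = Ideal.span {(q : 𝓞 (QuadField p))}) ∨
        v.1.1 = Ideal.span {sqrtNeg p}
      then (Ideal.absNorm v.1.1 : ℝ) ^ (-1 : ℝ) * Real.log (Ideal.absNorm v.1.1) else 0) *
      (if v.2 = 0 then 1 else 0)
  have ha : Summable a := by
    have h1 := (Z.summable_log_mul_w (σ := 2) (by norm_num)).comp_injective
      (Subtype.val_injective (p := fun Q : Ideal (𝓞 (QuadField p)) ↦ Prime Q))
    exact h1.mul_of_nonneg (summable_geometric_of_lt_one (r := (2⁻¹ : ℝ)) (by norm_num)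
      (by norm_num)) (fun Q ↦ mul_nonneg (Real.log_natCast_nonneg _) (Z.w_nonneg _ _))
      (fun k ↦ by positivity)
  have hb : Summable b := by
    have h1 := (summable_inert_or_ramified (p := p)).comp_injective
      (Subtype.val_injective (p := fun Q : Ideal (𝓞 (QuadField p)) ↦ Prime Q))
    refine (h1.mul_of_nonneg (hasSum_ite_eq (0 : ℕ) (1 : ℝ)).summable (fun Q ↦ ?_)
      (fun k ↦ ?_)).congr fun v ↦ ?_
    · simp only [Function.comp_apply, Pi.zero_apply]
      split_ifs
      · exact mul_nonneg (by positivity) (Real.log_natCast_nonneg _)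
      · exact le_rfl
    · simp only [Pi.zero_apply]
      split_ifs <;> norm_num
    · simp only [b, Function.comp_apply]
  have hle : ∀ σ : ℝ, 1 < σ → Z.primePowerSum g σ ≤ ∑' v, (2 * a v + b v) := by
    intro σ hσ
    have ha0 (v) : 0 ≤ a v :=
      mul_nonneg (mul_nonneg (Real.log_natCast_nonneg _) (Z.w_nonneg _ _)) (by positivity)
    have hb0 (v) : 0 ≤ b v := by
      refine mul_nonneg ?_ (by split_ifs <;> norm_num)
      split_ifs
      · exact mul_nonneg (by positivity) (Real.log_natCast_nonneg _)
      · exact le_rfl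
    have hterm (v : {Q : Ideal (𝓞 (QuadField p)) // Prime Q} × ℕ) :
        (if Z.cl (v.1.1 ^ (v.2 + 1)) = g then
          (Z.N (v.1.1 ^ (v.2 + 1)) : ℝ) ^ (-σ) * Real.log (Z.N v.1.1) else 0) ≤ 2 * a v + b v := by
      obtain ⟨⟨Q, hQ⟩, k⟩ := v
      split_ifs with h
      swap
      · linarith [ha0 (⟨Q, hQ⟩, k), hb0 (⟨Q, hQ⟩, k)]
      have h2 := two_le_absNorm hQ
      have h2' : (2 : ℝ) ≤ Ideal.absNorm Q := by exact_mod_cast h2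
      have hlog : 0 ≤ Real.log (Ideal.absNorm Q) := Real.log_natCast_nonneg _
      have hN1 : (1 : ℝ) ≤ (Ideal.absNorm Q : ℝ) ^ (k + 1) := one_le_pow₀ (by linarith)
      have hbound : (Z.N (Q ^ (k + 1)) : ℝ) ^ (-σ) * Real.log (Z.N Q) ≤
          ((Ideal.absNorm Q : ℝ) ^ (k + 1)) ^ (-1 : ℝ) * Real.log (Ideal.absNorm Q) := by
        rw [hN, hN, map_pow, Nat.cast_pow]
        gcongr
      refine hbound.trans ?_
      rcases k with _ | k
      · have h3 := inert_or_ramified hQ (fun q hq hqp ↦ hcon Q hQ (by simpa [hcl] using h) q hq hqp)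
        have h4 : b (⟨Q, hQ⟩, 0) =
            (Ideal.absNorm Q : ℝ) ^ (-1 : ℝ) * Real.log (Ideal.absNorm Q) := by
          simp only [b, if_pos h3, if_true, mul_one]
        rw [h4, zero_add, pow_one]
        linarith [ha0 (⟨Q, hQ⟩, 0)]
      · have hcl0 : Z.cl Q ≠ 0 := by
          intro h0
          rw [map_pow, h0, zero_pow (by omega)] at h
          exact WithZero.zero_ne_coe h
        have h4 : 2 * a (⟨Q, hQ⟩, k + 1) = Real.log (Ideal.absNorm Q) *
            ((Ideal.absNorm Q : ℝ) ^ 2)⁻¹ * (2⁻¹ : ℝ) ^ k := by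
          simp only [a, ClassZeta.w, if_neg hcl0, hN]
          rw [Real.rpow_neg (by positivity), Real.rpow_ofNat, pow_succ]
          ring
        have h5 : ((Ideal.absNorm Q : ℝ) ^ (k + 1 + 1)) ^ (-1 : ℝ) ≤
            ((Ideal.absNorm Q : ℝ) ^ 2)⁻¹ * (2⁻¹ : ℝ) ^ k := by
          rw [Real.rpow_neg_one, add_assoc, one_add_one_eq_two, pow_add, mul_inv, mul_comm,
            ← inv_pow _ k]
          gcongr
        rw [h4]
        have h6 := mul_le_mul_of_nonneg_right h5 hlog
        linarith [hb0 (⟨Q, hQ⟩, k + 1)]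
    have hsum := (ha.mul_left 2).add hb
    refine Summable.tsum_le_tsum (fun v ↦ ?_) (Summable.of_nonneg_of_le (fun v ↦ ?_)
      (fun v ↦ ?_) hsum) hsum
    · refine le_of_eq_of_le ?_ (hterm v)
      congr
    swap
    · refine le_of_eq_of_le ?_ (hterm v)
      congr
    split_ifs
    · exact mul_nonneg (by positivity) (Real.log_natCast_nonneg _)
    · exact le_rfl
  have h1 := (Z.tendsto_primePowerSum g).eventually_gt_atTop (∑' v, (2 * a v + b v))
  obtain ⟨σ, h2, h3⟩ := (h1.and self_mem_nhdsWithin).exists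
  exact absurd (hle σ h3) (not_le.2 h2)

/-- Every ideal of odd norm is a prime ideal of degree one, up to a quotient of two elements of
`rayElements p`. -/
theorem exists_prime_mul_eq (hp : 3 < p) {A : Ideal (𝓞 (QuadField p))}
    (hA : Odd (Ideal.absNorm A)) : ∃ Q : Ideal (𝓞 (QuadField p)), Q.IsPrime ∧
      (∃ q : ℕ, q.Prime ∧ q ≠ p ∧ Ideal.absNorm Q = q) ∧
      ∃ u ∈ rayElements p, ∃ v ∈ rayElements p, Ideal.span {u} * Q = Ideal.span {v} * A := by
  obtain ⟨Q, hQ, hcl, hq⟩ :=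
    exists_prime_rayClass_eq hp ((⟨A, hA⟩ : oddIdeals p) : RingClassGroup p)
  refine ⟨Q, Ideal.isPrime_of_prime hQ, hq, ?_⟩
  rw [rayClass_of_mem (mem_oddIdeals_of_rayClass_eq hcl), WithZero.coe_inj, Con.eq] at hcl
  exact hcl

end

end SupersingularOrders

end

/-! ### Lattices given by local conditions -/

noncomputable section

set_option linter.unusedSectionVars false

namespace SupersingularOrders

section

variable {p : ℕ} [Fact p.Prime]

variable (p) in
/-- The ring `ℤ[√-p]`. -/
def rootRing : Subring (QuadField p) where
  carrier := {z | ∃ a b : ℤ, z = ⟨a, b⟩}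
  zero_mem' := ⟨0, 0, by ext <;> simp⟩
  one_mem' := ⟨1, 0, by ext <;> simp [QuadraticAlgebra.re_one, QuadraticAlgebra.im_one]⟩
  add_mem' := by
    rintro _ _ ⟨a, b, rfl⟩ ⟨c, d, rfl⟩
    exact ⟨a + c, b + d, by ext <;> simp⟩
  neg_mem' := by
    rintro _ ⟨a, b, rfl⟩
    exact ⟨-a, -b, by ext <;> simp⟩
  mul_mem' := by
    rintro _ _ ⟨a, b, rfl⟩ ⟨c, d, rfl⟩
    exact ⟨a * c - p * b * d, a * d + b * c, by ext <;> (simp; try ring)⟩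

variable (p) in
/-- The localization of `ℤ[√-p]` at `2`. -/
def locTwo : Subring (QuadField p) where
  carrier := {z | ∃ n : ℤ, Odd n ∧ (n : QuadField p) * z ∈ rootRing p}
  zero_mem' := ⟨1, odd_one, by rw [mul_zero]; exact zero_mem _⟩
  one_mem' := ⟨1, odd_one, by simp⟩
  add_mem' := by
    rintro x y ⟨n, hn, hx⟩ ⟨m, hm, hy⟩
    refine ⟨n * m, hn.mul hm, ?_⟩
    have : ((n * m : ℤ) : QuadField p) * (x + y) = m * (n * x) + n * (m * y) := by push_cast; ring
    rw [this]
    exact add_mem (mul_mem (intCast_mem _ _) hx) (mul_mem (intCast_mem _ _) hy)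
  neg_mem' := by
    rintro x ⟨n, hn, hx⟩
    exact ⟨n, hn, by rw [mul_neg]; exact neg_mem hx⟩
  mul_mem' := by
    rintro x y ⟨n, hn, hx⟩ ⟨m, hm, hy⟩
    refine ⟨n * m, hn.mul hm, ?_⟩
    have : ((n * m : ℤ) : QuadField p) * (x * y) = (n * x) * (m * y) := by push_cast; ring
    rw [this]
    exact mul_mem hx hy

variable (p) in
/-- The ring `ℤ[√-p, 1/2]`. -/
def invertTwo : Subring (QuadField p) where
  carrier := {z | ∃ k : ℕ, (2 ^ k : QuadField p) * z ∈ rootRing p}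
  zero_mem' := ⟨0, by rw [mul_zero]; exact zero_mem _⟩
  one_mem' := ⟨0, by simp⟩
  add_mem' := by
    rintro x y ⟨n, hx⟩ ⟨m, hy⟩
    refine ⟨n + m, ?_⟩
    have : (2 ^ (n + m) : QuadField p) * (x + y) = 2 ^ m * (2 ^ n * x) + 2 ^ n * (2 ^ m * y) := by
      ring
    rw [this]
    exact add_mem (mul_mem (pow_mem (ofNat_mem _ 2) _) hx)
      (mul_mem (pow_mem (ofNat_mem _ 2) _) hy)
  neg_mem' := by
    rintro x ⟨n, hx⟩
    exact ⟨n, by rw [mul_neg]; exact neg_mem hx⟩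
  mul_mem' := by
    rintro x y ⟨n, hx⟩ ⟨m, hy⟩
    refine ⟨n + m, ?_⟩
    have : (2 ^ (n + m) : QuadField p) * (x * y) = (2 ^ n * x) * (2 ^ m * y) := by ring
    rw [this]
    exact mul_mem hx hy

lemma rootRing_le_locTwo : rootRing p ≤ locTwo p := fun x hx ↦ ⟨1, odd_one, by simpa using hx⟩

lemma rootRing_le_invertTwo : rootRing p ≤ invertTwo p := fun x hx ↦ ⟨0, by simpa using hx⟩

/-- An element of a lattice can be detected from an odd multiple and a multiple by a power of `2`.
-/
lemma mem_of_odd_smul_mem_of_pow_smul_mem {V : Type*} [AddCommGroup V] {M : Submodule ℤ V} {w : V}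
    {n : ℤ} {k : ℕ} (hn : Odd n) (h1 : n • w ∈ M) (h2 : (2 ^ k : ℤ) • w ∈ M) : w ∈ M := by
  obtain ⟨a, b, hab⟩ : IsCoprime n (2 ^ k : ℤ) := by
    refine IsCoprime.pow_right ?_
    obtain ⟨m, rfl⟩ := hn
    exact ⟨1, -m, by ring⟩
  rw [← one_smul ℤ w, ← hab, add_smul, mul_smul, mul_smul]
  exact add_mem (M.smul_mem _ h1) (M.smul_mem _ h2)

lemma mem_rootRing_of_mem_of_mem {x : QuadField p} (h1 : x ∈ locTwo p) (h2 : x ∈ invertTwo p) :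
    x ∈ rootRing p := by
  obtain ⟨n, hn, h1⟩ := h1
  obtain ⟨k, h2⟩ := h2
  have := mem_of_odd_smul_mem_of_pow_smul_mem (M := (rootRing p).toAddSubgroup.toIntSubmodule)
    (w := x) (k := k) hn (by rw [zsmul_eq_mul]; exact h1)
    (by rw [zsmul_eq_mul]; push_cast; exact h2)
  exact this

lemma mem_invertTwo_of_two_mul {x : QuadField p} (h : 2 * x ∈ invertTwo p) : x ∈ invertTwo p := by
  obtain ⟨k, hk⟩ := h
  exact ⟨k + 1, by rw [pow_succ, mul_assoc]; exact hk⟩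

/-- The element `x + yβ` of the quaternion algebra. -/
def quat (q : ℕ) (x y : QuadField p) : QuatAlg p q := ⟨x.re, x.im, y.re, y.im⟩

/-- The coefficient `x` of `x + yβ`. -/
def fstPart {q : ℕ} (w : QuatAlg p q) : QuadField p := ⟨w.re, w.imI⟩

/-- The coefficient `y` of `x + yβ`. -/
def sndPart {q : ℕ} (w : QuatAlg p q) : QuadField p := ⟨w.imJ, w.imK⟩

variable {q : ℕ}

@[simp] lemma fstPart_quat (x y : QuadField p) : fstPart (quat q x y) = x := rfl

@[simp] lemma sndPart_quat (x y : QuadField p) : sndPart (quat q x y) = y := rfl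

lemma quat_fst_snd (w : QuatAlg p q) : quat q (fstPart w) (sndPart w) = w := rfl

lemma quat_mul (x y z w : QuadField p) :
    quat q x y * quat q z w = quat q (x * z - (q : QuadField p) * (y * star w)) (x * w + y * star z) := by
  ext <;> simp [quat] <;> ring

lemma quat_add (x y z w : QuadField p) : quat q x y + quat q z w = quat q (x + z) (y + w) := rfl

lemma intCast_smul_quat (n : ℤ) (x y : QuadField p) : n • quat q x y =
    quat q ((n : QuadField p) * x) ((n : QuadField p) * y) := by
  ext <;> simp [quat]

lemma embed_eq (x : QuadField p) : embed p q x = quat q x 0 := rfl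

lemma embed_mul_mul_embed (a b x y : QuadField p) :
    embed p q a * quat q x y * embed p q b = quat q (a * x * b) (a * y * star b) := by
  rw [embed_eq, embed_eq, quat_mul, quat_mul]
  simp

/-- The lattice of the `x + yβ` such that `2x` lies in `ℤ[√-p]`, `y D` lies in `ℤ[√-p, 1/2]`, and
`e x - y` lies in the localization of `ℤ[√-p]` at `2`. The second condition restricts `y` at the odd
primes, the third at `2`. -/
def localLattice (q : ℕ) (D : Set (QuadField p)) (e : QuadField p) :
    Submodule ℤ (QuatAlg p q) where
  carrier := {w | 2 * fstPart w ∈ rootRing p ∧ (∀ d ∈ D, sndPart w * d ∈ invertTwo p) ∧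
    e * fstPart w - sndPart w ∈ locTwo p}
  zero_mem' := by
    have h1 : fstPart (0 : QuatAlg p q) = 0 := rfl
    have h2 : sndPart (0 : QuatAlg p q) = 0 := rfl
    simp [h1, h2, zero_mem]
  add_mem' := by
    rintro v w ⟨h1, h2, h3⟩ ⟨h4, h5, h6⟩
    have e1 : fstPart (v + w) = fstPart v + fstPart w := rfl
    have e2 : sndPart (v + w) = sndPart v + sndPart w := rfl
    refine ⟨?_, fun d hd ↦ ?_, ?_⟩
    · rw [e1, mul_add]; exact add_mem h1 h4
    · rw [e2, add_mul]; exact add_mem (h2 d hd) (h5 d hd)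
    · rw [e1, e2, mul_add, add_sub_add_comm]; exact add_mem h3 h6
  smul_mem' := by
    rintro n w ⟨h1, h2, h3⟩
    have e1 : fstPart (n • w) = (n : QuadField p) * fstPart w := by
      rw [← quat_fst_snd w, intCast_smul_quat]; rfl
    have e2 : sndPart (n • w) = (n : QuadField p) * sndPart w := by
      rw [← quat_fst_snd w, intCast_smul_quat]; rfl
    refine ⟨?_, fun d hd ↦ ?_, ?_⟩
    · rw [e1, mul_left_comm]; exact mul_mem (intCast_mem _ _) h1
    · rw [e2, mul_assoc]; exact mul_mem (intCast_mem _ _) (h2 d hd)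
    · rw [e1, e2, mul_left_comm, ← mul_sub]; exact mul_mem (intCast_mem _ _) h3

lemma quat_mem_localLattice {D : Set (QuadField p)} {e x y : QuadField p} :
    quat q x y ∈ localLattice q D e ↔ 2 * x ∈ rootRing p ∧ (∀ d ∈ D, y * d ∈ invertTwo p) ∧
      e * x - y ∈ locTwo p := Iff.rfl

variable (p) in
lemma mem_maxOrder {q : ℕ} {r : ℤ} {w : QuatAlg p q} : w ∈ maxOrder p q r ↔
    ∃ a b c d : ℤ, w = ⟨a + b / 2, c / 2, b / 2 + d * (r / q), c / 2 + d * (1 / q)⟩ := by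
  simp only [maxOrder, Submodule.mem_span_insert, Submodule.mem_span_singleton]
  constructor
  · rintro ⟨a, _, ⟨b, _, ⟨c, _, ⟨d, rfl⟩, rfl⟩, rfl⟩, rfl⟩
    refine ⟨a, b, c, d, ?_⟩
    ext <;> simp <;> ring
  · rintro ⟨a, b, c, d, rfl⟩
    refine ⟨a, _, ⟨b, _, ⟨c, _, ⟨d, rfl⟩, rfl⟩, rfl⟩, ?_⟩
    ext <;> simp <;> ring

/-- The lattice `𝒪(q, r)` by local conditions. The two elements of `D` generate, away from `2`, the
prime ideal `[q, r - √-p]`. -/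
lemma maxOrder_eq_localLattice {r : ℤ} (hq : Odd q) (hr : (q : ℤ) ∣ r ^ 2 + p) :
    maxOrder p q r = localLattice q {(q : QuadField p), ⟨r, -1⟩} 1 := by
  have hq0 : (q : ℚ) ≠ 0 := by
    have : q ≠ 0 := by rintro rfl; exact absurd hq (by decide)
    exact_mod_cast this
  obtain ⟨m, hm⟩ := hr
  have hm' : (r : ℚ) ^ 2 + p = q * m := by exact_mod_cast hm
  ext w
  rw [mem_maxOrder]
  constructor
  · rintro ⟨a, b, c, d, rfl⟩
    refine ⟨⟨2 * a + b, c, ?_⟩, ?_, ⟨q, by exact_mod_cast hq, ⟨q * a - d * r, -d, ?_⟩⟩⟩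
    · ext <;> simp [fstPart, QuadraticAlgebra.re_ofNat, QuadraticAlgebra.im_ofNat] <;> ring
    · rintro _ (rfl | rfl)
      · refine ⟨1, b * q + 2 * d * r, c * q + 2 * d, ?_⟩
        ext <;> simp [sndPart, QuadraticAlgebra.re_ofNat, QuadraticAlgebra.im_ofNat] <;>
          field_simp
      · refine ⟨1, b * r + c * p + 2 * d * m, -b + c * r, ?_⟩
        ext <;> simp [sndPart, QuadraticAlgebra.re_ofNat, QuadraticAlgebra.im_ofNat] <;>
          field_simp
        · linear_combination (2 * d : ℚ) * hm'
        · ring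
    · ext <;> simp [fstPart, sndPart] <;> field_simp <;> ring
  · rintro ⟨hx, hD, hxy⟩
    rw [one_mul] at hxy
    set x := fstPart w with hxw
    set y := sndPart w with hyw
    have hx' : x ∈ invertTwo p := mem_invertTwo_of_two_mul (rootRing_le_invertTwo hx)
    have hz (d : QuadField p) (hd : d ∈ ({(q : QuadField p), ⟨r, -1⟩} : Set (QuadField p)))
        (hd' : d ∈ rootRing p) : (y - x) * d ∈ invertTwo p := by
      rw [sub_mul]
      exact sub_mem (hD d hd) (mul_mem hx' (rootRing_le_invertTwo hd'))
    have hqz : (y - x) * q ∈ rootRing p := by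
      refine mem_rootRing_of_mem_of_mem (mul_mem ?_ (natCast_mem _ _))
        (hz _ (Or.inl rfl) (natCast_mem _ _))
      rw [← neg_sub]
      exact neg_mem hxy
    obtain ⟨s, t, hst⟩ := hqz
    obtain ⟨k, u, v, huv⟩ := hz ⟨r, -1⟩ (Or.inr rfl) ⟨r, -1, by simp⟩
    obtain ⟨b, c, hbc⟩ := hx
    have hs := congrArg QuadraticAlgebra.re hst
    have ht := congrArg QuadraticAlgebra.im hst
    have hv := congrArg QuadraticAlgebra.im huv
    have hb := congrArg QuadraticAlgebra.re hbc
    have hc := congrArg QuadraticAlgebra.im hbc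
    have h2 : (2 ^ k : QuadField p) = ((2 ^ k : ℕ) : QuadField p) := by push_cast; rfl
    rw [h2, QuadraticAlgebra.im_mul, QuadraticAlgebra.re_natCast, QuadraticAlgebra.im_natCast] at hv
    simp at hs ht hv
    rw [two_mul] at hb hc
    simp at hb hc
    have hdvd : (q : ℤ) ∣ t * r - s := by
      have hcop : IsCoprime (q : ℤ) (2 ^ k) := by
        refine IsCoprime.pow_right ?_
        obtain ⟨m, rfl⟩ := hq
        exact ⟨1, -m, by push_cast; ring⟩
      refine hcop.dvd_of_dvd_mul_left ⟨v, ?_⟩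
      have : ((2 ^ k * (t * r - s) : ℤ) : ℚ) = ((q * v : ℤ) : ℚ) := by
        push_cast
        rw [← hs, ← ht, ← hv]
        ring
      exact_mod_cast this
    obtain ⟨j, hj⟩ := hdvd
    have hj' : (t * r - s : ℚ) = q * j := by exact_mod_cast hj
    refine ⟨j, b - 2 * j, c, t, ?_⟩
    have e1 : w.re = x.re := rfl
    have e2 : w.imI = x.im := rfl
    have e3 : w.imJ = y.re := rfl
    have e4 : w.imK = y.im := rfl
    ext
    · simp only [e1]; push_cast; linarith
    · simp only [e2]; linarith
    · simp only [e3]; push_cast; field_simp; linear_combination 2 * hs + q * hb - 2 * hj'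
    · simp only [e4]; field_simp; linear_combination 2 * ht + q * hc

end

end SupersingularOrders

end

/-! ### Homomorphisms between quaternion algebras -/

noncomputable section

set_option linter.unusedSectionVars false

namespace SupersingularOrders

section

variable {p : ℕ} [Fact p.Prime] {q : ℕ}

lemma mul_mem_maxOrder {r : ℤ} (hq : q % 4 = 3) (hr : (q : ℤ) ∣ r ^ 2 + p) {v w : QuatAlg p q}
    (hv : v ∈ maxOrder p q r) (hw : w ∈ maxOrder p q r) : v * w ∈ maxOrder p q r := by
  rw [mem_maxOrder] at *
  obtain ⟨a, b, c, d, rfl⟩ := hv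
  obtain ⟨A, B, C, D, rfl⟩ := hw
  obtain ⟨m, hm⟩ := hr
  have hq0 : (q : ℚ) ≠ 0 := by
    have : q ≠ 0 := by omega
    exact_mod_cast this
  obtain ⟨k, hk⟩ : ∃ k : ℤ, (q : ℤ) + 1 = 4 * k := ⟨(q + 1) / 4, by omega⟩
  have hp' : (p : ℚ) = q * m - r ^ 2 := by
    have : (r : ℚ) ^ 2 + p = q * m := by exact_mod_cast hm
    linarith
  have hk' : (k : ℚ) = (q + 1) / 4 := by
    have : (q : ℚ) + 1 = 4 * k := by exact_mod_cast hk
    linarith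
  -- structure constants of `𝒪(q, r)` in terms of `m = (r² + p) / q` and `k = (q + 1) / 4`
  refine ⟨a * A - d * D * m - k * (b * B + p * c * C) + r * k * (c * B - b * C) +
      D * (c * r ^ 2 + m * c * (1 - 2 * k) - b * r) - 2 * k * d * C * m,
    a * B + A * b + b * B - D * (b * r + p * c) - d * (r * B + p * C) -
      2 * r * k * (c * B - b * C) - 2 * D * (c * r ^ 2 + m * c * (1 - 2 * k) - b * r) +
      4 * k * d * C * m,
    a * C + A * c + c * B - 2 * k * (c * B - b * C) - D * (c * r - b) - d * (B - r * C),
    q * k * (c * B - b * C) + D * (2 * k * c * r + b * (1 - 2 * k)) + 2 * k * d * (B - r * C) +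
      a * D + A * d, ?_⟩
  ext <;> simp <;> rw [hk'] <;> (try rw [hp']) <;> field_simp <;> ring

lemma one_mem_maxOrder (r : ℤ) : (1 : QuatAlg p q) ∈ maxOrder p q r :=
  (mem_maxOrder p).2 ⟨1, 0, 0, 0, by ext <;> simp⟩

variable (p) in
/-- The ring structure on the lattice `𝒪(q, r)`. -/
def maxOrderRing (r : ℤ) (hq : q % 4 = 3) (hr : (q : ℤ) ∣ r ^ 2 + p) : Subring (QuatAlg p q) where
  carrier := maxOrder p q r
  zero_mem' := zero_mem _
  one_mem' := one_mem_maxOrder r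
  add_mem' := add_mem
  neg_mem' := neg_mem
  mul_mem' := mul_mem_maxOrder hq hr

variable (p q) in
/-- The ring homomorphism `x + yβ₂ ↦ x + yδβ₁` between quaternion algebras with
`β₁² = -q` and `β₂² = -q'`, where `δ` has norm `q' / q`. -/
def twistHom (q' : ℕ) (δ : QuadField p) (hδ : (q : QuadField p) * (δ * star δ) = q') :
    QuatAlg p q' →+* QuatAlg p q where
  toFun w := quat q (fstPart w) (sndPart w * δ)
  map_one' := by
    ext <;> simp [quat, fstPart, sndPart]
  map_zero' := by
    ext <;> simp [quat, fstPart, sndPart]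
  map_add' v w := by
    rw [quat_add, ← add_mul]; rfl
  map_mul' v w := by
    conv_lhs => rw [← quat_fst_snd v, ← quat_fst_snd w, quat_mul]
    rw [fstPart_quat, sndPart_quat, quat_mul, star_mul, ← hδ]
    congr 1 <;> ring

lemma twistHom_injective {q' : ℕ} {δ : QuadField p}
    (hδ : (q : QuadField p) * (δ * star δ) = q') (h0 : δ ≠ 0) :
    Function.Injective (twistHom p q q' δ hδ) := by
  rw [injective_iff_map_eq_zero]
  intro w hw
  have h1 : fstPart w = 0 := congrArg fstPart hw
  have h2 : sndPart w * δ = 0 := congrArg sndPart hw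
  rw [← quat_fst_snd w, h1, (mul_eq_zero.1 h2).resolve_right h0]
  rfl

lemma IsomorphicRings.trans {A B C : Type*} [Ring A] [Ring B] [Ring C] {L : Submodule ℤ A}
    {M : Submodule ℤ B} {N : Submodule ℤ C} (h₁ : IsomorphicRings L M) (h₂ : IsomorphicRings M N) :
    IsomorphicRings L N := by
  obtain ⟨R, S, hR, hS, ⟨f⟩⟩ := h₁
  obtain ⟨S', T, hS', hT, ⟨g⟩⟩ := h₂
  obtain rfl : S = S' := SetLike.coe_injective (hS.trans hS'.symm)
  exact ⟨R, T, hR, hT, ⟨f.trans g⟩⟩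

lemma isomorphicRings_of_map {A B : Type*} [Ring A] [Ring B] {M : Submodule ℤ A}
    {N : Submodule ℤ B} (S : Subring B) (hS : (S : Set B) = N) (f : B →+* A)
    (hf : Function.Injective f) (h : ∀ w, w ∈ M ↔ ∃ v ∈ N, f v = w) : IsomorphicRings M N := by
  refine ⟨S.map f, S, ?_, hS, ⟨(S.equivMapOfInjective f hf).symm⟩⟩
  ext w
  rw [Subring.coe_map, hS, SetLike.mem_coe, h]
  rfl

variable (p q) in
/-- Conjugation by `β`. -/
def conjBeta : QuatAlg p q →+* QuatAlg p q where
  toFun w := quat q (star (fstPart w)) (star (sndPart w))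
  map_one' := by
    ext <;> simp [quat, fstPart, sndPart]
  map_zero' := by
    ext <;> simp [quat, fstPart, sndPart]
  map_add' v w := by
    rw [quat_add, ← star_add, ← star_add]; rfl
  map_mul' v w := by
    conv_lhs => rw [← quat_fst_snd v, ← quat_fst_snd w, quat_mul]
    rw [fstPart_quat, sndPart_quat, quat_mul]
    simp only [star_sub, star_add, star_mul, star_star]
    congr 1
    · have : star (q : QuadField p) = q := star_natCast _
      rw [this]; ring
    · ring

/-- Conjugation by `β` carries `𝒪(q, r)` to `𝒪(q, -r)`. -/
lemma isomorphicRings_maxOrder_neg {r : ℤ} (hq : q % 4 = 3) (hr : (q : ℤ) ∣ r ^ 2 + p) :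
    IsomorphicRings (maxOrder p q (-r)) (maxOrder p q r) := by
  have hinv : ∀ w, conjBeta p q (conjBeta p q w) = w := by
    intro w
    change quat q (star (star (fstPart w))) (star (star (sndPart w))) = w
    rw [star_star, star_star]
    rfl
  have hmaps : ∀ (r : ℤ) (w : QuatAlg p q), w ∈ maxOrder p q r →
      conjBeta p q w ∈ maxOrder p q (-r) := by
    intro r w hw
    obtain ⟨a, b, c, d, rfl⟩ := (mem_maxOrder p).1 hw
    refine (mem_maxOrder p).2 ⟨a, b, -c, -d, ?_⟩
    ext <;> simp [conjBeta, quat, fstPart, sndPart] <;> ring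
  refine isomorphicRings_of_map (maxOrderRing p r hq hr) rfl (conjBeta p q)
    (Function.LeftInverse.injective hinv) fun w ↦ ⟨fun h ↦ ?_, ?_⟩
  · exact ⟨conjBeta p q w, by simpa using hmaps _ _ h, hinv w⟩
  · rintro ⟨v, hv, rfl⟩
    exact hmaps _ _ hv

end

end SupersingularOrders

end

/-! ### Comparison of lattices with `𝒪(q, r)` -/

noncomputable section

set_option linter.unusedSectionVars false

namespace SupersingularOrders

section

variable {p : ℕ} [Fact p.Prime] {q : ℕ}

lemma algebraMap_elt_mem_rootRing (a b : ℤ) :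
    algebraMap (𝓞 (QuadField p)) (QuadField p) (elt p a b) ∈ rootRing p :=
  ⟨a, b, algebraMap_elt p a b⟩

/-- The integers in a proper ideal that contains a prime `q` are multiples of `q`. -/
lemma dvd_of_intCast_mem {Q : Ideal (𝓞 (QuadField p))} (hQ : Q ≠ ⊤) (hq : q.Prime)
    (hqQ : (q : 𝓞 (QuadField p)) ∈ Q) {m : ℤ} (hm : (m : 𝓞 (QuadField p)) ∈ Q) : (q : ℤ) ∣ m := by
  by_contra h
  obtain ⟨a, b, hab⟩ := ((Nat.prime_iff_prime_int.1 hq).coprime_iff_not_dvd).2 h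
  apply hQ
  rw [Ideal.eq_top_iff_one]
  have h1 : (1 : 𝓞 (QuadField p)) = a * q + b * m := by exact_mod_cast congrArg Int.cast hab.symm
  rw [h1]
  exact add_mem (Q.mul_mem_left _ hqQ) (Q.mul_mem_left _ hm)

variable (p) in
/-- The multiplicative set of the elements `x + 2y√-p` of `O_K` with `x` odd. -/
def oddElements : Submonoid (𝓞 (QuadField p)) where
  carrier := {γ | ∃ x y : ℤ, Odd x ∧ γ = elt p x (2 * y)}
  one_mem' := ⟨1, 0, odd_one, by simp [elt]⟩
  mul_mem' := by
    rintro _ _ ⟨x, y, hx, rfl⟩ ⟨z, w, hz, rfl⟩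
    refine ⟨x * z - p * (2 * y) * (2 * w), x * w + y * z, ?_, ?_⟩
    · exact (hx.mul hz).sub_even ⟨p * y * w * 2, by ring⟩
    · rw [elt_mul]; congr 1; ring

lemma rayElements_le_oddElements : rayElements p ≤ oddElements p := by
  rintro _ ⟨x, y, hx, rfl⟩
  exact ⟨x, 4 * y, hx, by congr 1; ring⟩

lemma algebraMap_oddElements_ne_zero {u : 𝓞 (QuadField p)} (hu : u ∈ oddElements p) :
    algebraMap (𝓞 (QuadField p)) (QuadField p) u ≠ 0 := by
  obtain ⟨x, y, hx, rfl⟩ := hu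
  intro h
  rw [algebraMap_elt] at h
  have := congrArg QuadraticAlgebra.re h
  simp at this
  rw [this] at hx
  exact absurd hx (by decide)

/-- Quotients of two elements of `oddElements p` are congruent to `1` modulo `2` in the localization
at `2`. -/
lemma exists_div_eq_one_add {u v : 𝓞 (QuadField p)} (hu : u ∈ oddElements p)
    (hv : v ∈ oddElements p) : ∃ k ∈ locTwo p, algebraMap (𝓞 (QuadField p)) (QuadField p) v /
      algebraMap (𝓞 (QuadField p)) (QuadField p) u = 1 + 2 * k := by
  have hu0 := algebraMap_oddElements_ne_zero hu
  obtain ⟨x, y, hx, rfl⟩ := hu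
  obtain ⟨z, w, hz, rfl⟩ := hv
  obtain ⟨c, d, hc, hcd⟩ := (oddElements p).mul_mem ⟨z, w, hz, rfl⟩ ⟨x, -y, hx, rfl⟩
  set n : ℤ := x * x + p * (2 * y) * (2 * y) with hn
  have hnodd : Odd n := (hx.mul hx).add_even ⟨p * y * y * 2, by ring⟩
  have hn' : elt p x (2 * y) * elt p x (2 * -y) = n := by
    rw [elt_mul, elt_intCast, hn]; congr 1 <;> ring
  have hn0 : (n : QuadField p) ≠ 0 := by
    have : n ≠ 0 := by rintro h; rw [h] at hnodd; exact absurd hnodd (by decide)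
    exact_mod_cast this
  obtain ⟨j, hj⟩ : Even (c - n) := hc.sub_odd hnodd
  have h1 := congrArg (algebraMap (𝓞 (QuadField p)) (QuadField p)) hcd
  have h2 := congrArg (algebraMap (𝓞 (QuadField p)) (QuadField p)) hn'
  rw [map_mul] at h1 h2
  rw [map_intCast] at h2
  have h3 : algebraMap (𝓞 (QuadField p)) (QuadField p) (elt p c (2 * d)) =
      n + 2 * algebraMap (𝓞 (QuadField p)) (QuadField p) (elt p j d) := by
    have : elt p c (2 * d) = n + 2 * elt p j d := by
      have : c = n + 2 * j := by linarith
      rw [this]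
      simp only [elt]; push_cast; ring
    rw [this, map_add, map_mul, map_intCast, map_ofNat]
  refine ⟨algebraMap (𝓞 (QuadField p)) (QuadField p) (elt p j d) / n, ⟨n, hnodd, ?_⟩, ?_⟩
  · rw [mul_div_cancel₀ _ hn0]
    exact algebraMap_elt_mem_rootRing _ _
  · rw [div_eq_iff hu0]
    have h4 : (n : QuadField p) * algebraMap (𝓞 (QuadField p)) (QuadField p) (elt p z (2 * w)) =
        (n + 2 * algebraMap (𝓞 (QuadField p)) (QuadField p) (elt p j d)) *
        algebraMap (𝓞 (QuadField p)) (QuadField p) (elt p x (2 * y)) := by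
      rw [← h3, ← h1, ← h2]; ring
    field_simp
    linear_combination h4

lemma div_mem_locTwo {u v : 𝓞 (QuadField p)} (hu : u ∈ oddElements p) (hv : v ∈ oddElements p) :
    algebraMap (𝓞 (QuadField p)) (QuadField p) v / algebraMap (𝓞 (QuadField p)) (QuadField p) u ∈
      locTwo p := by
  obtain ⟨k, hk, h⟩ := exists_div_eq_one_add hu hv
  rw [h]
  exact add_mem (one_mem _) (mul_mem (ofNat_mem _ 2) hk)

/-- Integrality of `y`, away from `2`, against a prime ideal of degree one can be tested on `q` and
`r - √-p`. -/
lemma forall_mul_mem_iff {Q : Ideal (𝓞 (QuadField p))} (hQ : Q ≠ ⊤) (hq : q.Prime)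
    (hqQ : (q : 𝓞 (QuadField p)) ∈ Q) {r : ℤ} (hr : elt p r (-1) ∈ Q) (y : QuadField p) :
    (∀ d ∈ ({(q : QuadField p), ⟨r, -1⟩} : Set (QuadField p)), y * d ∈ invertTwo p) ↔
      ∀ z ∈ Q, y * algebraMap (𝓞 (QuadField p)) (QuadField p) z ∈ invertTwo p := by
  have he : algebraMap (𝓞 (QuadField p)) (QuadField p) (elt p r (-1)) = ⟨r, -1⟩ := by
    rw [algebraMap_elt]; ext <;> simp
  constructor
  · intro h z hz
    obtain ⟨a, b, hab⟩ := two_mul_eq_elt p z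
    have h1 : ((a + b * r : ℤ) : 𝓞 (QuadField p)) = 2 * z + b * elt p r (-1) := by
      rw [hab]; simp only [elt]; push_cast; ring
    obtain ⟨c, hc⟩ := dvd_of_intCast_mem hQ hq hqQ
      (h1 ▸ add_mem (Q.mul_mem_left _ hz) (Q.mul_mem_left _ hr))
    have h2 : 2 * z = c * q - b * elt p r (-1) := by
      rw [eq_sub_iff_add_eq, ← h1, hc]; push_cast; ring
    have h3 := congrArg (algebraMap (𝓞 (QuadField p)) (QuadField p)) h2
    rw [map_sub, map_mul, map_mul, map_mul, map_intCast, map_intCast, map_natCast, map_ofNat,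
      he] at h3
    refine mem_invertTwo_of_two_mul ?_
    rw [mul_left_comm, h3]
    have h4 : y * (c * q - b * (⟨r, -1⟩ : QuadField p)) =
        c * (y * q) - b * (y * (⟨r, -1⟩ : QuadField p)) := by ring
    rw [h4]
    exact sub_mem (mul_mem (intCast_mem _ _) (h _ (Or.inl rfl)))
      (mul_mem (intCast_mem _ _) (h _ (Or.inr rfl)))
  · rintro h _ (rfl | rfl)
    · simpa using h _ hqQ
    · rw [← he]
      exact h _ hr

/-- The lattice with the local conditions given by `D` and `e`, where `e` is a unit at `2`, is
isomorphic to `𝒪(q', r)` if for some `δ` of norm `q' / q` the set `δ D` is a prime ideal over `q'`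
and `δ / e` is a quotient of elements of `oddElements p`. As such a quotient is `1` modulo `2` and
`2x` is integral, `twistHom` identifies the conditions at `2`. -/
lemma isomorphicRings_localLattice {q' : ℕ} (hq' : q'.Prime) (hq4 : q' % 4 = 3) {r : ℤ}
    (hr : (q' : ℤ) ∣ r ^ 2 + p) {Q : Ideal (𝓞 (QuadField p))} (hQ : Q ≠ ⊤)
    (hqQ : (q' : 𝓞 (QuadField p)) ∈ Q) (hrQ : elt p r (-1) ∈ Q) {D : Set (QuadField p)}
    {e e' : QuadField p} (he : e ∈ locTwo p) (he' : e' ∈ locTwo p) (hee' : e * e' = 1)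
    {u v : 𝓞 (QuadField p)} (hu : u ∈ oddElements p) (hv : v ∈ oddElements p) {δ : QuadField p}
    (hδ : (q : QuadField p) * (δ * star δ) = q')
    (hδe : δ = e * (algebraMap (𝓞 (QuadField p)) (QuadField p) v /
      algebraMap (𝓞 (QuadField p)) (QuadField p) u))
    (hD : ∀ d ∈ D, ∃ z ∈ Q, δ * d = algebraMap (𝓞 (QuadField p)) (QuadField p) z)
    (hD' : ∀ z ∈ Q, ∃ d ∈ D, δ * d = algebraMap (𝓞 (QuadField p)) (QuadField p) z) :
    IsomorphicRings (localLattice q D e) (maxOrder p q' r) := by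
  have hδ0 : δ ≠ 0 := by
    rintro rfl
    have : (q' : QuadField p) = 0 := by rw [← hδ]; simp
    exact hq'.ne_zero (by exact_mod_cast this)
  obtain ⟨k, hk, hε⟩ := exists_div_eq_one_add hu hv
  have hε1 := div_mem_locTwo hu hv
  have hε2 := div_mem_locTwo hv hu
  have hε3 : (algebraMap (𝓞 (QuadField p)) (QuadField p) v /
      algebraMap (𝓞 (QuadField p)) (QuadField p) u) * (algebraMap (𝓞 (QuadField p)) (QuadField p) u /
      algebraMap (𝓞 (QuadField p)) (QuadField p) v) = 1 := by
    have := algebraMap_oddElements_ne_zero hu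
    have := algebraMap_oddElements_ne_zero hv
    field_simp
  set ε := algebraMap (𝓞 (QuadField p)) (QuadField p) v /
      algebraMap (𝓞 (QuadField p)) (QuadField p) u
  set ε' := algebraMap (𝓞 (QuadField p)) (QuadField p) u /
      algebraMap (𝓞 (QuadField p)) (QuadField p) v
  have hodd : Odd q' := Nat.odd_iff.2 (by omega)
  have key (x y : QuadField p) : quat q x (y * δ) ∈ localLattice q D e ↔
      quat q' x y ∈ maxOrder p q' r := by
    rw [maxOrder_eq_localLattice hodd hr, quat_mem_localLattice, quat_mem_localLattice,
      forall_mul_mem_iff hQ hq' hqQ hrQ, one_mul]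
    refine and_congr_right fun hx ↦ and_congr ?_ ?_
    · constructor
      · intro h z hz
        obtain ⟨d, hd, hdz⟩ := hD' z hz
        rw [← hdz, ← mul_assoc]
        exact h d hd
      · intro h d hd
        obtain ⟨z, hz, hdz⟩ := hD d hd
        rw [mul_assoc, hdz]
        exact h z hz
    · constructor
      · intro h
        have h1 : x - y = ε' * (e' * (e * x - y * δ)) + ε' * ((2 * x) * k) := by
          rw [hδe]
          have h2 : ε' * (e' * (e * x - y * (e * ε))) + ε' * ((2 * x) * k) =
            (e * e') * (ε' * x - y * (ε * ε')) + ε' * ((2 * x) * k) := by ring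
          rw [h2, hee', hε3]
          have h3 : ε' * (2 * k) = 1 - ε' := by
            have : ε' * (1 + 2 * k) = 1 := by rw [← hε, mul_comm]; exact hε3
            linear_combination this
          linear_combination (-x) * h3
        rw [h1]
        exact add_mem (mul_mem hε2 (mul_mem he' h))
          (mul_mem hε2 (mul_mem (rootRing_le_locTwo hx) hk))
      · intro h
        have h1 : e * x - y * δ = e * (ε * (x - y) - (2 * x) * k) := by
          rw [hδe]
          linear_combination (-e * x) * hε
        rw [h1]
        exact mul_mem he (sub_mem (mul_mem hε1 h) (mul_mem (rootRing_le_locTwo hx) hk))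
  refine isomorphicRings_of_map (maxOrderRing p r hq4 hr) rfl (twistHom p q q' δ hδ)
    (twistHom_injective hδ hδ0) fun w ↦ ⟨fun h ↦ ?_, ?_⟩
  · refine ⟨quat q' (fstPart w) (sndPart w / δ), ?_, ?_⟩
    · rw [← key, div_mul_cancel₀ _ hδ0]
      exact h
    · change quat q (fstPart w) (sndPart w / δ * δ) = w
      rw [div_mul_cancel₀ _ hδ0]
      rfl
  · rintro ⟨v, hv, rfl⟩
    exact (key (fstPart v) (sndPart v)).2 hv

end

end SupersingularOrders

end

/-! ### Ideals of `ℤ[2√-p]` -/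

noncomputable section

set_option linter.unusedSectionVars false

namespace SupersingularOrders

section

variable {p : ℕ} [Fact p.Prime]

variable (p) in
/-- The element `a + 2b√-p` of `O`. -/
def ordElt (a b : ℤ) : order p := a + b * twoSqrt p

lemma coe_ordElt (a b : ℤ) : (ordElt p a b : 𝓞 (QuadField p)) = elt p a (2 * b) := by
  simp only [ordElt, twoSqrt, elt]
  push_cast
  ring

lemma exists_eq_ordElt (x : order p) : ∃ a b : ℤ, x = ordElt p a b := by
  obtain ⟨x, hx⟩ := x
  have : ∃ a b : ℤ, x = elt p a (2 * b) := by
    induction hx using Algebra.adjoin_induction with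
    | mem x hx =>
      rw [Set.mem_singleton_iff.1 hx]
      exact ⟨0, 1, by simp [elt]⟩
    | algebraMap n => exact ⟨n, 0, by simp [elt]⟩
    | add x y _ _ hx hy =>
      obtain ⟨a, b, rfl⟩ := hx
      obtain ⟨c, d, rfl⟩ := hy
      exact ⟨a + c, b + d, by rw [elt_add]; congr 1; ring⟩
    | mul x y _ _ hx hy =>
      obtain ⟨a, b, rfl⟩ := hx
      obtain ⟨c, d, rfl⟩ := hy
      exact ⟨a * c - 4 * p * b * d, a * d + b * c, by rw [elt_mul]; congr 1 <;> ring⟩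
  obtain ⟨a, b, rfl⟩ := this
  exact ⟨a, b, Subtype.ext (coe_ordElt a b).symm⟩

lemma ordElt_mul (a b c d : ℤ) :
    ordElt p a b * ordElt p c d = ordElt p (a * c - 4 * p * b * d) (a * d + b * c) := by
  apply Subtype.ext
  rw [MulMemClass.coe_mul, coe_ordElt, coe_ordElt, coe_ordElt, elt_mul]
  congr 1 <;> ring

lemma ordElt_add (a b c d : ℤ) : ordElt p a b + ordElt p c d = ordElt p (a + c) (b + d) := by
  simp only [ordElt]; push_cast; ring

lemma natCast_eq_ordElt (n : ℕ) : (n : order p) = ordElt p n 0 := by simp [ordElt]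

lemma ordElt_inj {a b c d : ℤ} : ordElt p a b = ordElt p c d ↔ a = c ∧ b = d := by
  constructor
  · intro h
    have := congrArg (Subtype.val) h
    rw [coe_ordElt, coe_ordElt, elt_inj] at this
    exact ⟨this.1, by linarith [this.2]⟩
  · rintro ⟨rfl, rfl⟩; rfl

lemma intCast_eq_mk (n : ℤ) : (n : QuadField p) = ⟨n, 0⟩ := rfl

variable (p) in
/-- The inclusion of `O` in `K`. -/
def ordEmb : order p →+* QuadField p :=
  (algebraMap (𝓞 (QuadField p)) (QuadField p)).comp (order p).val.toRingHom

lemma ordEmb_ordElt (a b : ℤ) : ordEmb p (ordElt p a b) = ⟨a, 2 * b⟩ := by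
  change algebraMap (𝓞 (QuadField p)) (QuadField p) (ordElt p a b : 𝓞 (QuadField p)) = _
  rw [coe_ordElt, algebraMap_elt]
  ext <;> simp

lemma ordEmb_mem_rootRing (x : order p) : ordEmb p x ∈ rootRing p := by
  obtain ⟨a, b, rfl⟩ := exists_eq_ordElt x
  exact ⟨a, 2 * b, by rw [ordEmb_ordElt]; ext <;> simp⟩

lemma mem_lattice {I : Ideal (order p)} {z : QuadField p} :
    z ∈ lattice p I ↔ ∃ x ∈ I, ordEmb p x = z := by
  have : lattice p I = (I.toAddSubgroup.map (ordEmb p).toAddMonoidHom).toIntSubmodule := by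
    refine Submodule.span_eq_of_le _ ?_ ?_
    · rintro _ ⟨x, hx, rfl⟩
      exact ⟨x, hx, rfl⟩
    · rintro _ ⟨x, hx, rfl⟩
      exact Submodule.subset_span ⟨x, hx, rfl⟩
  rw [this]
  rfl

lemma mem_latticeInv {I : Ideal (order p)} {z : QuadField p} :
    z ∈ latticeInv p I ↔ ∀ x ∈ I, ∃ y : order p, z * ordEmb p x = ordEmb p y := by
  rw [latticeInv, Submodule.mem_div_iff_forall_mul_mem]
  constructor
  · intro h x hx
    obtain ⟨y, -, hy⟩ := mem_lattice.1 (h _ (mem_lattice.2 ⟨x, hx, rfl⟩))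
    exact ⟨y, hy.symm⟩
  · intro h _ hmem
    obtain ⟨x, hx, rfl⟩ := mem_lattice.1 hmem
    obtain ⟨y, hy⟩ := h x hx
    exact mem_lattice.2 ⟨y, Submodule.mem_top, hy.symm⟩

lemma one_mem_latticeInv (I : Ideal (order p)) : (1 : QuadField p) ∈ latticeInv p I :=
  mem_latticeInv.2 fun x _ ↦ ⟨x, one_mul _⟩

variable {q : ℕ} {r : ℤ}

lemma mem_conjOrder_of_mem {I : Ideal (order p)} {a x y : QuadField p} (ha : a ∈ latticeInv p I)
    (hw : quat q x y ∈ maxOrder p q r) {b : order p} (hb : b ∈ I) :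
    quat q (a * x * ordEmb p b) (a * y * star (ordEmb p b)) ∈ conjOrder p q r I := by
  rw [← embed_mul_mul_embed]
  exact Submodule.mul_mem_mul (Submodule.mul_mem_mul (Submodule.mem_map_of_mem
    (f := (embed p q).toAddMonoidHom.toIntLinearMap) ha) hw) (Submodule.mem_map_of_mem
    (f := (embed p q).toAddMonoidHom.toIntLinearMap) (mem_lattice.2 ⟨b, hb, rfl⟩))

lemma conjOrder_le {I : Ideal (order p)} {S : Submodule ℤ (QuatAlg p q)}
    (h : ∀ a ∈ latticeInv p I, ∀ x y : QuadField p, quat q x y ∈ maxOrder p q r → ∀ b ∈ I,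
      quat q (a * x * ordEmb p b) (a * y * star (ordEmb p b)) ∈ S) : conjOrder p q r I ≤ S := by
  rw [conjOrder, Submodule.mul_le]
  rintro m hm _ ⟨b, hmem, rfl⟩
  obtain ⟨b, hb, rfl⟩ := mem_lattice.1 hmem
  induction hm using Submodule.mul_induction_on' with
  | mem_mul_mem m hm n hn =>
    obtain ⟨a, ha, rfl⟩ := hm
    have := h a ha (fstPart n) (sndPart n) hn b hb
    rw [← embed_mul_mul_embed] at this
    exact this
  | add m _ n _ h1 h2 =>
    rw [add_mul]
    exact add_mem h1 h2

/-- The ideal `I` of `O` has the `ℤ`-basis `l, s + 2√-p`: both elements lie in `I`, and the elements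
`a + 2b√-p` of `I` are combinations of them. -/
structure IsDegreeOne (I : Ideal (order p)) (l : ℕ) (s : ℤ) : Prop where
  natCast_mem : (l : order p) ∈ I
  ordElt_mem : ordElt p s 1 ∈ I
  dvd : ∀ {a b : ℤ}, ordElt p a b ∈ I → (l : ℤ) ∣ a - s * b

lemma isDegreeOne_idealQConj (hr : (q : ℤ) ∣ r ^ 2 + p) :
    IsDegreeOne (idealQConj p q r) q (-(2 * r)) where
  natCast_mem := Ideal.subset_span (Or.inl rfl)
  ordElt_mem := by
    have h1 : 2 * (r : order p) - twoSqrt p ∈ idealQConj p q r := Ideal.subset_span (Or.inr rfl)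
    have h2 : ordElt p (-(2 * r)) 1 = -(2 * (r : order p) - twoSqrt p) := by
      simp only [ordElt]; push_cast; ring
    rw [h2]
    exact neg_mem h1
  dvd := by
    intro a b h
    obtain ⟨x, y, hxy⟩ := Ideal.mem_span_pair.1 h
    obtain ⟨c, d, rfl⟩ := exists_eq_ordElt x
    obtain ⟨e, f, rfl⟩ := exists_eq_ordElt y
    have h2 : 2 * (r : order p) - twoSqrt p = ordElt p (2 * r) (-1) := by
      simp only [ordElt]; push_cast; ring
    rw [h2, natCast_eq_ordElt, ordElt_mul, ordElt_mul, ordElt_add, ordElt_inj] at hxy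
    obtain ⟨h3, h4⟩ := hxy
    obtain ⟨m, hm⟩ := hr
    refine ⟨c + 2 * r * d + 4 * f * m, ?_⟩
    linear_combination -h3 - 2 * r * h4 + 4 * f * hm

/-- If `O / L` has prime order `l`, then `1` generates it, so that `-2√-p` is congruent to an
integer. -/
lemma exists_isDegreeOne_of_cardQuot {L : Ideal (order p)} {l : ℕ} (hl : l.Prime)
    (hL : Submodule.cardQuot L = l) : ∃ s : ℤ, IsDegreeOne L l s := by
  have : Fact l.Prime := ⟨hl⟩
  have hcard : Nat.card (order p ⧸ L) = l := hL
  have hne : (1 : order p) ∉ L := by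
    intro h
    rw [(Ideal.eq_top_iff_one L).2 h] at hL
    simp at hL
    exact hl.one_lt.ne hL
  have hne' : (Ideal.Quotient.mk L 1) ≠ 0 := by
    rwa [Ne, Ideal.Quotient.eq_zero_iff_mem]
  have hlmem : (l : order p) ∈ L := by
    rw [← Ideal.Quotient.eq_zero_iff_mem]
    have : Nat.card (order p ⧸ L) • (Ideal.Quotient.mk L 1) = 0 := card_nsmul_eq_zero'
    rw [hcard, nsmul_eq_mul] at this
    simpa using this
  have hint : ∀ m : ℤ, (m : order p) ∈ L → (l : ℤ) ∣ m := by
    intro m hm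
    by_contra h
    obtain ⟨a, b, hab⟩ := ((Nat.prime_iff_prime_int.1 hl).coprime_iff_not_dvd).2 h
    apply hne
    have h1 : (1 : order p) = a * l + b * m := by exact_mod_cast congrArg Int.cast hab.symm
    rw [h1]
    exact add_mem (L.mul_mem_left _ hlmem) (L.mul_mem_left _ hm)
  obtain ⟨s, hs⟩ : -Ideal.Quotient.mk L (twoSqrt p) ∈
      AddSubgroup.zmultiples (Ideal.Quotient.mk L 1) :=
    mem_zmultiples_of_prime_card hcard hne'
  have hs' : ordElt p s 1 ∈ L := by
    rw [← Ideal.Quotient.eq_zero_iff_mem, ordElt, map_add]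
    simp only [zsmul_eq_mul, map_one, mul_one] at hs
    rw [map_intCast, hs]
    simp
  refine ⟨s, hlmem, hs', fun {a b} h ↦ hint _ ?_⟩
  have : ((a - s * b : ℤ) : order p) = ordElt p a b - b * ordElt p s 1 := by
    simp only [ordElt]; push_cast; ring
  rw [this]
  exact sub_mem h (L.mul_mem_left _ hs')

namespace IsDegreeOne

variable {I : Ideal (order p)} {l : ℕ} {s : ℤ}

lemma dvd_norm (h : IsDegreeOne I l s) : (l : ℤ) ∣ s ^ 2 + 4 * p := by
  have h1 := I.mul_mem_left (ordElt p s (-1)) h.ordElt_mem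
  rw [ordElt_mul] at h1
  convert h.dvd h1 using 1
  ring

/-- The product of `I` and its conjugate is contained in `l O`. -/
lemma star_mul_eq (h : IsDegreeOne I l s) {x y : order p} (hx : x ∈ I) (hy : y ∈ I) :
    ∃ z : order p, star (ordEmb p x) * ordEmb p y = l * ordEmb p z := by
  obtain ⟨a, b, rfl⟩ := exists_eq_ordElt x
  obtain ⟨c, d, rfl⟩ := exists_eq_ordElt y
  obtain ⟨j, hj⟩ := h.dvd hx
  obtain ⟨k, hk⟩ := h.dvd hy
  obtain ⟨m, hm⟩ := h.dvd_norm
  refine ⟨ordElt p (m * b * d + s * b * k + j * s * d + l * j * k) (j * d - b * k), ?_⟩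
  have hj' : (a : ℚ) = s * b + l * j := by
    have : (a : ℚ) - s * b = l * j := by exact_mod_cast hj
    linarith
  have hk' : (c : ℚ) = s * d + l * k := by
    have : (c : ℚ) - s * d = l * k := by exact_mod_cast hk
    linarith
  have hm' : (s : ℚ) ^ 2 + 4 * p = l * m := by exact_mod_cast hm
  rw [ordEmb_ordElt, ordEmb_ordElt, ordEmb_ordElt]
  ext
  · simp [hj', hk']
    linear_combination (b * d : ℚ) * hm'
  · simp [hj', hk']
    ring

lemma star_div_mem_latticeInv (h : IsDegreeOne I l s) (hl : l ≠ 0) {x : order p} (hx : x ∈ I) :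
    star (ordEmb p x) / l ∈ latticeInv p I := by
  have hl' : (l : QuadField p) ≠ 0 := by exact_mod_cast hl
  refine mem_latticeInv.2 fun y hy ↦ ?_
  obtain ⟨z, hz⟩ := h.star_mul_eq hx hy
  refine ⟨z, ?_⟩
  rw [div_mul_eq_mul_div, hz, mul_div_cancel_left₀ _ hl']

/-- If `l` is an odd prime, then `l` is a combination of the products of an element of `I` and the
conjugate of another: the products `l²`, `2ls` and `s² + 4p` have the greatest common divisor `l`,
as `l² ∣ 4p` is impossible. -/
lemma mul_natCast_mem (h : IsDegreeOne I l s) (hl : l.Prime) (hl2 : l ≠ 2)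
    {H : AddSubgroup (QuadField p)} {z : QuadField p}
    (hz : ∀ x ∈ I, ∀ y ∈ I, z * (ordEmb p x * star (ordEmb p y)) ∈ H) : z * l ∈ H := by
  obtain ⟨t, ht⟩ := h.dvd_norm
  have hlp := Nat.prime_iff_prime_int.1 hl
  have hndvd2 : ¬ (l : ℤ) ∣ 2 := by
    intro h2
    have h2' : l ∣ 2 := by exact_mod_cast h2
    exact hl2 ((Nat.prime_dvd_prime_iff_eq hl Nat.prime_two).1 h2')
  have hcop : ∃ a b c : ℤ, a * l + b * (2 * s) + c * t = 1 := by
    by_cases hs : (l : ℤ) ∣ s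
    · have hlt : ¬ (l : ℤ) ∣ t := by
        intro hlt
        have h4 : (l : ℤ) * l ∣ 4 * p := by
          have : (4 * p : ℤ) = l * t - s * s := by rw [← ht]; ring
          rw [this]
          exact dvd_sub (mul_dvd_mul_left _ hlt) (mul_dvd_mul hs hs)
        have h5 : (l : ℤ) ∣ p := by
          have h6 : (l : ℤ) ∣ 2 * (2 * p) := by
            have : (2 * (2 * p) : ℤ) = 4 * p := by ring
            rw [this]
            exact (dvd_mul_right _ _).trans h4
          exact (hlp.dvd_or_dvd ((hlp.dvd_or_dvd h6).resolve_left hndvd2)).resolve_left hndvd2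
        have h5' : l ∣ p := by exact_mod_cast h5
        obtain rfl := (Nat.prime_dvd_prime_iff_eq hl Fact.out).1 h5'
        have h6 : (l : ℤ) ∣ 4 := (mul_dvd_mul_iff_right (a := (l : ℤ)) (by
          exact_mod_cast hl.ne_zero)).1 h4
        have h7 : (l : ℤ) ∣ 2 * 2 := h6
        exact hndvd2 ((hlp.dvd_or_dvd h7).elim id id)
      obtain ⟨a, c, hac⟩ := (hlp.coprime_iff_not_dvd).2 hlt
      exact ⟨a, 0, c, by linarith⟩
    · have : ¬ (l : ℤ) ∣ 2 * s := fun h2 ↦ (hlp.dvd_or_dvd h2).elim hndvd2 hs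
      obtain ⟨a, b, hab⟩ := (hlp.coprime_iff_not_dvd).2 this
      exact ⟨a, b, 0, by linarith⟩
  obtain ⟨a, b, c, habc⟩ := hcop
  have e1 : ordEmb p (l : order p) = l := map_natCast _ _
  have h1 := hz _ h.natCast_mem _ h.natCast_mem
  have h2 := hz _ h.natCast_mem _ h.ordElt_mem
  have h3 := hz _ h.ordElt_mem _ h.natCast_mem
  have h4 := hz _ h.ordElt_mem _ h.ordElt_mem
  have e2 : star (l : QuadField p) = l := star_natCast _
  rw [e1, e2] at h1
  rw [e1] at h2
  rw [e1, e2] at h3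
  have hsum : ordEmb p (ordElt p s 1) + star (ordEmb p (ordElt p s 1)) = (2 * s : ℤ) := by
    rw [ordEmb_ordElt, intCast_eq_mk]
    ext <;> simp
    ring
  have hprod : ordEmb p (ordElt p s 1) * star (ordEmb p (ordElt p s 1)) = (l * t : ℤ) := by
    rw [← ht, ordEmb_ordElt, intCast_eq_mk]
    ext <;> simp <;> ring
  have hmem := add_mem (add_mem (H.zsmul_mem h1 a) (H.zsmul_mem (add_mem h2 h3) b))
    (H.zsmul_mem h4 c)
  simp only [zsmul_eq_mul] at hmem
  convert hmem using 1
  have habc' : (a * l + b * (2 * s) + c * t : QuadField p) = 1 := by exact_mod_cast congrArg Int.cast habc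
  push_cast at hsum hprod
  linear_combination (-z * l) * habc' - (b * z * l) * hsum - c * z * hprod

end IsDegreeOne

end

end SupersingularOrders

end

/-! ### Conjugation by an ideal of odd prime norm -/

noncomputable section

set_option linter.unusedSectionVars false

namespace SupersingularOrders

section

variable {p : ℕ} [Fact p.Prime] {q : ℕ} {r : ℤ}

/-- The elements of `I O_K` are in `I` after multiplication by `4`. -/
lemma exists_four_mul_eq {I : Ideal (order p)} {z : 𝓞 (QuadField p)} (hz : z ∈ extend p I) :
    ∃ x ∈ I, 4 * z = (x : 𝓞 (QuadField p)) := by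
  have hfour (γ : 𝓞 (QuadField p)) : ∃ x : order p, 4 * γ = (x : 𝓞 (QuadField p)) := by
    obtain ⟨u, v, huv⟩ := two_mul_eq_elt p γ
    refine ⟨ordElt p (2 * u) v, ?_⟩
    rw [coe_ordElt, show (4 : 𝓞 (QuadField p)) = 2 * 2 by norm_num, mul_assoc, huv]
    simp only [elt]; push_cast; ring
  induction hz using Submodule.span_induction with
  | mem z hz =>
    obtain ⟨x, hx, rfl⟩ := hz
    exact ⟨4 * x, I.mul_mem_left _ hx, rfl⟩
  | zero => exact ⟨0, zero_mem _, by simp⟩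
  | add z w _ _ hz hw =>
    obtain ⟨x, hx, hx'⟩ := hz
    obtain ⟨y, hy, hy'⟩ := hw
    exact ⟨x + y, add_mem hx hy, by rw [mul_add, hx', hy']; rfl⟩
  | smul c z hzmem hz =>
    clear hz
    induction hzmem using Submodule.span_induction generalizing c with
    | mem z hz =>
      obtain ⟨x, hx, rfl⟩ := hz
      obtain ⟨y, hy⟩ := hfour c
      refine ⟨y * x, I.mul_mem_left _ hx, ?_⟩
      rw [smul_eq_mul, ← mul_assoc, hy]; rfl
    | zero => exact ⟨0, zero_mem _, by simp⟩
    | add z w _ _ hz hw =>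
      obtain ⟨x, hx, hx'⟩ := hz c
      obtain ⟨y, hy, hy'⟩ := hw c
      exact ⟨x + y, add_mem hx hy, by rw [smul_add, mul_add, hx', hy']; rfl⟩
    | smul d z _ hz =>
      obtain ⟨x, hx, hx'⟩ := hz (c * d)
      exact ⟨x, hx, by rw [← hx', smul_smul]⟩

lemma coe_mem_extend {I : Ideal (order p)} {x : order p} (hx : x ∈ I) :
    (x : 𝓞 (QuadField p)) ∈ extend p I := Ideal.mem_map_of_mem _ hx

lemma IsDegreeOne.absNorm_extend {I : Ideal (order p)} {l : ℕ} {s : ℤ} (h : IsDegreeOne I l s)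
    (hl : l.Prime) (hl2 : l ≠ 2) : Ideal.absNorm (extend p I) = l := by
  have hlp := Nat.prime_iff_prime_int.1 hl
  have hndvd : ¬ (l : ℤ) ∣ 4 := by
    intro h4
    have h5 : (l : ℤ) ∣ 2 := by
      have h6 : (l : ℤ) ∣ 2 * 2 := h4
      exact (hlp.dvd_or_dvd h6).elim id id
    have h2' : l ∣ 2 := by exact_mod_cast h5
    exact hl2 ((Nat.prime_dvd_prime_iff_eq hl Nat.prime_two).1 h2')
  have hmem : (l : 𝓞 (QuadField p)) ∈ extend p I := coe_mem_extend h.natCast_mem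
  have hdvd : Ideal.absNorm (extend p I) ∣ l ^ 2 := by
    rw [← absNorm_span_natCast (p := p)]
    exact Ideal.absNorm_dvd_absNorm_of_le ((Ideal.span_singleton_le_iff_mem _).2 hmem)
  obtain ⟨i, hi, hiq⟩ := (Nat.dvd_prime_pow hl).1 hdvd
  interval_cases i
  · exfalso
    rw [pow_zero, Ideal.absNorm_eq_one_iff, Ideal.eq_top_iff_one] at hiq
    obtain ⟨x, hx, h4⟩ := exists_four_mul_eq hiq
    have h5 : x = ordElt p 4 0 := by
      apply Subtype.ext
      rw [← h4, coe_ordElt]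
      simp [elt]
    rw [h5] at hx
    have := h.dvd hx
    rw [mul_zero, sub_zero] at this
    exact hndvd this
  · rwa [pow_one] at hiq
  · exfalso
    have h1 := eq_span_of_mem_of_absNorm_eq hmem (by exact_mod_cast hl.ne_zero)
      (by rw [absNorm_span_natCast, hiq])
    have h2 := coe_mem_extend h.ordElt_mem
    rw [h1, Ideal.mem_span_singleton, coe_ordElt] at h2
    obtain ⟨γ, hγ⟩ := h2
    obtain ⟨c, d, hcd⟩ := two_mul_eq_elt p γ
    have h3 : elt p (2 * s) 4 = elt p (l * c) (l * d) := by
      have e1 : elt p (l * c) (l * d) = l * elt p c d := by simp only [elt]; push_cast; ring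
      have e2 : elt p (2 * s) 4 = 2 * elt p s (2 * 1) := by simp only [elt]; push_cast; ring
      rw [e1, e2, ← hcd, hγ]; ring
    exact hndvd ⟨d, (elt_inj.1 h3).2⟩

lemma two_mul_mem_of_mem_maxOrder {x y : QuadField p} (hq : Odd q) (hr : (q : ℤ) ∣ r ^ 2 + p)
    (h : quat q x y ∈ maxOrder p q r) : 2 * x ∈ rootRing p ∧ 2 * y ∈ locTwo p ∧
      x - y ∈ locTwo p := by
  rw [maxOrder_eq_localLattice hq hr, quat_mem_localLattice, one_mul] at h
  refine ⟨h.1, ?_, h.2.2⟩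
  have : 2 * y = 2 * x - 2 * (x - y) := by ring
  rw [this]
  exact sub_mem (rootRing_le_locTwo h.1) (mul_mem (ofNat_mem _ 2) h.2.2)

/-- The second coefficients of `𝒪(q, r)` are integral, away from `2`, against the ideal
`[q, 2r - 2√-p]`. -/
lemma mul_ordEmb_mem_invertTwo {x y : QuadField p} (hq : Odd q) (hr : (q : ℤ) ∣ r ^ 2 + p)
    (h : quat q x y ∈ maxOrder p q r) {c : order p} (hc : c ∈ idealQConj p q r) :
    y * ordEmb p c ∈ invertTwo p := by
  rw [maxOrder_eq_localLattice hq hr, quat_mem_localLattice] at h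
  obtain ⟨a, b, rfl⟩ := exists_eq_ordElt c
  obtain ⟨j, hj⟩ := (isDegreeOne_idealQConj hr).dvd hc
  have hj' : (a : ℚ) = -(2 * r * b) + q * j := by
    have : (a : ℚ) - -(2 * r) * b = q * j := by exact_mod_cast hj
    linarith
  have h1 : ordEmb p (ordElt p a b) = j * (q : QuadField p) -
      ((2 * b : ℤ) : QuadField p) * ⟨r, -1⟩ := by
    rw [ordEmb_ordElt, intCast_eq_mk, intCast_eq_mk]
    ext
    · simp [hj']; ring
    · simp
  rw [h1, mul_sub, mul_left_comm, mul_left_comm y]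
  exact sub_mem (mul_mem (intCast_mem _ _) (h.2.1 _ (Or.inl rfl)))
    (mul_mem (intCast_mem _ _) (h.2.1 _ (Or.inr rfl)))

/-- The element `c̄β / q` lies in `𝒪(q, r)` for all `c` in `[q, 2r - 2√-p]`. -/
lemma quat_star_div_mem_maxOrder (hq : q ≠ 0) (hr : (q : ℤ) ∣ r ^ 2 + p) {c : order p}
    (hc : c ∈ idealQConj p q r) : quat q 0 (star (ordEmb p c) / (q : QuadField p)) ∈ maxOrder p q r := by
  obtain ⟨a, b, rfl⟩ := exists_eq_ordElt c
  obtain ⟨j, hj⟩ := (isDegreeOne_idealQConj hr).dvd hc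
  have hq0 : (q : ℚ) ≠ 0 := by exact_mod_cast hq
  have hj' : (a : ℚ) = -(2 * r * b) + q * j := by
    have : (a : ℚ) - -(2 * r) * b = q * j := by exact_mod_cast hj
    linarith
  refine (mem_maxOrder p).2 ⟨-j, 2 * j, 0, -(2 * b), ?_⟩
  have h1 : star (ordEmb p (ordElt p a b)) / (q : QuadField p) =
      ⟨j - 2 * b * (r / q), -(2 * b) * (1 / q)⟩ := by
    rw [div_eq_iff (by exact_mod_cast hq), ordEmb_ordElt]
    ext
    · simp [hj']; field_simp; ring
    · simp; field_simp
  rw [h1]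
  ext <;> simp [quat]
  ring

variable (q r) in
/-- The group of the `z` such that `2 ^ k zβ` lies in `I⁻¹ 𝒪(q, r) I` for some `k`. -/
def sndSupport (I : Ideal (order p)) : AddSubgroup (QuadField p) where
  carrier := {z | ∃ k : ℕ, quat q 0 (2 ^ k * z) ∈ conjOrder p q r I}
  zero_mem' := ⟨0, by rw [mul_zero]; exact zero_mem _⟩
  add_mem' := by
    rintro x y ⟨n, hx⟩ ⟨m, hy⟩
    refine ⟨n + m, ?_⟩
    have : quat q 0 (2 ^ (n + m) * (x + y)) = (2 ^ m : ℤ) • quat q 0 (2 ^ n * x) +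
        (2 ^ n : ℤ) • quat q 0 (2 ^ m * y) := by
      rw [intCast_smul_quat, intCast_smul_quat, quat_add]
      push_cast
      congr 1 <;> ring
    rw [this]
    exact add_mem (Submodule.smul_mem _ _ hx) (Submodule.smul_mem _ _ hy)
  neg_mem' := by
    rintro x ⟨n, hx⟩
    refine ⟨n, ?_⟩
    have : quat q 0 (2 ^ n * -x) = (-1 : ℤ) • quat q 0 (2 ^ n * x) := by
      rw [intCast_smul_quat]
      push_cast
      congr 1 <;> ring
    rw [this]
    exact Submodule.smul_mem _ _ hx

lemma mul_mem_latticeInv {I : Ideal (order p)} {a : QuadField p} (ha : a ∈ latticeInv p I)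
    (x : order p) : ordEmb p x * a ∈ latticeInv p I := by
  refine mem_latticeInv.2 fun y hy ↦ ?_
  obtain ⟨z, hz⟩ := mem_latticeInv.1 ha y hy
  exact ⟨x * z, by rw [mul_assoc, hz, map_mul]⟩

lemma exists_pow_mul_eq_ordEmb {z : QuadField p} (hz : z ∈ invertTwo p) :
    ∃ k : ℕ, ∃ x : order p, 2 ^ k * z = ordEmb p x := by
  obtain ⟨k, a, b, h⟩ := hz
  refine ⟨k + 1, ordElt p (2 * a) b, ?_⟩
  rw [pow_succ', mul_assoc, h, ordEmb_ordElt, two_mul]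
  ext
  · simp; ring
  · simp; ring

lemma mul_mem_sndSupport {I : Ideal (order p)} {z a y : QuadField p} (hz : z ∈ invertTwo p)
    (ha : a ∈ latticeInv p I) {b : order p} (hb : b ∈ I) (hy : quat q 0 y ∈ maxOrder p q r) :
    z * (a * y * star (ordEmb p b)) ∈ sndSupport q r I := by
  obtain ⟨k, x, hx⟩ := exists_pow_mul_eq_ordEmb hz
  refine ⟨k, ?_⟩
  have := mem_conjOrder_of_mem (mul_mem_latticeInv ha x) hy hb
  rw [← hx] at this
  convert this using 1
  congr 1 <;> ring

/-- The lattice `𝔩⁻¹ 𝒪(q, r) 𝔩` for an ideal `𝔩` of odd prime norm `l`: the condition at the odd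
primes is integrality against `l⁻¹ [q, 2r - 2√-p] 𝔩²`. -/
theorem conjOrder_eq_localLattice (hq : q.Prime) (hq2 : q ≠ 2) (hr : (q : ℤ) ∣ r ^ 2 + p)
    {L : Ideal (order p)} {l : ℕ} {s : ℤ} (hL : IsDegreeOne L l s) (hl : l.Prime) (hl2 : l ≠ 2) :
    conjOrder p q r L = localLattice q {d | ∃ z ∈ extend p (idealQConj p q r * L ^ 2),
      d = algebraMap (𝓞 (QuadField p)) (QuadField p) z / (l : QuadField p)} 1 := by
  have hqo : Odd q := hq.odd_of_ne_two hq2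
  have hlo : Odd l := hl.odd_of_ne_two hl2
  have hl0 : (l : QuadField p) ≠ 0 := by exact_mod_cast hl.ne_zero
  have hq0 : (q : QuadField p) ≠ 0 := by exact_mod_cast hq.ne_zero
  have hloc {a : QuadField p} (ha : a ∈ latticeInv p L) : a ∈ locTwo p := by
    obtain ⟨y, hy⟩ := mem_latticeInv.1 ha _ hL.natCast_mem
    refine ⟨l, by exact_mod_cast hlo, ?_⟩
    rw [map_natCast, mul_comm] at hy
    rw [Int.cast_natCast, hy]
    exact ordEmb_mem_rootRing y
  refine le_antisymm (conjOrder_le fun a ha x y hw b hb ↦ ?_) fun w hw ↦ ?_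
  · obtain ⟨hx, hy, hxy⟩ := two_mul_mem_of_mem_maxOrder hqo hr hw
    obtain ⟨o, ho⟩ := mem_latticeInv.1 ha b hb
    refine quat_mem_localLattice.2 ⟨?_, ?_, ?_⟩
    · have : 2 * (a * x * ordEmb p b) = (a * ordEmb p b) * (2 * x) := by ring
      rw [this, ho]
      exact mul_mem (ordEmb_mem_rootRing o) hx
    · rintro _ ⟨z, hz, rfl⟩
      obtain ⟨t, ht, hzt⟩ := exists_four_mul_eq hz
      have key : (a * y * star (ordEmb p b)) * (ordEmb p t / l) ∈ invertTwo p := by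
        clear hzt hz
        induction ht using Submodule.mul_induction_on' with
        | mem_mul_mem c hc t ht =>
          rw [pow_two] at ht
          induction ht using Submodule.mul_induction_on' with
          | mem_mul_mem m hm n hn =>
            obtain ⟨o₁, ho₁⟩ := mem_latticeInv.1 ha m hm
            obtain ⟨o₂, ho₂⟩ := hL.star_mul_eq hb hn
            have e : (a * y * star (ordEmb p b)) * (ordEmb p (c * (m * n)) / l) =
                (y * ordEmb p c) * (a * ordEmb p m) *
                  ((star (ordEmb p b) * ordEmb p n) / l) := by
              rw [map_mul, map_mul]; ring
            rw [e, ho₁, ho₂, mul_div_cancel_left₀ _ hl0]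
            exact mul_mem (mul_mem (mul_ordEmb_mem_invertTwo hqo hr hw hc)
              (rootRing_le_invertTwo (ordEmb_mem_rootRing _)))
              (rootRing_le_invertTwo (ordEmb_mem_rootRing _))
          | add m _ n _ h1 h2 =>
            rw [mul_add, map_add, add_div, mul_add]
            exact add_mem h1 h2
        | add m _ n _ h1 h2 =>
          rw [map_add, add_div, mul_add]
          exact add_mem h1 h2
      refine mem_invertTwo_of_two_mul (mem_invertTwo_of_two_mul ?_)
      have e : ordEmb p t = 4 * algebraMap (𝓞 (QuadField p)) (QuadField p) z := by
        change algebraMap (𝓞 (QuadField p)) (QuadField p) (t : 𝓞 (QuadField p)) = _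
        rw [← hzt, map_mul, map_ofNat]
      rw [e] at key
      convert key using 1
      ring
    · obtain ⟨m, hm, hbm⟩ : ∃ m ∈ rootRing p, ordEmb p b - star (ordEmb p b) = 2 * m := by
        obtain ⟨c, d, rfl⟩ := exists_eq_ordElt b
        refine ⟨⟨(0 : ℤ), (2 * d : ℤ)⟩, ⟨0, 2 * d, rfl⟩, ?_⟩
        rw [ordEmb_ordElt, two_mul (⟨_, _⟩ : QuadField p)]
        ext <;> simp
      have e : 1 * (a * x * ordEmb p b) - a * y * star (ordEmb p b) =
          (a * ordEmb p b) * (x - y) + a * (2 * y) * m := by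
        linear_combination a * y * hbm
      rw [e, ho]
      exact add_mem (mul_mem (rootRing_le_locTwo (ordEmb_mem_rootRing o)) hxy)
        (mul_mem (mul_mem (hloc ha) hy) (rootRing_le_locTwo hm))
  · obtain ⟨hx, hD, hxy⟩ := hw
    set x := fstPart w with hxdef
    set y := sndPart w with hydef
    rw [one_mul] at hxy
    have hw' : w = quat q x y := rfl
    -- an odd multiple lies in `l 𝒪(q, r)`
    have hodd : (l * (q * l) : ℤ) • w ∈ conjOrder p q r L := by
      have h1 : quat q (((q * l : ℤ) : QuadField p) * x) (((q * l : ℤ) : QuadField p) * y) ∈ maxOrder p q r := by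
        rw [maxOrder_eq_localLattice hqo hr, quat_mem_localLattice]
        refine ⟨?_, fun d hd ↦ ?_, ?_⟩
        · rw [mul_left_comm]
          exact mul_mem (intCast_mem _ _) hx
        · have hd' : d ∈ rootRing p := by
            rcases hd with rfl | rfl
            · exact natCast_mem _ _
            · exact ⟨r, -1, by simp⟩
          have hmem : ((q * (l * l) : order p) : 𝓞 (QuadField p)) ∈
              extend p (idealQConj p q r * L ^ 2) := by
            refine coe_mem_extend (Ideal.mul_mem_mul (isDegreeOne_idealQConj hr).natCast_mem ?_)
            rw [pow_two]
            exact Ideal.mul_mem_mul hL.natCast_mem hL.natCast_mem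
          have h2 := hD _ ⟨_, hmem, rfl⟩
          have e : algebraMap (𝓞 (QuadField p)) (QuadField p)
              ((q * (l * l) : order p) : 𝓞 (QuadField p)) = q * (l * l) := by
            change ordEmb p (q * (l * l)) = _
            rw [map_mul, map_mul, map_natCast, map_natCast]
          rw [e] at h2
          have e2 : ((q * l : ℤ) : QuadField p) * y * d =
              y * ((q : QuadField p) * (l * l) / l) * d := by
            push_cast
            field_simp
          rw [e2]
          exact mul_mem h2 (rootRing_le_invertTwo hd')
        · rw [one_mul, ← mul_sub]
          exact mul_mem (intCast_mem _ _) hxy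
      have h2 := mem_conjOrder_of_mem (one_mem_latticeInv L) h1 hL.natCast_mem
      rw [hw', intCast_smul_quat]
      convert h2 using 1
      rw [map_natCast]
      have : star (l : QuadField p) = l := star_natCast _
      rw [this]
      push_cast
      congr 1 <;> ring
    -- multiples by powers of two
    have hfst : quat q (4 * x) 0 ∈ conjOrder p q r L := by
      obtain ⟨a, b, hab⟩ := hx
      have hab' : 4 * x = ordEmb p (ordElt p (2 * a) b) := by
        have : 4 * x = 2 * (2 * x) := by ring
        rw [this, hab, ordEmb_ordElt, two_mul]
        ext <;> simp <;> ring
      let H : AddSubgroup (QuadField p) :=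
        { carrier := {z | quat q z 0 ∈ conjOrder p q r L}
          zero_mem' := (conjOrder p q r L).zero_mem
          add_mem' := fun {y z} hy hz ↦ by
            have : quat q (y + z) 0 = quat q y 0 + quat q z 0 := by rw [quat_add, add_zero]
            exact (congrArg (· ∈ conjOrder p q r L) this).mpr (add_mem hy hz)
          neg_mem' := fun {y} hy ↦ by
            have : quat q (-y) 0 = (-1 : ℤ) • quat q y 0 := by
              rw [intCast_smul_quat]; simp
            exact (congrArg (· ∈ conjOrder p q r L) this).mpr (Submodule.smul_mem _ _ hy) }
      have h1 : (4 * x) / l * l ∈ H := by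
        refine hL.mul_natCast_mem hl hl2 fun m hm n hn ↦ ?_
        have h2 := mem_conjOrder_of_mem (mul_mem_latticeInv
          (hL.star_div_mem_latticeInv hl.ne_zero hn) (ordElt p (2 * a) b)) (x := 1) (y := 0)
          (one_mem_maxOrder r : (1 : QuatAlg p q) ∈ maxOrder p q r) hm
        rw [← hab'] at h2
        have h3 : quat q (4 * x / (l : QuadField p) * (ordEmb p m * star (ordEmb p n))) 0 ∈
            conjOrder p q r L := by
          convert h2 using 1
          congr 1 <;> ring
        exact h3
      rw [div_mul_cancel₀ _ hl0] at h1
      exact h1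
    have hsnd : y ∈ sndSupport q r L := by
      have h1 : y / l / l / q * q * l * l ∈ sndSupport q r L := by
        refine hL.mul_natCast_mem hl hl2 fun m hm m' hm' ↦ ?_
        have e : y / l / l / q * q * l * (ordEmb p m * star (ordEmb p m')) =
          (y / l / l / q * q * (ordEmb p m * star (ordEmb p m'))) * l := by ring
        rw [e]
        refine hL.mul_natCast_mem hl hl2 fun n hn n' hn' ↦ ?_
        have e : y / l / l / q * q * (ordEmb p m * star (ordEmb p m')) *
            (ordEmb p n * star (ordEmb p n')) = (y / l / l / q *
            (ordEmb p m * star (ordEmb p m')) * (ordEmb p n * star (ordEmb p n'))) * q := by ring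
        rw [e]
        refine (isDegreeOne_idealQConj hr).mul_natCast_mem hq hq2 fun c hc c' hc' ↦ ?_
        have hmem : ((c * (m * n) : order p) : 𝓞 (QuadField p)) ∈
            extend p (idealQConj p q r * L ^ 2) := by
          refine coe_mem_extend (Ideal.mul_mem_mul hc ?_)
          rw [pow_two]
          exact Ideal.mul_mem_mul hm hn
        have h2 := mul_mem_sndSupport (hD _ ⟨_, hmem, rfl⟩)
          (hL.star_div_mem_latticeInv hl.ne_zero hm') hn'
          (quat_star_div_mem_maxOrder hq.ne_zero hr hc')
        have e2 : algebraMap (𝓞 (QuadField p)) (QuadField p)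
            ((c * (m * n) : order p) : 𝓞 (QuadField p)) =
            ordEmb p c * (ordEmb p m * ordEmb p n) := by
          change ordEmb p (c * (m * n)) = _
          rw [map_mul, map_mul]
        rw [e2] at h2
        convert h2 using 1
        ring
      have e : y / l / l / q * q * l * l = y := by field_simp
      rwa [e] at h1
    obtain ⟨k, hk⟩ := hsnd
    have hpow : (2 ^ (k + 2) : ℤ) • w ∈ conjOrder p q r L := by
      have e : (2 ^ (k + 2) : ℤ) • w =
          (2 ^ k : ℤ) • quat q (4 * x) 0 + (4 : ℤ) • quat q 0 (2 ^ k * y) := by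
        rw [hw', intCast_smul_quat, intCast_smul_quat, intCast_smul_quat, quat_add]
        push_cast
        congr 1 <;> ring
      rw [e]
      exact add_mem (Submodule.smul_mem _ _ hfst) (Submodule.smul_mem _ _ hk)
    refine mem_of_odd_smul_mem_of_pow_smul_mem ?_ hodd hpow
    have hl' : Odd (l : ℤ) := by exact_mod_cast hlo
    have hq' : Odd (q : ℤ) := by exact_mod_cast hqo
    exact hl'.mul (hq'.mul hl')

end

end SupersingularOrders

end

/-! ### Conjugation by `[8, 2 + 2√-p]` -/

noncomputable section

set_option linter.unusedSectionVars false

namespace SupersingularOrders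

section

variable {p : ℕ} [Fact p.Prime] {q : ℕ} {r : ℤ}

lemma ordElt_mem_idealTwo_iff (hp : Odd p) {a b : ℤ} :
    ordElt p a b ∈ idealTwo p ↔ (8 : ℤ) ∣ a - 2 * b := by
  have h8 : (8 : order p) = ordElt p 8 0 := by simp [ordElt]
  have h2 : (2 : order p) + twoSqrt p = ordElt p 2 1 := by simp [ordElt]
  rw [idealTwo, h8, h2, Ideal.mem_span_pair]
  constructor
  · rintro ⟨x, y, hxy⟩
    obtain ⟨c, d, rfl⟩ := exists_eq_ordElt x
    obtain ⟨e, f, rfl⟩ := exists_eq_ordElt y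
    rw [ordElt_mul, ordElt_mul, ordElt_add, ordElt_inj] at hxy
    obtain ⟨k, hk⟩ := hp
    obtain ⟨h3, h4⟩ := hxy
    have hk' : (p : ℤ) = 2 * k + 1 := by exact_mod_cast hk
    refine ⟨c - 2 * d - f * (k + 1), ?_⟩
    linear_combination -h3 + 2 * h4 - 4 * f * hk'
  · rintro ⟨j, hj⟩
    refine ⟨ordElt p j 0, ordElt p b 0, ?_⟩
    rw [ordElt_mul, ordElt_mul, ordElt_add, ordElt_inj]
    constructor
    · linear_combination -hj
    · ring

lemma ordEmb_eight : ordEmb p (ordElt p 8 0) = 8 := by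
  have : ordElt p 8 0 = 8 := by simp [ordElt]
  rw [this, map_ofNat]

lemma eight_mul_eq (x : QuadField p) : 8 * x = ⟨8 * x.re, 8 * x.im⟩ := by
  have : (8 : QuadField p) = ⟨8, 0⟩ := by
    have := intCast_eq_mk (p := p) 8
    exact_mod_cast this
  rw [this]
  ext <;> simp

/-- The lattice inverse to `[8, 2 + 2√-p]` is `[1, (1 - √-p) / 4]`. -/
lemma exists_eq_of_mem_latticeInv_idealTwo (hp : Odd p) {a : QuadField p}
    (ha : a ∈ latticeInv p (idealTwo p)) : ∃ v t : ℤ, a = ⟨v - t / 4, t / 4⟩ := by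
  rw [mem_latticeInv] at ha
  obtain ⟨y, hy⟩ := ha (ordElt p 8 0) ((ordElt_mem_idealTwo_iff hp).2 (by norm_num))
  obtain ⟨z, hz⟩ := ha (ordElt p 2 1) ((ordElt_mem_idealTwo_iff hp).2 (by norm_num))
  obtain ⟨s, t, rfl⟩ := exists_eq_ordElt y
  obtain ⟨u, v, rfl⟩ := exists_eq_ordElt z
  rw [ordEmb_eight, mul_comm, eight_mul_eq, ordEmb_ordElt] at hy
  rw [ordEmb_ordElt, ordEmb_ordElt] at hz
  have h1 := congrArg QuadraticAlgebra.re hy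
  have h2 := congrArg QuadraticAlgebra.im hy
  have h3 := congrArg QuadraticAlgebra.im hz
  simp at h1 h2 h3
  refine ⟨v, t, ?_⟩
  ext
  · simp only; linarith
  · simp only; linarith

/-- The ideal `[8, 2 + 2√-p]` corresponds to the form `(8, 4, (1 + p) / 2)`, which is primitive as
`(1 + p) / 2` is odd. -/
theorem isProperIdeal_idealTwo (hp : p % 4 = 1) : IsProperIdeal p (idealTwo p) := by
  have hpo : Odd p := Nat.odd_iff.2 (by omega)
  obtain ⟨m, hm⟩ : ∃ m : ℤ, (p : ℤ) = 4 * m + 1 := ⟨p / 4, by omega⟩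
  refine le_antisymm (fun x hx ↦ ?_) (fun x hx ↦ ?_)
  · rw [Submodule.mem_div_iff_forall_mul_mem] at hx
    obtain ⟨y, hymem, hy⟩ := mem_lattice.1 (hx _ (mem_lattice.2 ⟨ordElt p 8 0,
      (ordElt_mem_idealTwo_iff hpo).2 (by norm_num), rfl⟩))
    obtain ⟨z, hzmem, hz⟩ := mem_lattice.1 (hx _ (mem_lattice.2 ⟨ordElt p 2 1,
      (ordElt_mem_idealTwo_iff hpo).2 (by norm_num), rfl⟩))
    obtain ⟨s, t, rfl⟩ := exists_eq_ordElt y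
    obtain ⟨u, v, rfl⟩ := exists_eq_ordElt z
    obtain ⟨w, hw⟩ := (ordElt_mem_idealTwo_iff hpo).1 hzmem
    rw [ordEmb_eight, mul_comm, eight_mul_eq, ordEmb_ordElt] at hy
    rw [ordEmb_ordElt, ordEmb_ordElt] at hz
    have h1 := congrArg QuadraticAlgebra.re hy
    have h2 := congrArg QuadraticAlgebra.im hy
    have h3 := congrArg QuadraticAlgebra.im hz
    have h4 := congrArg QuadraticAlgebra.re hz
    simp at h1 h2 h3 h4
    have hm' : (p : ℚ) = 4 * m + 1 := by exact_mod_cast hm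
    have hw' : (u : ℚ) - 2 * v = 8 * w := by exact_mod_cast hw
    have h5 : (2 * m + 1) * t = -(8 * w) := by
      have : ((2 * m + 1 : ℚ)) * t = -(8 * w) := by
        have e1 : x.re = s / 8 := by linarith
        have e2 : x.im = t / 4 := by linarith
        rw [e1, e2] at h3 h4
        rw [hm'] at h4
        linear_combination -hw' + h4 - h3
      exact_mod_cast this
    obtain ⟨t', rfl⟩ : (8 : ℤ) ∣ t := by
      have hcop : IsCoprime (8 : ℤ) (2 * m + 1) :=
        IsCoprime.pow_left (m := 3) (x := (2 : ℤ)) ⟨-m, 1, by ring⟩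
      exact hcop.dvd_of_dvd_mul_left ⟨-w, by rw [h5]; ring⟩
    refine mem_lattice.2 ⟨ordElt p (v - 2 * t') t', Submodule.mem_top, ?_⟩
    rw [ordEmb_ordElt]
    push_cast at h1 h2
    ext
    · simp only; push_cast; linarith
    · simp only; linarith
  · obtain ⟨y, -, rfl⟩ := mem_lattice.1 hx
    rw [Submodule.mem_div_iff_forall_mul_mem]
    intro z hz
    obtain ⟨z, hz', rfl⟩ := mem_lattice.1 hz
    exact mem_lattice.2 ⟨y * z, Ideal.mul_mem_left _ _ hz', map_mul _ _ _⟩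

/-- The ideal `[p, 2√-p]` of `O`. -/
def idealRamified (p : ℕ) [Fact p.Prime] : Ideal (order p) :=
  Ideal.span {(p : order p), twoSqrt p}

/-- The square of `[8, 2 + 2√-p]` is `[16, 8√-p]`, which is equivalent to `[p, 2√-p]`. -/
lemma span_twoSqrt_mul_idealTwo_sq (hp : p % 4 = 1) :
    Ideal.span {twoSqrt p} * idealTwo p ^ 2 = Ideal.span {(16 : order p)} * idealRamified p := by
  obtain ⟨m, hm⟩ : ∃ m : ℕ, p = 4 * m + 1 := ⟨p / 4, by omega⟩
  have ht : twoSqrt p * twoSqrt p = -(4 * (p : order p)) := by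
    apply Subtype.ext
    change (2 * sqrtNeg p) * (2 * sqrtNeg p) = -(4 * (p : 𝓞 (QuadField p)))
    linear_combination 4 * sqrtNeg_mul_self p
  have hm' : (p : order p) = 4 * m + 1 := by
    have : ((p : ℕ) : order p) = ((4 * m + 1 : ℕ) : order p) := congrArg _ hm
    rw [this]; push_cast; ring
  rw [idealTwo, idealRamified, pow_two, Ideal.span_pair_mul_span_pair]
  simp only [Ideal.span_mul_span', Set.singleton_mul, Set.image_insert_eq, Set.image_singleton]
  set t := twoSqrt p
  apply le_antisymm
  · rw [Ideal.span_le]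
    rintro _ (rfl | rfl | rfl | rfl) <;> refine Ideal.mem_span_pair.2 ?_
    · exact ⟨0, 4, by ring⟩
    · exact ⟨-2, 1, by linear_combination (-8) * ht⟩
    · exact ⟨-2, 1, by linear_combination (-8) * ht⟩
    · exact ⟨-1, -m, by linear_combination -(4 + t) * ht + 4 * t * hm'⟩
  · rw [Ideal.span_le]
    set J := Ideal.span {t * (8 * 8), t * (8 * (2 + t)), t * ((2 + t) * 8),
      t * ((2 + t) * (2 + t))}
    have h1 : t * (8 * 8) ∈ J := Ideal.subset_span (by simp)
    have h2 : t * (8 * (2 + t)) ∈ J := Ideal.subset_span (by simp)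
    have h3 : t * ((2 + t) * (2 + t)) ∈ J := Ideal.subset_span (by simp)
    have h4 : 16 * t ∈ J := by
      have e : 16 * t = (1 + 2 * m) * (t * (8 * (2 + t)) - 2 * (t * ((2 + t) * (2 + t)))) -
          (m + m ^ 2) * (t * (8 * 8)) := by
        linear_combination (2 * (1 + 2 * m) * t) * ht - 8 * t * (1 + 2 * m) * hm'
      rw [e]
      exact sub_mem (J.mul_mem_left _ (sub_mem h2 (J.mul_mem_left _ h3))) (J.mul_mem_left _ h1)
    rintro _ (rfl | rfl)
    · have e : 16 * (p : order p) = -(t * ((2 + t) * (2 + t))) - m * (16 * t) := by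
        linear_combination (4 + t) * ht - 4 * t * hm'
      rw [e]
      exact sub_mem (neg_mem h3) (J.mul_mem_left _ h4)
    · exact h4

lemma extend_idealRamified (hp : Odd p) : extend p (idealRamified p) = Ideal.span {sqrtNeg p} := by
  obtain ⟨k, hk⟩ := hp
  have hs := sqrtNeg_mul_self p
  have hk' : (p : 𝓞 (QuadField p)) = 2 * k + 1 := by
    have : ((p : ℕ) : 𝓞 (QuadField p)) = ((2 * k + 1 : ℕ) : 𝓞 (QuadField p)) := congrArg _ hk
    rw [this]; push_cast; ring
  rw [extend, idealRamified, Ideal.map_span, Set.image_pair]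
  change Ideal.span {((p : order p) : 𝓞 (QuadField p)), 2 * sqrtNeg p} = _
  have hc : ((p : order p) : 𝓞 (QuadField p)) = p := rfl
  rw [hc]
  apply le_antisymm
  · rw [Ideal.span_le]
    rintro _ (rfl | rfl)
    · exact Ideal.mem_span_singleton.2 ⟨-sqrtNeg p, by linear_combination hs⟩
    · exact Ideal.mem_span_singleton.2 ⟨2, mul_comm _ _⟩
  · rw [Ideal.span_singleton_le_iff_mem, Ideal.mem_span_pair]
    exact ⟨sqrtNeg p, -k, by rw [hk']; ring⟩

/-- The lattice `𝔩⁻¹ 𝒪(q, r) 𝔩` for `𝔩 = [8, 2 + 2√-p]`: only the condition at `2` changes. -/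
theorem conjOrder_idealTwo_eq_localLattice (hp : p % 4 = 1) (hq : Odd q)
    (hr : (q : ℤ) ∣ r ^ 2 + p) :
    conjOrder p q r (idealTwo p) = localLattice q {d | ∃ z ∈ extend p (idealQConj p q r),
      d = algebraMap (𝓞 (QuadField p)) (QuadField p) z} ⟨0, 1⟩ := by
  have hpo : Odd p := Nat.odd_iff.2 (by omega)
  obtain ⟨m, hm⟩ : ∃ m : ℤ, (p : ℤ) = 4 * m + 1 := ⟨p / 4, by omega⟩
  have hm' : (p : ℚ) = 4 * m + 1 := by exact_mod_cast hm
  have h8 : ordElt p 8 0 ∈ idealTwo p := (ordElt_mem_idealTwo_iff hpo).2 (by norm_num)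
  refine le_antisymm (conjOrder_le fun a ha x y hw b hb ↦ ?_) fun w hw ↦ ?_
  · obtain ⟨hx, hy, hxy⟩ := two_mul_mem_of_mem_maxOrder hq hr hw
    obtain ⟨o, ho⟩ := mem_latticeInv.1 ha b hb
    refine quat_mem_localLattice.2 ⟨?_, ?_, ?_⟩
    · have : 2 * (a * x * ordEmb p b) = (a * ordEmb p b) * (2 * x) := by ring
      rw [this, ho]
      exact mul_mem (ordEmb_mem_rootRing o) hx
    · rintro _ ⟨z, hz, rfl⟩
      obtain ⟨t, ht, hzt⟩ := exists_four_mul_eq hz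
      have ha' : a ∈ invertTwo p := by
        obtain ⟨o', ho'⟩ := mem_latticeInv.1 ha _ h8
        refine ⟨3, ?_⟩
        rw [ordEmb_eight] at ho'
        have : (2 ^ 3 : QuadField p) * a = a * 8 := by ring
        rw [this, ho']
        exact ordEmb_mem_rootRing o'
      have hb' : star (ordEmb p b) ∈ invertTwo p := by
        obtain ⟨c, d, rfl⟩ := exists_eq_ordElt b
        refine rootRing_le_invertTwo ⟨c, -(2 * d), ?_⟩
        rw [ordEmb_ordElt]
        ext <;> simp
      have e : ordEmb p t = 4 * algebraMap (𝓞 (QuadField p)) (QuadField p) z := by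
        change algebraMap (𝓞 (QuadField p)) (QuadField p) (t : 𝓞 (QuadField p)) = _
        rw [← hzt, map_mul, map_ofNat]
      have key := mul_mem (mul_mem (mul_ordEmb_mem_invertTwo hq hr hw ht) ha') hb'
      refine mem_invertTwo_of_two_mul (mem_invertTwo_of_two_mul ?_)
      rw [e] at key
      convert key using 1
      ring
    · obtain ⟨v, t, rfl⟩ := exists_eq_of_mem_latticeInv_idealTwo hpo ha
      obtain ⟨c, d, rfl⟩ := exists_eq_ordElt b
      obtain ⟨j, hj⟩ := (ordElt_mem_idealTwo_iff hpo).1 hb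
      have hj' : (c : ℚ) = 2 * d + 8 * j := by
        have : (c : ℚ) - 2 * d = 8 * j := by exact_mod_cast hj
        linarith
      set a : QuadField p := ⟨v - t / 4, t / 4⟩ with hadef
      have h1 : a * star (ordEmb p (ordElt p c d)) ∈ rootRing p := by
        refine ⟨v * c - t * (-(2 * m * d) + 2 * j), -(2 * d * v) + t * (d + 2 * j), ?_⟩
        rw [ordEmb_ordElt]
        ext
        · simp [hadef, hj', hm']; ring
        · simp [hadef, hj', hm']; ring
      obtain ⟨k, hk, hk2⟩ : ∃ k ∈ rootRing p, a * ((⟨0, 1⟩ : QuadField p) * ordEmb p (ordElt p c d) -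
          star (ordEmb p (ordElt p c d))) = 2 * k := by
        refine ⟨⟨(-(2 * v * (d * (2 * m + 1) + 2 * j)) - t * (m * d + 4 * m * j) : ℤ),
          (2 * v * (d + 2 * j) - t * (d * (m + 1) + 2 * j) : ℤ)⟩, ⟨_, _, rfl⟩, ?_⟩
        rw [ordEmb_ordElt, two_mul (⟨_, _⟩ : QuadField p)]
        ext
        · simp [hadef, hj', hm']; ring
        · simp [hadef, hj', hm']; ring
      have e : (⟨0, 1⟩ : QuadField p) * (a * x * ordEmb p (ordElt p c d)) -
          a * y * star (ordEmb p (ordElt p c d)) =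
          (a * star (ordEmb p (ordElt p c d))) * (x - y) + (2 * x) * k := by
        linear_combination x * hk2
      rw [e]
      exact add_mem (mul_mem (rootRing_le_locTwo h1) hxy)
        (mul_mem (rootRing_le_locTwo hx) (rootRing_le_locTwo hk))
  · obtain ⟨hx, hD, hxy⟩ := hw
    set x := fstPart w with hxdef
    set y := sndPart w with hydef
    have hw' : w = quat q x y := rfl
    have hpow : (2 ^ 4 : ℤ) • w ∈ conjOrder p q r (idealTwo p) := by
      have h1 : quat q (2 * x) (2 * y) ∈ maxOrder p q r := by
        rw [maxOrder_eq_localLattice hq hr, quat_mem_localLattice]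
        refine ⟨mul_mem (ofNat_mem _ 2) hx, ?_, ?_⟩
        · rintro _ (rfl | rfl)
          · have := hD _ ⟨_, coe_mem_extend (isDegreeOne_idealQConj hr).natCast_mem, rfl⟩
            rw [mul_assoc]
            exact mul_mem (ofNat_mem _ 2) this
          · have := hD _ ⟨_, coe_mem_extend (isDegreeOne_idealQConj hr).ordElt_mem, rfl⟩
            have e : algebraMap (𝓞 (QuadField p)) (QuadField p)
                (ordElt p (-(2 * r)) 1 : 𝓞 (QuadField p)) = -(2 * ⟨r, -1⟩) := by
              change ordEmb p (ordElt p (-(2 * r)) 1) = _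
              rw [ordEmb_ordElt, two_mul (⟨_, _⟩ : QuadField p)]
              ext
              · simp; ring
              · simp; ring
            rw [e] at this
            have e2 : 2 * y * (⟨r, -1⟩ : QuadField p) = -(y * -(2 * ⟨r, -1⟩)) := by ring
            rw [e2]
            exact neg_mem this
        · have e : 1 * (2 * x) - 2 * y = (2 * x) - (⟨0, 1⟩ : QuadField p) * (2 * x) +
              2 * ((⟨0, 1⟩ : QuadField p) * x - y) := by ring
          rw [e]
          exact add_mem (sub_mem (rootRing_le_locTwo hx) (mul_mem
            (rootRing_le_locTwo ⟨0, 1, by simp⟩) (rootRing_le_locTwo hx)))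
            (mul_mem (ofNat_mem _ 2) hxy)
      have h2 := mem_conjOrder_of_mem (one_mem_latticeInv (idealTwo p)) h1 h8
      rw [hw', intCast_smul_quat]
      convert h2 using 1
      rw [ordEmb_eight]
      have : star (8 : QuadField p) = 8 := star_ofNat _
      rw [this]
      push_cast
      congr 1 <;> ring
    -- the elements of `𝔩⁻¹` and `𝔩` whose product is the odd integer `(1 + p) / 2`
    set a₀ : QuadField p := ⟨1 / 4, -1 / 4⟩ with ha₀
    have ha₀mem : a₀ ∈ latticeInv p (idealTwo p) := by
      refine mem_latticeInv.2 fun b hb ↦ ?_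
      obtain ⟨c, d, rfl⟩ := exists_eq_ordElt b
      obtain ⟨j, hj⟩ := (ordElt_mem_idealTwo_iff hpo).1 hb
      have hj' : (c : ℚ) = 2 * d + 8 * j := by
        have : (c : ℚ) - 2 * d = 8 * j := by exact_mod_cast hj
        linarith
      refine ⟨ordElt p (d * (2 * m + 1) + 2 * j) (-j), ?_⟩
      rw [ordEmb_ordElt, ordEmb_ordElt]
      ext
      · simp [ha₀, hj', hm']; ring
      · simp [ha₀, hj', hm']; ring
    have hb₀mem : ordElt p 2 1 ∈ idealTwo p := (ordElt_mem_idealTwo_iff hpo).2 (by norm_num)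
    have hab : a₀ * ordEmb p (ordElt p 2 1) = ((2 * m + 1 : ℤ) : QuadField p) := by
      rw [ordEmb_ordElt, intCast_eq_mk]
      ext
      · simp [ha₀, hm']; ring
      · simp [ha₀]; ring
    have hab' : a₀ * star (ordEmb p (ordElt p 2 1)) = -⟨2 * m, 1⟩ := by
      rw [ordEmb_ordElt]
      ext
      · simp [ha₀, hm']; ring
      · simp [ha₀]; ring
    have hnorm : (⟨2 * m, 1⟩ : QuadField p) * ⟨2 * m, -1⟩ = ((4 * m ^ 2 + p : ℤ) : QuadField p) := by
      rw [intCast_eq_mk]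
      ext
      · simp; ring
      · simp
    obtain ⟨n, hn, hny⟩ : ((2 * m + 1 : ℤ) : QuadField p) * y + ⟨2 * m, 1⟩ * x ∈ locTwo p := by
      have e : ((2 * m + 1 : ℤ) : QuadField p) * y + ⟨2 * m, 1⟩ * x =
          -(((2 * m + 1 : ℤ) : QuadField p) * ((⟨0, 1⟩ : QuadField p) * x - y)) +
          (⟨m, m + 1⟩ : QuadField p) * (2 * x) := by
        have e2 : ((2 * m + 1 : ℤ) : QuadField p) * ⟨0, 1⟩ + ⟨2 * m, 1⟩ =
            (⟨m, m + 1⟩ : QuadField p) + ⟨m, m + 1⟩ := by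
          rw [intCast_eq_mk]
          ext
          · simp; ring
          · simp; ring
        linear_combination x * e2
      rw [e]
      exact add_mem (neg_mem (mul_mem (intCast_mem _ _) hxy)) (mul_mem
        (rootRing_le_locTwo ⟨m, m + 1, by push_cast; rfl⟩) (rootRing_le_locTwo hx))
    have h1 : quat q (((2 * m + 1 : ℤ) : QuadField p) * x) (-(⟨2 * m, 1⟩ * x)) ∈
        conjOrder p q r (idealTwo p) := by
      have h2 : quat q x x ∈ maxOrder p q r := by
        obtain ⟨b, c, hbc⟩ := hx
        rw [two_mul] at hbc
        have e1 := congrArg QuadraticAlgebra.re hbc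
        have e2 := congrArg QuadraticAlgebra.im hbc
        simp at e1 e2
        refine (mem_maxOrder p).2 ⟨0, b, c, 0, ?_⟩
        ext <;> simp [quat] <;> linarith
      convert mem_conjOrder_of_mem ha₀mem h2 hb₀mem using 1
      congr 1
      · rw [← hab]; ring
      · rw [mul_right_comm, hab']; ring
    have h2 : quat q 0 (((4 * m ^ 2 + p : ℤ) : QuadField p) *
        ((n : QuadField p) * (((2 * m + 1 : ℤ) : QuadField p) * y + ⟨2 * m, 1⟩ * x))) ∈
        conjOrder p q r (idealTwo p) := by
      set ρ : QuadField p := (n : QuadField p) * (((2 * m + 1 : ℤ) : QuadField p) * y + ⟨2 * m, 1⟩ * x)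
      have h3 : -(⟨2 * m, -1⟩ * ρ) ∈ rootRing p :=
        neg_mem (mul_mem ⟨2 * m, -1, by simp⟩ hny)
      have h4 : quat q 0 (-(⟨2 * m, -1⟩ * ρ)) ∈ maxOrder p q r := by
        rw [maxOrder_eq_localLattice hq hr, quat_mem_localLattice]
        refine ⟨by rw [mul_zero]; exact zero_mem _, fun d hd ↦ ?_, ?_⟩
        · refine rootRing_le_invertTwo (mul_mem h3 ?_)
          rcases hd with rfl | rfl
          · exact natCast_mem _ _
          · exact ⟨r, -1, by simp⟩
        · rw [mul_zero, zero_sub]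
          exact neg_mem (rootRing_le_locTwo h3)
      convert mem_conjOrder_of_mem ha₀mem h4 hb₀mem using 1
      congr 1
      · ring
      · rw [← hnorm, mul_right_comm a₀, hab']; ring
    have hodd : (n * (4 * m ^ 2 + p) * (2 * m + 1) : ℤ) • w ∈ conjOrder p q r (idealTwo p) := by
      convert add_mem (Submodule.smul_mem _ (n * (4 * m ^ 2 + p)) h1) h2 using 1
      rw [hw', intCast_smul_quat, intCast_smul_quat, quat_add]
      push_cast
      congr 1 <;> ring
    refine mem_of_odd_smul_mem_of_pow_smul_mem ?_ hodd hpow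
    have hp' : Odd (4 * m ^ 2 + (p : ℤ)) := by
      rw [hm]
      exact ⟨2 * m ^ 2 + 2 * m, by ring⟩
    exact (hn.mul hp').mul ⟨m, rfl⟩

end

end SupersingularOrders

end

/-! ### From ring classes to isomorphic orders -/

noncomputable section

set_option linter.unusedSectionVars false

namespace SupersingularOrders

section

variable {p : ℕ} [Fact p.Prime]

lemma exists_coprime_of_mem_oddElements {u : 𝓞 (QuadField p)} (hu : u ∈ oddElements p) :
    ∃ a : ℤ, IsCoprime a ((2 : ℕ) : ℤ) ∧
      ((2 : ℕ) : 𝓞 (QuadField p)) ∣ u - (a : 𝓞 (QuadField p)) := by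
  obtain ⟨x, y, ⟨k, rfl⟩, rfl⟩ := hu
  refine ⟨2 * k + 1, ⟨1, -k, by push_cast; ring⟩, y * sqrtNeg p, ?_⟩
  simp only [elt]; push_cast; ring

lemma exists_coprime_of_mem_rayElements {u : 𝓞 (QuadField p)} (hu : u ∈ rayElements p) :
    ∃ a : ℤ, IsCoprime a ((4 : ℕ) : ℤ) ∧
      ((4 : ℕ) : 𝓞 (QuadField p)) ∣ u - (a : 𝓞 (QuadField p)) := by
  obtain ⟨x, y, ⟨k, rfl⟩, rfl⟩ := hu
  refine ⟨2 * k + 1, ?_, 2 * y * sqrtNeg p, ?_⟩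
  · exact IsCoprime.pow_right (n := 2) (y := (2 : ℤ)) ⟨1, -k, by ring⟩
  · simp only [elt]; push_cast; ring

/-- If `u` and `v` are congruent to integers prime to `f`, then the quotient of `v O_K` by `u O_K`
lies in `P_ℤ(f)`. -/
lemma memCoset_of_span_mul_eq {f : ℕ} {u v : 𝓞 (QuadField p)} (hu0 : u ≠ 0) (hv0 : v ≠ 0)
    (hu : ∃ a : ℤ, IsCoprime a (f : ℤ) ∧ (f : 𝓞 (QuadField p)) ∣ u - (a : 𝓞 (QuadField p)))
    (hv : ∃ a : ℤ, IsCoprime a (f : ℤ) ∧ (f : 𝓞 (QuadField p)) ∣ v - (a : 𝓞 (QuadField p)))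
    {Q A : Ideal (𝓞 (QuadField p))} (h : Ideal.span {u} * Q = Ideal.span {v} * A) :
    MemCoset p f Q A := by
  have hne {w : 𝓞 (QuadField p)} (hw : w ≠ 0) : FractionalIdeal.spanSingleton (𝓞 (QuadField p))⁰
      (algebraMap (𝓞 (QuadField p)) (QuadField p) w) ≠ 0 := by
    rw [Ne, FractionalIdeal.spanSingleton_eq_zero_iff]
    exact fun h0 ↦ hw (algebraMap_inj.1 (h0.trans (map_zero _).symm))
  obtain ⟨a, ha, hau⟩ := hu
  obtain ⟨b, hb, hbv⟩ := hv
  refine ⟨Units.mk0 _ (hne hv0) * (Units.mk0 _ (hne hu0))⁻¹, mul_mem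
    (Subgroup.subset_closure ⟨v, b, hb, hbv, rfl⟩)
    (inv_mem (Subgroup.subset_closure ⟨u, a, ha, hau, rfl⟩)), ?_⟩
  have h1 := congrArg (fun I : Ideal (𝓞 (QuadField p)) ↦
    (I : FractionalIdeal (𝓞 (QuadField p))⁰ (QuadField p))) h
  simp only [FractionalIdeal.coeIdeal_mul, FractionalIdeal.coeIdeal_span_singleton] at h1
  rw [Units.val_mul, Units.val_inv_eq_inv_val, Units.val_mk0, Units.val_mk0, ← mul_assoc,
    mul_comm _ (FractionalIdeal.spanSingleton _ _), ← h1, mul_right_comm, mul_inv_cancel₀ (hne hu0),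
    one_mul]

/-- The norm of an element of `O_K` as a product with the conjugate. -/
lemma mul_star_eq (z : 𝓞 (QuadField p)) : algebraMap (𝓞 (QuadField p)) (QuadField p) z *
    star (algebraMap (𝓞 (QuadField p)) (QuadField p) z) =
      (Ideal.absNorm (Ideal.span {z}) : QuadField p) := by
  set x := algebraMap (𝓞 (QuadField p)) (QuadField p) z with hx
  have h1 : ((Algebra.norm ℤ z : ℤ) : ℚ) = x.re ^ 2 + p * x.im ^ 2 := by
    rw [← norm_eq, hx]
    exact Algebra.coe_norm_int z
  have h2 : 0 ≤ Algebra.norm ℤ z := by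
    have : (0 : ℚ) ≤ ((Algebra.norm ℤ z : ℤ) : ℚ) := by rw [h1]; positivity
    exact_mod_cast this
  have h3 : ((Ideal.absNorm (Ideal.span {z}) : ℕ) : QuadField p) =
      ((Algebra.norm ℤ z : ℤ) : QuadField p) := by
    rw [Ideal.absNorm_span_singleton, ← Int.cast_natCast (R := QuadField p),
      Int.natAbs_of_nonneg h2]
  rw [h3, intCast_eq_mk, h1]
  ext
  · simp; ring
  · simp; ring

/-- As `q ≡ 3` modulo `4`, `-1` is not a square modulo `q`, whereas `-p` is one. -/
lemma admissible_of_dvd {q : ℕ} (hq : q.Prime) (hq8 : q % 8 = 3) (hqp : q ≠ p) {r : ℤ}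
    (hr : (q : ℤ) ∣ r ^ 2 + p) : Admissible p q := by
  have : Fact q.Prime := ⟨hq⟩
  refine ⟨hq, hq8, ?_⟩
  rw [← jacobiSym.legendreSym.to_jacobiSym]
  have hp0 : ((-(p : ℤ) : ℤ) : ZMod q) ≠ 0 := by
    rw [Ne, ZMod.intCast_zmod_eq_zero_iff_dvd, dvd_neg]
    intro h
    have h' : q ∣ p := by exact_mod_cast h
    exact hqp ((Nat.prime_dvd_prime_iff_eq hq Fact.out).1 h')
  have h1 : legendreSym q (-(p : ℤ)) = 1 := by
    rw [legendreSym.eq_one_iff q hp0]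
    refine ⟨(r : ZMod q), ?_⟩
    have h2 : ((r ^ 2 + p : ℤ) : ZMod q) = 0 := (ZMod.intCast_zmod_eq_zero_iff_dvd _ _).2 hr
    push_cast at h2 ⊢
    linear_combination -h2
  have h3 : legendreSym q (-1) = -1 := by
    rw [legendreSym.at_neg_one (by omega), ZMod.χ₄_nat_three_mod_four (by omega)]
  have h4 : legendreSym q (-(p : ℤ)) = legendreSym q (-1) * legendreSym q p := by
    rw [← legendreSym.mul]; congr 1; ring
  rw [h1, h3] at h4
  linarith

/-- In the residue field `ℤ/q` of a prime ideal of degree one `√-p` is congruent to an integer. -/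
lemma exists_elt_mem {Q : Ideal (𝓞 (QuadField p))} {q : ℕ} (hq : q.Prime)
    (hQ : Ideal.absNorm Q = q) : ∃ r : ℤ, elt p r (-1) ∈ Q := by
  have : Fact q.Prime := ⟨hq⟩
  have hcard : Nat.card (𝓞 (QuadField p) ⧸ Q) = q := hQ
  have hne : (Ideal.Quotient.mk Q 1) ≠ 0 := by
    rw [Ne, Ideal.Quotient.eq_zero_iff_mem, ← Ideal.eq_top_iff_one, ← Ideal.absNorm_eq_one_iff, hQ]
    exact hq.one_lt.ne'
  obtain ⟨r, hr⟩ : Ideal.Quotient.mk Q (sqrtNeg p) ∈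
      AddSubgroup.zmultiples (Ideal.Quotient.mk Q 1) :=
    mem_zmultiples_of_prime_card hcard hne
  refine ⟨r, ?_⟩
  simp only [zsmul_eq_mul, map_one, mul_one] at hr
  rw [← Ideal.Quotient.eq_zero_iff_mem, elt, map_add, map_intCast, hr]
  simp

lemma dvd_of_elt_mem {Q : Ideal (𝓞 (QuadField p))} {q : ℕ} (hq : q.Prime) (hQ : Q ≠ ⊤)
    (hqQ : (q : 𝓞 (QuadField p)) ∈ Q) {r : ℤ} (hr : elt p r (-1) ∈ Q) : (q : ℤ) ∣ r ^ 2 + p := by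
  refine dvd_of_intCast_mem hQ hq hqQ ?_
  have : ((r ^ 2 + p : ℤ) : 𝓞 (QuadField p)) = elt p r 1 * elt p r (-1) := by
    rw [elt_mul, elt_intCast]; congr 1 <;> ring
  rw [this]
  exact Q.mul_mem_left _ hr

/-- The two square roots of `-p` modulo `q'` belong to the two primes above `q'`, and lead to
isomorphic orders. -/
lemma isomorphicRings_localLattice_of_dvd {q q' : ℕ} (hq' : q'.Prime) (hq4 : q' % 4 = 3)
    {Q : Ideal (𝓞 (QuadField p))} (hQ : Q.IsPrime)
    (hqQ : (q' : 𝓞 (QuadField p)) ∈ Q) {D : Set (QuadField p)}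
    {e e' : QuadField p} (he : e ∈ locTwo p) (he' : e' ∈ locTwo p) (hee' : e * e' = 1)
    {u v : 𝓞 (QuadField p)} (hu : u ∈ oddElements p) (hv : v ∈ oddElements p) {δ : QuadField p}
    (hδ : (q : QuadField p) * (δ * star δ) = q')
    (hδe : δ = e * (algebraMap (𝓞 (QuadField p)) (QuadField p) v /
      algebraMap (𝓞 (QuadField p)) (QuadField p) u))
    (hD : ∀ d ∈ D, ∃ z ∈ Q, δ * d = algebraMap (𝓞 (QuadField p)) (QuadField p) z)
    (hD' : ∀ z ∈ Q, ∃ d ∈ D, δ * d = algebraMap (𝓞 (QuadField p)) (QuadField p) z)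
    {r : ℤ} (hr : (q' : ℤ) ∣ r ^ 2 + p) :
    IsomorphicRings (localLattice q D e) (maxOrder p q' r) := by
  have hmem : elt p r (-1) * elt p r 1 ∈ Q := by
    obtain ⟨m, hm⟩ := hr
    have : elt p r (-1) * elt p r 1 = m * q' := by
      rw [elt_mul]
      have h1 : r * r - p * -1 * 1 = m * q' := by linear_combination hm
      have h2 : r * 1 + -1 * r = 0 := by ring
      rw [h1, h2, elt]; push_cast; ring
    rw [this]
    exact Q.mul_mem_left _ hqQ
  rcases hQ.mem_or_mem hmem with h | h
  · exact isomorphicRings_localLattice hq' hq4 hr hQ.ne_top hqQ h he he' hee' hu hv hδ hδe hD hD'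
  · have h' : elt p (-r) (-1) ∈ Q := by
      rw [← elt_neg]
      exact neg_mem h
    exact (isomorphicRings_localLattice hq' hq4 (by rwa [neg_sq]) hQ.ne_top hqQ h' he he' hee' hu hv
      hδ hδe hD hD').trans (isomorphicRings_maxOrder_neg hq4 hr)

lemma extend_mul (I J : Ideal (order p)) : extend p (I * J) = extend p I * extend p J :=
  Ideal.map_mul _ _ _

/-- The norm modulo `8` only depends on the class. -/
lemma absNorm_mod_eight {u v : 𝓞 (QuadField p)} (hu : u ∈ rayElements p) (hv : v ∈ rayElements p)
    {Q A : Ideal (𝓞 (QuadField p))} (h : Ideal.span {u} * Q = Ideal.span {v} * A) :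
    Ideal.absNorm Q % 8 = Ideal.absNorm A % 8 := by
  have h1 := congrArg (Ideal.absNorm · % 8) h
  simp only [map_mul] at h1
  rw [Nat.mul_mod, Nat.mul_mod (Ideal.absNorm (Ideal.span {v})),
    absNorm_mod_eight_of_mem_rayElements hu, absNorm_mod_eight_of_mem_rayElements hv] at h1
  simpa using h1

/-- A prime ideal of degree one in the class of `A = [q₁, 2r₁ - 2√-p] 𝔩² O_K`, say `u Q₂ = v A`,
yields the isomorphism given by `δ = l v / u`. -/
lemma exists_prime_conjOrder_of_degreeOne (hp : 3 < p) {q₁ : ℕ} (hq₁ : Admissible p q₁)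
    {r₁ : ℤ} (hr₁ : (q₁ : ℤ) ∣ r₁ ^ 2 + p) {l : ℕ} {L : Ideal (order p)} (hl : l.Prime)
    (hl2 : l ≠ 2) (hL : Submodule.cardQuot L = l) :
    ∃ (q₂ : ℕ) (Q₂ : Ideal (𝓞 (QuadField p))), Admissible p q₂ ∧
      Q₂.IsPrime ∧ Ideal.absNorm Q₂ = q₂ ∧
      MemCoset p 2 Q₂ (extend p (idealQConj p q₁ r₁ * L ^ 2)) ∧
      MemCoset p 4 Q₂ (extend p (idealQConj p q₁ r₁ * L ^ 2)) ∧
      (∃ r₂ : ℤ, (q₂ : ℤ) ∣ r₂ ^ 2 + p) ∧ ∀ r₂ : ℤ, (q₂ : ℤ) ∣ r₂ ^ 2 + p →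
        IsomorphicRings (conjOrder p q₁ r₁ L) (maxOrder p q₂ r₂) := by
  obtain ⟨hq₁p, hq₁8, -⟩ := hq₁
  have hq₁2 : q₁ ≠ 2 := by rintro rfl; omega
  obtain ⟨s, hs⟩ := exists_isDegreeOne_of_cardQuot hl hL
  set A := extend p (idealQConj p q₁ r₁ * L ^ 2) with hA
  have hNA : Ideal.absNorm A = q₁ * l ^ 2 := by
    rw [hA, extend_mul, pow_two, extend_mul, map_mul, map_mul, hs.absNorm_extend hl hl2,
      (isDegreeOne_idealQConj hr₁).absNorm_extend hq₁p hq₁2, pow_two]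
  have hlo : Odd l := hl.odd_of_ne_two hl2
  have hAodd : Odd (Ideal.absNorm A) := by
    rw [hNA]
    exact (hq₁p.odd_of_ne_two hq₁2).mul hlo.pow
  obtain ⟨Q, hQ, ⟨q₂, hq₂, hq₂p, hNQ⟩, u, hu, v, hv, huv⟩ := exists_prime_mul_eq hp hAodd
  have hl8 : l ^ 2 % 8 = 1 := by
    have : l % 8 = 1 ∨ l % 8 = 3 ∨ l % 8 = 5 ∨ l % 8 = 7 := by
      obtain ⟨k, rfl⟩ := hlo
      omega
    rcases this with h | h | h | h <;> simp [Nat.pow_mod, h]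
  have hq₂8 : q₂ % 8 = 3 := by
    rw [← hNQ, absNorm_mod_eight hu hv huv, hNA, Nat.mul_mod, hl8, hq₁8]
  have hqQ : (q₂ : 𝓞 (QuadField p)) ∈ Q := hNQ ▸ Ideal.absNorm_mem Q
  obtain ⟨r, hr⟩ := exists_elt_mem hq₂ hNQ
  have hr' := dvd_of_elt_mem hq₂ hQ.ne_top hqQ hr
  have hu' := rayElements_le_oddElements hu
  have hv' := rayElements_le_oddElements hv
  have hu0 := ne_zero_of_mem_rayElements hu
  have hv0 := ne_zero_of_mem_rayElements hv
  refine ⟨q₂, Q, admissible_of_dvd hq₂ hq₂8 hq₂p hr', hQ, hNQ,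
    memCoset_of_span_mul_eq hu0 hv0 (exists_coprime_of_mem_oddElements hu')
      (exists_coprime_of_mem_oddElements hv') huv,
    memCoset_of_span_mul_eq hu0 hv0 (exists_coprime_of_mem_rayElements hu)
      (exists_coprime_of_mem_rayElements hv) huv, ⟨r, hr'⟩, fun r₂ hr₂ ↦ ?_⟩
  rw [conjOrder_eq_localLattice hq₁p hq₁2 hr₁ hs hl hl2]
  have hlodd : ((l : ℕ) : 𝓞 (QuadField p)) ∈ oddElements p :=
    rayElements_le_oddElements (natCast_mem_rayElements hlo)
  have huK := algebraMap_oddElements_ne_zero hu'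
  have hvK := algebraMap_oddElements_ne_zero hv'
  have hl0 : (l : QuadField p) ≠ 0 := by exact_mod_cast hl.ne_zero
  set U := algebraMap (𝓞 (QuadField p)) (QuadField p) u with hU
  set V := algebraMap (𝓞 (QuadField p)) (QuadField p) v with hV
  refine isomorphicRings_localLattice_of_dvd hq₂ (by omega) hQ hqQ (e := 1) (e' := 1)
    (δ := l * V / U) (u := u) (v := l * v) (one_mem _) (one_mem _) (one_mul _) hu'
    (mul_mem hlodd hv') ?_ ?_ ?_ ?_ hr₂
  · have h1 := congrArg Ideal.absNorm huv
    rw [map_mul, map_mul, hNQ, hNA] at h1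
    have h2 : (Ideal.absNorm (Ideal.span {u}) : QuadField p) * q₂ =
        Ideal.absNorm (Ideal.span {v}) * (q₁ * l ^ 2) := by exact_mod_cast congrArg Nat.cast h1
    rw [← mul_star_eq, ← mul_star_eq, ← hU, ← hV] at h2
    have h3 : star (l : QuadField p) = l := star_natCast _
    have h4 : star U ≠ 0 := star_ne_zero.2 huK
    rw [star_div₀, star_mul, h3]
    field_simp
    linear_combination -h2
  · rw [map_mul, map_natCast, one_mul]
  · rintro _ ⟨z, hz, rfl⟩
    have h1 : v * z ∈ Ideal.span {u} * Q := by
      rw [huv]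
      exact Ideal.mul_mem_mul (Ideal.mem_span_singleton_self v) hz
    obtain ⟨z', hz', h2⟩ := Ideal.mem_span_singleton_mul.1 h1
    refine ⟨z', hz', ?_⟩
    have h3 := congrArg (algebraMap (𝓞 (QuadField p)) (QuadField p)) h2
    rw [map_mul, map_mul] at h3
    field_simp
    linear_combination -h3
  · intro z hz
    have h1 : u * z ∈ Ideal.span {v} * A := by
      rw [← huv]
      exact Ideal.mul_mem_mul (Ideal.mem_span_singleton_self u) hz
    obtain ⟨z', hz', h2⟩ := Ideal.mem_span_singleton_mul.1 h1
    refine ⟨_, ⟨z', hz', rfl⟩, ?_⟩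
    have h3 := congrArg (algebraMap (𝓞 (QuadField p)) (QuadField p)) h2
    rw [map_mul, map_mul] at h3
    field_simp
    linear_combination h3

/-- A prime ideal of degree one in the class of `A = [q₁, 2r₁ - 2√-p] √-p g O_K`, say `u Q₂ = v A`,
yields the isomorphism given by `δ = √-p v g / u`. -/
lemma exists_prime_conjOrder_idealTwo (hp : 3 < p) (hp4 : p % 4 = 1) {q₁ : ℕ}
    (hq₁ : Admissible p q₁) {r₁ : ℤ} (hr₁ : (q₁ : ℤ) ∣ r₁ ^ 2 + p) :
    ∃ (q₂ : ℕ) (Q₂ : Ideal (𝓞 (QuadField p))), Admissible p q₂ ∧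
      Q₂.IsPrime ∧ Ideal.absNorm Q₂ = q₂ ∧
      MemClassCoset p 2 Q₂ (idealQConj p q₁ r₁ * idealTwo p ^ 2) ∧
      (∃ r₂ : ℤ, (q₂ : ℤ) ∣ r₂ ^ 2 + p) ∧ ∀ r₂ : ℤ, (q₂ : ℤ) ∣ r₂ ^ 2 + p →
        IsomorphicRings (conjOrder p q₁ r₁ (idealTwo p)) (maxOrder p q₂ r₂) := by
  obtain ⟨hq₁p, hq₁8, -⟩ := hq₁
  have hq₁2 : q₁ ≠ 2 := by rintro rfl; omega
  have hpo : Odd p := Nat.odd_iff.2 (by omega)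
  have hq₁o : Odd q₁ := hq₁p.odd_of_ne_two hq₁2
  set E := extend p (idealQConj p q₁ r₁) with hE
  -- multiplication by `1 + 2√-p`, of norm `1 + 4p`, does not change the class modulo `2` but
  -- changes the residue of the norm modulo `8`
  obtain ⟨g, hg, hgN⟩ : ∃ g ∈ oddElements p, p * Ideal.absNorm (Ideal.span {g}) % 8 = 1 := by
    rcases (by omega : p % 8 = 1 ∨ p % 8 = 5) with h | h
    · refine ⟨1, one_mem _, ?_⟩
      rw [Ideal.span_singleton_one, Ideal.absNorm_top, mul_one, h]
    · refine ⟨elt p 1 (2 * 1), ⟨1, 1, odd_one, rfl⟩, ?_⟩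
      have h1 := absNorm_span_elt p 1 (2 * 1)
      have h2 : Ideal.absNorm (Ideal.span {elt p 1 (2 * 1)}) = 1 + 4 * p := by
        have : (Ideal.absNorm (Ideal.span {elt p 1 (2 * 1)}) : ℤ) = (1 + 4 * p : ℕ) := by
          rw [h1]; push_cast; ring
        exact_mod_cast this
      rw [h2, Nat.mul_mod, Nat.add_mod, Nat.mul_mod 4, h]
  set A := E * Ideal.span {sqrtNeg p} * Ideal.span {g} with hA
  have hNA : Ideal.absNorm A = q₁ * (p * Ideal.absNorm (Ideal.span {g})) := by
    rw [hA, map_mul, map_mul, absNorm_span_sqrtNeg,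
      (isDegreeOne_idealQConj hr₁).absNorm_extend hq₁p hq₁2, mul_assoc]
  have hAodd : Odd (Ideal.absNorm A) := by
    rw [hNA]
    exact hq₁o.mul (Nat.odd_iff.2 (by omega))
  obtain ⟨Q, hQ, ⟨q₂, hq₂, hq₂p, hNQ⟩, u, hu, v, hv, huv⟩ := exists_prime_mul_eq hp hAodd
  have hq₂8 : q₂ % 8 = 3 := by
    rw [← hNQ, absNorm_mod_eight hu hv huv, hNA, Nat.mul_mod, hgN, hq₁8]
  have hqQ : (q₂ : 𝓞 (QuadField p)) ∈ Q := hNQ ▸ Ideal.absNorm_mem Q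
  obtain ⟨r, hr⟩ := exists_elt_mem hq₂ hNQ
  have hr' := dvd_of_elt_mem hq₂ hQ.ne_top hqQ hr
  have hu' := rayElements_le_oddElements hu
  have hv' := rayElements_le_oddElements hv
  have huK := algebraMap_oddElements_ne_zero hu'
  have hvK := algebraMap_oddElements_ne_zero hv'
  have hgK := algebraMap_oddElements_ne_zero hg
  have hu0 := ne_zero_of_mem_rayElements hu
  have hv0 := ne_zero_of_mem_rayElements hv
  have hg0 : g ≠ 0 := by rintro rfl; exact hgK (map_zero _)
  refine ⟨q₂, Q, admissible_of_dvd hq₂ hq₂8 hq₂p hr', hQ, hNQ,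
    ⟨idealQConj p q₁ r₁ * idealRamified p, ?_, ⟨twoSqrt p, 16, ?_, ?_, ?_⟩, ?_⟩, ⟨r, hr'⟩,
    fun r₂ hr₂ ↦ ?_⟩
  · rw [Ideal.eq_top_iff_one]
    have h1 : (q₁ : order p) * p ∈ idealQConj p q₁ r₁ * idealRamified p :=
      Ideal.mul_mem_mul (isDegreeOne_idealQConj hr₁).natCast_mem (Ideal.subset_span (Or.inl rfl))
    obtain ⟨k, hk⟩ := hq₁o.mul hpo
    have h2 : (1 : order p) = q₁ * p + (-k : order p) * ((2 : ℕ) : order p) := by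
      have : ((q₁ * p : ℕ) : order p) = ((2 * k + 1 : ℕ) : order p) := congrArg _ hk
      push_cast at this
      rw [this]; push_cast; ring
    rw [h2]
    exact Ideal.add_mem _ (Ideal.mem_sup_left h1) (Ideal.mem_sup_right
      (Ideal.mul_mem_left _ _ (Ideal.mem_span_singleton_self _)))
  · intro h0
    have : ordElt p 0 1 = ordElt p 0 0 := by simpa [ordElt] using h0
    exact one_ne_zero (ordElt_inj.1 this).2
  · exact OfNat.ofNat_ne_zero 16
  · rw [mul_left_comm, span_twoSqrt_mul_idealTwo_sq hp4, mul_left_comm]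
  · refine memCoset_of_span_mul_eq (v := v * g) hu0 (mul_ne_zero hv0 hg0)
      (exists_coprime_of_mem_oddElements hu')
      (exists_coprime_of_mem_oddElements (mul_mem hv' hg)) ?_
    rw [huv, extend_mul, extend_idealRamified hpo, ← Ideal.span_singleton_mul_span_singleton,
      mul_assoc, mul_comm (Ideal.span {g})]
  rw [conjOrder_idealTwo_eq_localLattice hp4 hq₁o hr₁]
  set U := algebraMap (𝓞 (QuadField p)) (QuadField p) u with hU
  set V := algebraMap (𝓞 (QuadField p)) (QuadField p) v with hV
  set G := algebraMap (𝓞 (QuadField p)) (QuadField p) g with hG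
  have hp0 : (p : ℚ) ≠ 0 := by
    have : p ≠ 0 := by omega
    exact_mod_cast this
  set S : QuadField p := ⟨0, 1⟩ with hS
  have hSalg : algebraMap (𝓞 (QuadField p)) (QuadField p) (sqrtNeg p) = S := rfl
  refine isomorphicRings_localLattice_of_dvd hq₂ (by omega) hQ hqQ (e := S)
    (e' := ⟨0, -1 / p⟩) (δ := S * (V * G / U)) (u := u) (v := v * g)
    (rootRing_le_locTwo ⟨0, 1, by simp [hS]⟩)
    ⟨p, by exact_mod_cast hpo, 0, -1, ?_⟩ ?_ hu'
    (mul_mem hv' hg) ?_ ?_ ?_ ?_ hr₂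
  · ext
    · simp
    · simp; field_simp
  · ext
    · simp [hS, QuadraticAlgebra.re_one]; field_simp
    · simp [hS, QuadraticAlgebra.im_one]
  · have h1 := congrArg Ideal.absNorm huv
    rw [map_mul, map_mul, hNQ, hNA] at h1
    have h2 : (Ideal.absNorm (Ideal.span {u}) : QuadField p) * q₂ =
        Ideal.absNorm (Ideal.span {v}) * (q₁ * (p * Ideal.absNorm (Ideal.span {g}))) := by
      exact_mod_cast congrArg Nat.cast h1
    rw [← mul_star_eq, ← mul_star_eq, ← mul_star_eq, ← hU, ← hV, ← hG] at h2
    have h3 : S * star S = p := by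
      rw [← hSalg, mul_star_eq, absNorm_span_sqrtNeg]
    have h4 : star U ≠ 0 := star_ne_zero.2 huK
    rw [star_mul, star_div₀, star_mul]
    have h5 : (q₁ : QuadField p) * (S * (V * G / U) * (star G * star V / star U * star S)) =
        q₁ * ((S * star S) * (V * star V) * (G * star G)) / (U * star U) := by
      field_simp
    rw [h5, h3, div_eq_iff (mul_ne_zero huK h4)]
    linear_combination -h2
  · rw [map_mul]
  · rintro _ ⟨z, hz, rfl⟩
    have h1 : v * (z * sqrtNeg p * g) ∈ Ideal.span {u} * Q := by
      rw [huv]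
      exact Ideal.mul_mem_mul (Ideal.mem_span_singleton_self v) (Ideal.mul_mem_mul
        (Ideal.mul_mem_mul hz (Ideal.mem_span_singleton_self _)) (Ideal.mem_span_singleton_self _))
    obtain ⟨z', hz', h2⟩ := Ideal.mem_span_singleton_mul.1 h1
    refine ⟨z', hz', ?_⟩
    have h3 := congrArg (algebraMap (𝓞 (QuadField p)) (QuadField p)) h2
    rw [map_mul, map_mul, map_mul, map_mul, hSalg, ← hU, ← hV, ← hG] at h3
    field_simp
    linear_combination -h3
  · intro z hz
    have h1 : u * z ∈ Ideal.span {v} * A := by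
      rw [← huv]
      exact Ideal.mul_mem_mul (Ideal.mem_span_singleton_self u) hz
    obtain ⟨a, ha, h2⟩ := Ideal.mem_span_singleton_mul.1 h1
    obtain ⟨b, hb, rfl⟩ := Ideal.mem_mul_span_singleton.1 ha
    obtain ⟨c, hc, rfl⟩ := Ideal.mem_mul_span_singleton.1 hb
    refine ⟨_, ⟨c, hc, rfl⟩, ?_⟩
    have h3 := congrArg (algebraMap (𝓞 (QuadField p)) (QuadField p)) h2
    rw [map_mul, map_mul, map_mul, map_mul, hSalg, ← hU, ← hV, ← hG] at h3
    field_simp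
    linear_combination h3

end

end SupersingularOrders

end

theorem mainTheorem6 (p : ℕ) [Fact p.Prime] (hp : 3 < p)
    (q₁ : ℕ) (hq₁ : SupersingularOrders.Admissible p q₁)
    (r₁ : ℤ) (hr₁ : (q₁ : ℤ) ∣ r₁ ^ 2 + p) :
    (∀ (l : ℕ) (L : Ideal (SupersingularOrders.order p)), l.Prime → l ≠ 2 →
      Submodule.cardQuot L = l →
      ∃ (q₂ : ℕ) (Q₂ : Ideal (NumberField.RingOfIntegers (SupersingularOrders.QuadField p))),
        SupersingularOrders.Admissible p q₂ ∧
        Q₂.IsPrime ∧ Ideal.absNorm Q₂ = q₂ ∧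
        (p % 4 = 1 → SupersingularOrders.MemCoset p 2 Q₂
          (SupersingularOrders.extend p (SupersingularOrders.idealQConj p q₁ r₁ * L ^ 2))) ∧
        (p % 4 = 3 → SupersingularOrders.MemCoset p 4 Q₂
          (SupersingularOrders.extend p (SupersingularOrders.idealQConj p q₁ r₁ * L ^ 2))) ∧
        (∃ r₂ : ℤ, (q₂ : ℤ) ∣ r₂ ^ 2 + p) ∧
        ∀ r₂ : ℤ, (q₂ : ℤ) ∣ r₂ ^ 2 + p →
          SupersingularOrders.IsomorphicRings
            (SupersingularOrders.conjOrder p q₁ r₁ L) (SupersingularOrders.maxOrder p q₂ r₂)) ∧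
    (p % 4 = 1 →
      SupersingularOrders.IsProperIdeal p (SupersingularOrders.idealTwo p) ∧
      ∃ (q₂ : ℕ) (Q₂ : Ideal (NumberField.RingOfIntegers (SupersingularOrders.QuadField p))),
        SupersingularOrders.Admissible p q₂ ∧
        Q₂.IsPrime ∧ Ideal.absNorm Q₂ = q₂ ∧
        SupersingularOrders.MemClassCoset p 2 Q₂
          (SupersingularOrders.idealQConj p q₁ r₁ * SupersingularOrders.idealTwo p ^ 2) ∧
        (∃ r₂ : ℤ, (q₂ : ℤ) ∣ r₂ ^ 2 + p) ∧
        ∀ r₂ : ℤ, (q₂ : ℤ) ∣ r₂ ^ 2 + p →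
          SupersingularOrders.IsomorphicRings
            (SupersingularOrders.conjOrder p q₁ r₁ (SupersingularOrders.idealTwo p))
            (SupersingularOrders.maxOrder p q₂ r₂)) := by
  refine ⟨fun l L hl hl2 hL ↦ ?_, fun hp4 ↦ ⟨?_, ?_⟩⟩
  · obtain ⟨q₂, Q₂, h1, h2, h3, h4, h5, h6, h7⟩ :=
      SupersingularOrders.exists_prime_conjOrder_of_degreeOne hp hq₁ hr₁ hl hl2 hL
    exact ⟨q₂, Q₂, h1, h2, h3, fun _ ↦ h4, fun _ ↦ h5, h6, h7⟩
  · exact SupersingularOrders.isProperIdeal_idealTwo hp4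
  · exact SupersingularOrders.exists_prime_conjOrder_idealTwo hp hp4 hq₁ hr₁
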